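/- Fix $G>0$ and a smooth convex function $e_0$ on $(0,\infty)$, and put $p(\rho)=-e_0'(1/\rho)$. For $\xi\ge 0$ consider the compressible Maxwell viscoelastic flow system on $\mathbb R^3$ for the density $\rho>0$, the velocity $u$, the invertible deformation gradient $F$ and the symmetric positive definite metric $A$: $$\partial_t\rho+\operatorname{div}(\rho u)=0,\qquad \partial_t(\rho u)+\operatorname{div}(\rho u\otimes u-\sigma)=0,\qquad \sigma=-p(\rho)I+\rho G\,(FAF^T-I),$$ $$\partial_t(\rho F_{ia})+\sum_j\partial_j\big(\rho F_{ia}u_j-u_i\,\rho F_{ja}\big)=0,\qquad \sum_j\partial_j(\rho F_{ja})=0,\qquad (\partial_t+u\cdot\nabla)A=\xi\,(F^{-1}F^{-T}-A),$$ written as a system of balance laws $\partial_tU+\sum_\alpha\partial_\alpha G_\alpha(U)=\xi\,\Pi(U)$ (with the involution $\sum_j\partial_j(\rho F_{ja})=0$) for the conserved variable $U=(\rho,\rho u,\rho F,\rho A^{-2})\in\mathbb R^{19}$, which takes its values in the domain $\mathcal O=\{U : \rho>0,\ \det F\ne0,\ A=A^T \text{ positive definite}\}$. For $\xi=0$ this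 is compressible neo-Hookean elastodynamics. Let $M\in\mathbb R$, $\xi_2\ge0$, and let $U_2$ be a smooth solution with parameter $\xi_2$ on $[0,T)\times\mathbb R^3$ whose initial value coincides, outside a bounded set, with a constant equilibrium state $\bar U\in\mathcal O$ (i.e. $\bar A=\bar F^{-1}\bar F^{-T}$, so that $\Pi(\bar U)=0$). Let $D\subset\mathcal O$ be compact, and let $0<T'<T$; the choice $T'=T$ is allowed too if on $[0,T)\times\mathbb R^3$ the solution $U_2$ takes its values in a compact subset of $\mathcal O$ and is Lipschitz continuous in $x$ uniformly in $t$. Then there is a constant $C$, depending on $G$, $e_0$, $U_2$, $\xi_2$, $M$, $D$ and $T'$ only, such that for every $\xi_1$ with $\xi_2\le\xi_1\le M$ and every smooth solution $U_1$ with parameter $\xi_1$ on $[0,T')\times\mathbb R^3$ which takes its values in $D$ and has the same initial value as $U_2$, $$\|U_1(t)-U_2(t)\|_{L^2(\mathbb R^3)}\le C\,|\xi_1-\xi_2|\qquad\text{for all } t\in(0,T').$$ -/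

import Mathlib

open Set MeasureTheory
open scoped ContDiff Matrix

noncomputable section

namespace MaxwellFlow

/-- The physical space `ℝ³` with its Euclidean norm. -/
abbrev Space : Type := EuclideanSpace ℝ (Fin 3)

/-- Real `3 × 3` matrices. -/
abbrev Mat : Type := Matrix (Fin 3) (Fin 3) ℝ

/-- A pointwise state in physical variables: mass density `ρ`, velocity `u`, deformation
gradient `F` (`F i a`: Eulerian index `i`, material index `a`) and material metric `A`. -/
structure PrimState where
  /-- mass density -/
  ρ : ℝ
  /-- velocity -/
  u : Fin 3 → ℝ
  /-- deformation gradient -/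
  F : Mat
  /-- material metric -/
  A : Mat

/-- Physically admissible states: positive density, invertible deformation gradient and
symmetric positive definite metric. -/
structure PrimState.Admissible (w : PrimState) : Prop where
  ρ_pos : 0 < w.ρ
  F_inv : w.F.det ≠ 0
  A_posDef : w.A.PosDef

/-- The `6` independent entries `(i, j)`, `i ≤ j`, of a symmetric `3 × 3` matrix. -/
abbrev UpperPair : Type := {p : Fin 3 × Fin 3 // p.1 ≤ p.2}

/-- Labels of the `1 + 3 + 9 + 6` components of the conserved variable `U`. -/
abbrev CIdx : Type := Unit ⊕ Fin 3 ⊕ (Fin 3 × Fin 3) ⊕ UpperPair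

/-- The space of values of the conserved variable `U`, with its Euclidean norm. -/
abbrev ConsSpace : Type := EuclideanSpace ℝ CIdx

/-- The vector of `ConsSpace` with given mass, momentum, deformation and metric components. -/
def mkCons (r : ℝ) (m : Fin 3 → ℝ) (H K : Mat) : ConsSpace :=
  WithLp.toLp 2 (Sum.elim (fun _ => r)
    (Sum.elim m (Sum.elim (fun p => H p.1 p.2) (fun p => K p.1.1 p.1.2))))

/-- The change of variables `(ρ, u, F, A) ↦ U = (ρ, ρ u, ρ F, ρ A⁻²)`. -/
def conserved (w : PrimState) : ConsSpace :=
  mkCons w.ρ (w.ρ • w.u) (w.ρ • w.F) (w.ρ • (w.A⁻¹ * w.A⁻¹))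

/-- The hyperbolicity domain, in the variable `U`. -/
def hyperbolicDomain : Set ConsSpace := conserved '' {w | w.Admissible}

/-- The pressure `p = - ∂e₀/∂(ρ⁻¹)`, for a specific energy `e₀` given as a function of the
specific volume `ρ⁻¹`. -/
def pressure (e₀ : ℝ → ℝ) (ρ : ℝ) : ℝ := - deriv e₀ ρ⁻¹

/-- The Cauchy stress `σ = - p I + τ` with extra-stress `τ = ρ G (F A Fᵀ - I)`. -/
def stress (G : ℝ) (e₀ : ℝ → ℝ) (w : PrimState) : Mat :=
  -(pressure e₀ w.ρ • (1 : Mat)) + (w.ρ * G) • (w.F * w.A * w.Fᵀ - 1)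

/-- The flux in direction `α`: `ρ u_α` for the mass, `ρ u_i u_α - σ_{iα}` for the momentum,
`ρ F_{ia} u_α - u_i ρ F_{αa}` for the deformation gradient, and `ρ u_α A⁻²` for the metric. -/
def flux (G : ℝ) (e₀ : ℝ → ℝ) (α : Fin 3) (w : PrimState) : ConsSpace :=
  mkCons (w.ρ * w.u α)
    (fun i => w.ρ * w.u i * w.u α - stress G e₀ w i α)
    (Matrix.of fun i a => w.ρ * w.F i a * w.u α - w.u i * (w.ρ * w.F α a))
    ((w.ρ * w.u α) • (w.A⁻¹ * w.A⁻¹))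

/-- The source term: the relaxation `(∂_t + u·∇) A = ξ (F⁻¹ F⁻ᵀ - A)` of the metric,
written (without the factor `ξ`) for the conserved component `ρ A⁻²`, through
`d (A⁻²) = - (A⁻² dA A⁻¹ + A⁻¹ dA A⁻²)`. -/
def source (w : PrimState) : ConsSpace :=
  mkCons 0 0 0
    (-(w.ρ • ((w.A⁻¹ * w.A⁻¹) * (w.F⁻¹ * (w.F⁻¹)ᵀ - w.A) * w.A⁻¹
      + w.A⁻¹ * (w.F⁻¹ * (w.F⁻¹)ᵀ - w.A) * (w.A⁻¹ * w.A⁻¹))))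

/-- Admissible states at which the relaxation is at equilibrium: `A = F⁻¹ F⁻ᵀ`. -/
structure PrimState.IsEquilibrium (w : PrimState) : Prop where
  admissible : w.Admissible
  relaxed : w.A = w.F⁻¹ * (w.F⁻¹)ᵀ

/-- The partial derivative `∂_α f (x)` of a scalar field on `ℝ³`. -/
def partialDeriv (α : Fin 3) (f : Space → ℝ) (x : Space) : ℝ :=
  fderiv ℝ f x (EuclideanSpace.single α 1)

/-- `w` is smooth on `[0, T) × ℝ³`, up to the initial time. -/
structure IsSmoothField (T : ℝ) (w : ℝ → Space → PrimState) : Prop where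
  ρ : ContDiffOn ℝ ∞ (fun p : ℝ × Space => (w p.1 p.2).ρ) (Ico 0 T ×ˢ univ)
  u : ∀ i, ContDiffOn ℝ ∞ (fun p : ℝ × Space => (w p.1 p.2).u i) (Ico 0 T ×ˢ univ)
  F : ∀ i a, ContDiffOn ℝ ∞ (fun p : ℝ × Space => (w p.1 p.2).F i a) (Ico 0 T ×ˢ univ)
  A : ∀ a b, ContDiffOn ℝ ∞ (fun p : ℝ × Space => (w p.1 p.2).A a b) (Ico 0 T ×ˢ univ)

/-- The field `w`, i.e. `U = conserved ∘ w`, is a smooth solution on `[0, T) × ℝ³` of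
`∂_t U + ∂_α G_α(U) = ξ Π(U)` with the involution `div (ρ Fᵀ) = 0`. -/
structure IsSmoothSolution (G : ℝ) (e₀ : ℝ → ℝ) (ξ T : ℝ) (w : ℝ → Space → PrimState) :
    Prop where
  smooth : IsSmoothField T w
  admissible : ∀ t ∈ Ico 0 T, ∀ x, (w t x).Admissible
  balance : ∀ t ∈ Ioo 0 T, ∀ x, ∀ c : CIdx,
    deriv (fun s => conserved (w s x) c) t
      + ∑ α, partialDeriv α (fun y => flux G e₀ α (w t y) c) x
      = ξ * source (w t x) c
  piola : ∀ t ∈ Ico 0 T, ∀ x, ∀ a : Fin 3,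
    ∑ j, partialDeriv j (fun y => (w t y).ρ * (w t y).F j a) x = 0

/-- `w` stays regular up to time `T`: on `[0, T)`, `U = conserved ∘ w` takes its values in a
compact subset of the hyperbolicity domain, and is Lipschitz in space, uniformly in time. -/
def RegularUpTo (T : ℝ) (w : ℝ → Space → PrimState) : Prop :=
  ∃ K : Set ConsSpace, IsCompact K ∧ K ⊆ hyperbolicDomain ∧
    (∀ t ∈ Ico 0 T, ∀ x, conserved (w t x) ∈ K) ∧
    ∃ L : NNReal, ∀ t ∈ Ico 0 T, LipschitzWith L (fun x => conserved (w t x))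

end MaxwellFlow

end

/-!
The proof compares the two flows through a relative energy. Write `v = u₁ - u₂`, `f = F₁ - F₂`,
`a = A₁ - A₂`, let `ε (τ) = e₀ (τ) - G log τ` be the energy which accounts for the isotropic part of
the stress as a function of the specific volume `τ`, and put
`h = ½ |v|² + ε (τ₁ | τ₂) + G ∑ (½ f A₁ f + f a F₂) + κ / 2 |a|²`,
where `ε (τ₁ | τ₂)` is a first-order Taylor remainder; the elastic part is the remainder of
`½ tr (F A Fᵀ)`. Three facts carry the argument.

* Balance (`energy_balance`). The density `ρ₁ h` satisfies a balance law whose production is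
  quadratic in the difference of the two states, except for the product of this difference with the
  forcing `(ξ₁ - ξ₂) (F₂⁻¹ F₂⁻ᵀ - A₂)`. The identity is exact and algebraic. It needs the Piola
  identity `div (ρ Fᵀ) = 0` of both flows, and it closes because the stress is linear in `F A`: its
  flux contains the differences of `F A` and not those of `F` and `A` separately.
* Coercivity (`relEnergy_coercive`). On bounded sets of states `h` controls the square of the
  difference, once `κ` is large: the cross term `f a F₂` is absorbed by `½ f A₁ f` and `κ / 2 |a|²`,
  while the logarithm makes `ε` strictly convex although `e₀` is only convex. Hence the flux is
  bounded by a multiple of the density, which gives a finite speed of propagation, and the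
  production by a multiple of the density and of the square of the forcing
  (`exists_energy_constants`).
* Local Gronwall inequality (`weighted_energy_estimate`). Integration against a weight which is
  supported in a backward cone and decreases at its boundary faster than the energy flows out
  requires no decay of the solutions at infinity.

The local inequality is used twice. Between `U₂` and the constant equilibrium, which is a solution
for every relaxation parameter, it shows that `U₂` is that equilibrium outside a ball, at all times
(`finite_propagation`); since no bound on `U₂` is available up to time `T`, the cone is cut at the
first time at which the state has moved by a given amount. Therefore the forcing is supported in a
ball, and its square is integrable. Between `U₁` and `U₂`, with cones that grow to the whole of
space, it yields the bound in `L²` by Fatou's lemma (`eLpNorm_le_of_bounds`). Bounds on the two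
flows and on the gradient of `U₂` come from compactness; since `U` contains `A⁻²`, the gradient
of `A` is recovered from that of `A⁻²` by inverting `X ↦ X A + A X` on symmetric matrices
(`sylvester_bound`).
-/


noncomputable section

namespace MaxwellFlow

section

/-! ### The local balance of relative energy -/

/-- The direction in which the material metric relaxes: `F⁻¹ F⁻ᵀ - A`. -/
def relaxation (w : PrimState) : Mat := w.F⁻¹ * (w.F⁻¹)ᵀ - w.A

/-- The derivative of the product `F A` at the state `w` along the tangent vector `w'`, whose four
fields are the derivatives of those of `w`. -/
def dFA (w w' : PrimState) (i a : Fin 3) : ℝ :=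
  ∑ b, (w'.F i b * w.A b a + w.F i b * w'.A b a)

/-- The divergence of the Cauchy stress `ε'(ρ⁻¹) I + ρ G F A Fᵀ`, once the Piola identity has been
used. Here `ε` is the volumetric energy, a function of the specific volume `ρ⁻¹`, and `g j` is the
derivative of the state in the direction `j`. -/
def divStress (G : ℝ) (ε : ℝ → ℝ) (w : PrimState) (g : Fin 3 → PrimState) (i : Fin 3) : ℝ :=
  -(deriv (deriv ε) w.ρ⁻¹ * (g i).ρ / w.ρ ^ 2)
    + w.ρ * G * ∑ a, ∑ j, w.F j a * dFA w (g j) i a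

/-- `Z₁ - Z₂` for `Z = F A`. -/
def diffFA (w₁ w₂ : PrimState) (i a : Fin 3) : ℝ :=
  ∑ b, (w₁.F i b * w₁.A b a - w₂.F i b * w₂.A b a)

/-- The relative energy per unit mass of the state `w₁` with respect to `w₂`. The elastic part
is the first-order Taylor remainder of `½ tr (F A Fᵀ)`, which is not convex in `(F, A)`; the last
term, with a large weight `κ`, makes up for that. -/
def relEnergy (G : ℝ) (ε : ℝ → ℝ) (κ : ℝ) (w₁ w₂ : PrimState) : ℝ :=
  (1 / 2) * ∑ i, (w₁.u i - w₂.u i) ^ 2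
    + (ε w₁.ρ⁻¹ - ε w₂.ρ⁻¹ - deriv ε w₂.ρ⁻¹ * (w₁.ρ⁻¹ - w₂.ρ⁻¹))
    + G * ∑ i, ∑ a, ∑ b, ((1 / 2) * ((w₁.F i a - w₂.F i a) * w₁.A a b * (w₁.F i b - w₂.F i b))
        + (w₁.F i a - w₂.F i a) * (w₁.A a b - w₂.A a b) * w₂.F i b)
    + κ / 2 * ∑ a, ∑ b, (w₁.A a b - w₂.A a b) ^ 2

/-- The derivative of `relEnergy` along the tangent vectors `d₁`, `d₂`. -/
def dRelEnergy (G : ℝ) (ε : ℝ → ℝ) (κ : ℝ) (w₁ w₂ d₁ d₂ : PrimState) : ℝ :=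
  ∑ i, (w₁.u i - w₂.u i) * (d₁.u i - d₂.u i)
    + ((deriv ε w₁.ρ⁻¹ - deriv ε w₂.ρ⁻¹) * (-d₁.ρ / w₁.ρ ^ 2)
      - deriv (deriv ε) w₂.ρ⁻¹ * (-d₂.ρ / w₂.ρ ^ 2) * (w₁.ρ⁻¹ - w₂.ρ⁻¹))
    + G * ∑ i, ∑ a, ∑ b,
      ((1 / 2) * ((d₁.F i a - d₂.F i a) * w₁.A a b * (w₁.F i b - w₂.F i b)
          + (w₁.F i a - w₂.F i a) * d₁.A a b * (w₁.F i b - w₂.F i b)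
          + (w₁.F i a - w₂.F i a) * w₁.A a b * (d₁.F i b - d₂.F i b))
        + ((d₁.F i a - d₂.F i a) * (w₁.A a b - w₂.A a b) * w₂.F i b
          + (w₁.F i a - w₂.F i a) * (d₁.A a b - d₂.A a b) * w₂.F i b
          + (w₁.F i a - w₂.F i a) * (w₁.A a b - w₂.A a b) * d₂.F i b))
    + κ * ∑ a, ∑ b, (w₁.A a b - w₂.A a b) * (d₁.A a b - d₂.A a b)

/-- The part of the flux of the relative energy that is not carried by the velocity of the first
flow. -/
def relFlux (G : ℝ) (ε : ℝ → ℝ) (w₁ w₂ : PrimState) (j : Fin 3) : ℝ :=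
  (w₁.u j - w₂.u j) * (deriv ε w₂.ρ⁻¹ - deriv ε w₁.ρ⁻¹)
    - G * ∑ i, ∑ a, (w₁.ρ * w₁.F j a) * ((w₁.u i - w₂.u i) * diffFA w₁ w₂ i a)

/-- The derivative of the `j`-th component of `relFlux` along `d₁`, `d₂`, up to the term that the
Piola identity cancels in the divergence. -/
def dRelFlux (G : ℝ) (ε : ℝ → ℝ) (w₁ w₂ d₁ d₂ : PrimState) (j : Fin 3) : ℝ :=
  (d₁.u j - d₂.u j) * (deriv ε w₂.ρ⁻¹ - deriv ε w₁.ρ⁻¹)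
    + (w₁.u j - w₂.u j) * (deriv (deriv ε) w₂.ρ⁻¹ * (-d₂.ρ / w₂.ρ ^ 2)
        - deriv (deriv ε) w₁.ρ⁻¹ * (-d₁.ρ / w₁.ρ ^ 2))
    - G * ∑ i, ∑ a, (w₁.ρ * w₁.F j a) * ((d₁.u i - d₂.u i) * diffFA w₁ w₂ i a
        + (w₁.u i - w₂.u i) * (dFA w₁ d₁ i a - dFA w₂ d₂ i a))

/-- The production of relative energy per unit mass: `g` is the spatial gradient of the second
flow, `a₁` and `a₂` are the material derivatives of the two metrics, `a₂` being taken along the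
first flow. Every term is at least quadratic in the difference of the two states, except for
the source terms in `a₁ - a₂`. -/
def production (G : ℝ) (ε : ℝ → ℝ) (κ : ℝ) (w₁ w₂ : PrimState) (g : Fin 3 → PrimState)
    (a₁ a₂ : Mat) : ℝ :=
  -(∑ i, ∑ j, (w₁.u i - w₂.u i) * ((w₁.u j - w₂.u j) * (g j).u i))
    - w₁.ρ⁻¹ * (∑ j, (g j).u j) * (deriv ε w₂.ρ⁻¹ - deriv ε w₁.ρ⁻¹
        + w₁.ρ * w₂.ρ⁻¹ * (deriv (deriv ε) w₂.ρ⁻¹ * (w₁.ρ⁻¹ - w₂.ρ⁻¹)))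
    + G * (∑ i, ∑ a, ((w₁.u i - w₂.u i) * ∑ j, (w₁.F j a - w₂.F j a) * dFA w₂ (g j) i a
        + (∑ j, ((w₁.F j a - w₂.F j a) * (g j).u i - (w₁.u j - w₂.u j) * (g j).F i a))
            * diffFA w₁ w₂ i a)
      + ∑ i, ∑ a, ∑ b, ((1 / 2) * ((w₁.F i a - w₂.F i a) * a₁ a b * (w₁.F i b - w₂.F i b))
          + (w₁.F i a - w₂.F i a) * (a₁ a b - a₂ a b) * w₂.F i b
          + (w₁.F i a - w₂.F i a) * (w₁.A a b - w₂.A a b)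
            * (∑ j, ((g j).u i * w₂.F j b + (w₁.u j - w₂.u j) * (g j).F i b))))
    + κ * ∑ a, ∑ b, (w₁.A a b - w₂.A a b) * (a₁ a b - a₂ a b)

/-- The equations of motion at a point, for the material derivative `d` and the spatial
gradient `g` of the state `w`. -/
structure PointEquations (G : ℝ) (ε : ℝ → ℝ) (ξ : ℝ) (w d : PrimState) (g : Fin 3 → PrimState) :
    Prop where
  mass : d.ρ = -(w.ρ * ∑ j, (g j).u j)
  momentum : ∀ i, w.ρ * d.u i = divStress G ε w g i
  deformation : ∀ i a, d.F i a = ∑ j, (g j).u i * w.F j a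
  metric : ∀ a b, d.A a b = ξ * relaxation w a b

/-- The tangent vector `d + ∑ j, v j • g j`: it turns the material derivative of a flow into the
derivative along another flow, whose velocity differs by `v`. -/
def shift (d : PrimState) (v : Fin 3 → ℝ) (g : Fin 3 → PrimState) : PrimState where
  ρ := d.ρ + ∑ j, v j * (g j).ρ
  u := fun i => d.u i + ∑ j, v j * (g j).u i
  F := Matrix.of fun i a => d.F i a + ∑ j, v j * (g j).F i a
  A := Matrix.of fun a b => d.A a b + ∑ j, v j * (g j).A a b

lemma sum_sum_symm_mul (S : Mat) (hS : ∀ a b, S a b = S b a) (x y : Fin 3 → ℝ) :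
    ∑ a, ∑ b, x a * S a b * y b = ∑ a, ∑ b, y a * S a b * x b := by
  rw [Finset.sum_comm]
  refine Finset.sum_congr rfl fun b _ => Finset.sum_congr rfl fun a _ => ?_
  rw [hS a b]; ring

/-- The elastic part of the energy balance, for one row `i` of the deformation gradient. -/
lemma elastic_row (w₁ w₂ d₁ d₂ : PrimState) (g₁ g₂ : Fin 3 → PrimState)
    (hA₁ : ∀ a b, w₁.A a b = w₁.A b a) (hA₂ : ∀ a b, w₂.A a b = w₂.A b a) (i : Fin 3)
    (h₁ : ∀ a, d₁.F i a = ∑ j, (g₁ j).u i * w₁.F j a)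
    (h₂ : ∀ a, d₂.F i a = ∑ j, ((g₂ j).u i * w₂.F j a + (w₁.u j - w₂.u j) * (g₂ j).F i a)) :
    (w₁.u i - w₂.u i) * (∑ a, ∑ j, w₁.F j a * dFA w₁ (g₁ j) i a
        - ∑ a, ∑ j, w₂.F j a * dFA w₂ (g₂ j) i a)
      + ∑ a, ∑ b,
      ((1 / 2) * ((d₁.F i a - d₂.F i a) * w₁.A a b * (w₁.F i b - w₂.F i b)
          + (w₁.F i a - w₂.F i a) * d₁.A a b * (w₁.F i b - w₂.F i b)
          + (w₁.F i a - w₂.F i a) * w₁.A a b * (d₁.F i b - d₂.F i b))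
        + ((d₁.F i a - d₂.F i a) * (w₁.A a b - w₂.A a b) * w₂.F i b
          + (w₁.F i a - w₂.F i a) * (d₁.A a b - d₂.A a b) * w₂.F i b
          + (w₁.F i a - w₂.F i a) * (w₁.A a b - w₂.A a b) * d₂.F i b))
      - ∑ a, ∑ j, w₁.F j a * (((g₁ j).u i - (g₂ j).u i) * diffFA w₁ w₂ i a
        + (w₁.u i - w₂.u i) * (dFA w₁ (g₁ j) i a - dFA w₂ (g₂ j) i a))
    = ∑ a, ((w₁.u i - w₂.u i) * ∑ j, (w₁.F j a - w₂.F j a) * dFA w₂ (g₂ j) i a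
        + (∑ j, ((w₁.F j a - w₂.F j a) * (g₂ j).u i - (w₁.u j - w₂.u j) * (g₂ j).F i a))
            * diffFA w₁ w₂ i a)
      + ∑ a, ∑ b, ((1 / 2) * ((w₁.F i a - w₂.F i a) * d₁.A a b * (w₁.F i b - w₂.F i b))
          + (w₁.F i a - w₂.F i a) * (d₁.A a b - d₂.A a b) * w₂.F i b
          + (w₁.F i a - w₂.F i a) * (w₁.A a b - w₂.A a b)
            * (∑ j, ((g₂ j).u i * w₂.F j b + (w₁.u j - w₂.u j) * (g₂ j).F i b))) := by
  have key : ∑ a, ∑ b, (1 / 2) * ((d₁.F i a - d₂.F i a) * w₁.A a b * (w₁.F i b - w₂.F i b)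
          + (w₁.F i a - w₂.F i a) * w₁.A a b * (d₁.F i b - d₂.F i b))
        + ∑ a, ∑ b, (d₁.F i a - d₂.F i a) * (w₁.A a b - w₂.A a b) * w₂.F i b
      = ∑ a, (d₁.F i a - d₂.F i a) * diffFA w₁ w₂ i a := by
    have hs := sum_sum_symm_mul w₁.A hA₁ (fun a => d₁.F i a - d₂.F i a)
      (fun b => w₁.F i b - w₂.F i b)
    simp only [mul_add, Finset.sum_add_distrib, ← Finset.mul_sum] at hs ⊢
    rw [← hs, ← add_mul]
    norm_num
    rw [← Finset.sum_add_distrib]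
    refine Finset.sum_congr rfl fun a _ => ?_
    simp only [diffFA, Finset.mul_sum]
    rw [← Finset.sum_add_distrib]
    refine Finset.sum_congr rfl fun b _ => ?_
    rw [hA₁ a b, hA₂ a b]; ring
  have split : ∑ a, ∑ b,
      ((1 / 2) * ((d₁.F i a - d₂.F i a) * w₁.A a b * (w₁.F i b - w₂.F i b)
          + (w₁.F i a - w₂.F i a) * d₁.A a b * (w₁.F i b - w₂.F i b)
          + (w₁.F i a - w₂.F i a) * w₁.A a b * (d₁.F i b - d₂.F i b))
        + ((d₁.F i a - d₂.F i a) * (w₁.A a b - w₂.A a b) * w₂.F i b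
          + (w₁.F i a - w₂.F i a) * (d₁.A a b - d₂.A a b) * w₂.F i b
          + (w₁.F i a - w₂.F i a) * (w₁.A a b - w₂.A a b) * d₂.F i b))
      = (∑ a, (d₁.F i a - d₂.F i a) * diffFA w₁ w₂ i a)
      + ∑ a, ∑ b, ((1 / 2) * ((w₁.F i a - w₂.F i a) * d₁.A a b * (w₁.F i b - w₂.F i b))
          + (w₁.F i a - w₂.F i a) * (d₁.A a b - d₂.A a b) * w₂.F i b
          + (w₁.F i a - w₂.F i a) * (w₁.A a b - w₂.A a b) * d₂.F i b) := by
    rw [← key]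
    simp only [← Finset.sum_add_distrib]
    refine Finset.sum_congr rfl fun a _ => Finset.sum_congr rfl fun b _ => ?_
    ring
  rw [split]
  simp only [← h₂]
  rw [← sub_eq_zero]
  have : ∀ X Y Z W V : ℝ, X + (Y + Z) - W - (V + Z) = X + Y - W - V := by intros; ring
  rw [this, ← Finset.sum_sub_distrib, Finset.mul_sum, ← Finset.sum_add_distrib,
    ← Finset.sum_sub_distrib, ← Finset.sum_sub_distrib]
  refine Finset.sum_eq_zero fun a _ => ?_
  rw [h₁, h₂]
  simp only [Fin.sum_univ_three]
  ring

/-- The local balance of the relative energy. -/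
lemma energy_balance_pointwise {G κ ξ₁ ξ₂ : ℝ} {ε : ℝ → ℝ} {w₁ w₂ d₁ d₂ : PrimState}
    {g₁ g₂ : Fin 3 → PrimState} (hρ₁ : w₁.ρ ≠ 0) (hρ₂ : w₂.ρ ≠ 0)
    (hA₁ : ∀ a b, w₁.A a b = w₁.A b a) (hA₂ : ∀ a b, w₂.A a b = w₂.A b a)
    (E₁ : PointEquations G ε ξ₁ w₁ d₁ g₁) (E₂ : PointEquations G ε ξ₂ w₂ d₂ g₂) :
    w₁.ρ * dRelEnergy G ε κ w₁ w₂ d₁ (shift d₂ (fun j => w₁.u j - w₂.u j) g₂)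
      + ∑ j, dRelFlux G ε w₁ w₂ (g₁ j) (g₂ j) j
    = w₁.ρ * production G ε κ w₁ w₂ g₂ d₁.A
        (shift d₂ (fun j => w₁.u j - w₂.u j) g₂).A := by
  set d₂' := shift d₂ (fun j => w₁.u j - w₂.u j) g₂ with hd₂'
  have el := fun i => elastic_row w₁ w₂ d₁ d₂' g₁ g₂ hA₁ hA₂ i (E₁.deformation i) (by
    intro a
    simp only [hd₂', shift, Matrix.of_apply, E₂.deformation, Finset.sum_add_distrib])
  replace el := congrArg (fun h : Fin 3 → ℝ => ∑ i, h i) (funext el)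
  beta_reduce at el
  rw [Finset.sum_sub_distrib, Finset.sum_add_distrib, Finset.sum_add_distrib] at el
  unfold dRelEnergy production
  rw [← el]
  have fl : ∑ j, dRelFlux G ε w₁ w₂ (g₁ j) (g₂ j) j
      = (∑ j, (((g₁ j).u j - (g₂ j).u j) * (deriv ε w₂.ρ⁻¹ - deriv ε w₁.ρ⁻¹)
    + (w₁.u j - w₂.u j) * (deriv (deriv ε) w₂.ρ⁻¹ * (-(g₂ j).ρ / w₂.ρ ^ 2)
        - deriv (deriv ε) w₁.ρ⁻¹ * (-(g₁ j).ρ / w₁.ρ ^ 2)))) - w₁.ρ * (G *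
      ∑ i, ∑ a, ∑ j, w₁.F j a * (((g₁ j).u i - (g₂ j).u i) * diffFA w₁ w₂ i a
        + (w₁.u i - w₂.u i) * (dFA w₁ (g₁ j) i a - dFA w₂ (g₂ j) i a))) := by
    unfold dRelFlux
    rw [Finset.sum_sub_distrib]
    congr 1
    rw [← Finset.mul_sum, Finset.sum_comm, mul_left_comm]
    refine congrArg (G * ·) ?_
    rw [Finset.mul_sum]
    refine Finset.sum_congr rfl fun i _ => ?_
    rw [Finset.sum_comm, Finset.mul_sum]
    refine Finset.sum_congr rfl fun a _ => ?_
    rw [Finset.mul_sum]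
    refine Finset.sum_congr rfl fun j _ => ?_
    ring
  rw [fl]
  have m₁ : ∀ i, d₁.u i = divStress G ε w₁ g₁ i / w₁.ρ := fun i => by
    rw [← E₁.momentum i]; field_simp
  have m₂ : ∀ i, d₂'.u i = divStress G ε w₂ g₂ i / w₂.ρ
      + ∑ j, (w₁.u j - w₂.u j) * (g₂ j).u i := fun i => by
    rw [← E₂.momentum i]
    simp only [hd₂', shift]
    field_simp
  have r₂ : d₂'.ρ = -(w₂.ρ * ∑ j, (g₂ j).u j) + ∑ j, (w₁.u j - w₂.u j) * (g₂ j).ρ := by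
    simp only [hd₂', shift, E₂.mass]
  simp only [m₁, m₂, r₂, E₁.mass, divStress]
  generalize (∑ i, ∑ a, ∑ j, w₁.F j a * (((g₁ j).u i - (g₂ j).u i) * diffFA w₁ w₂ i a
        + (w₁.u i - w₂.u i) * (dFA w₁ (g₁ j) i a - dFA w₂ (g₂ j) i a))) = X₁
  generalize (∑ a, ∑ b, (w₁.A a b - w₂.A a b) * (d₁.A a b - d₂'.A a b)) = X₂
  generalize (∑ i, ∑ a, ∑ b,
      ((1 / 2) * ((d₁.F i a - d₂'.F i a) * w₁.A a b * (w₁.F i b - w₂.F i b)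
          + (w₁.F i a - w₂.F i a) * d₁.A a b * (w₁.F i b - w₂.F i b)
          + (w₁.F i a - w₂.F i a) * w₁.A a b * (d₁.F i b - d₂'.F i b))
        + ((d₁.F i a - d₂'.F i a) * (w₁.A a b - w₂.A a b) * w₂.F i b
          + (w₁.F i a - w₂.F i a) * (d₁.A a b - d₂'.A a b) * w₂.F i b
          + (w₁.F i a - w₂.F i a) * (w₁.A a b - w₂.A a b) * d₂'.F i b))) = X₃
  generalize hy₁ : (fun i => ∑ a, ∑ j, w₁.F j a * dFA w₁ (g₁ j) i a) = y₁
  generalize hy₂ : (fun i => ∑ a, ∑ j, w₂.F j a * dFA w₂ (g₂ j) i a) = y₂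
  have hy₁' : ∀ i, ∑ a, ∑ j, w₁.F j a * dFA w₁ (g₁ j) i a = y₁ i := fun i => congrFun hy₁ i
  have hy₂' : ∀ i, ∑ a, ∑ j, w₂.F j a * dFA w₂ (g₂ j) i a = y₂ i := fun i => congrFun hy₂ i
  simp only [hy₁', hy₂']
  generalize deriv (deriv ε) w₂.ρ⁻¹ = e₂
  generalize deriv (deriv ε) w₁.ρ⁻¹ = e₁
  generalize deriv ε w₂.ρ⁻¹ = p₂
  generalize deriv ε w₁.ρ⁻¹ = p₁
  simp only [Fin.sum_univ_three]
  field_simp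
  ring

end

section

open Asymptotics Filter

/-- Admissible states all of whose entries, and those of their inverses, are bounded by `m`. -/
structure StateBound (m : ℝ) (w : PrimState) : Prop where
  admissible : w.Admissible
  ρ_le : w.ρ ≤ m
  inv_ρ_le : w.ρ⁻¹ ≤ m
  u_le : ∀ i, |w.u i| ≤ m
  F_le : ∀ i a, |w.F i a| ≤ m
  inv_F_le : ∀ a i, |w.F⁻¹ a i| ≤ m
  A_le : ∀ a b, |w.A a b| ≤ m
  inv_A_le : ∀ a b, |w.A⁻¹ a b| ≤ m

/-- Tangent vectors all of whose entries are bounded by `L`. -/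
structure TangentBound (L : ℝ) (g : PrimState) : Prop where
  ρ_le : |g.ρ| ≤ L
  u_le : ∀ i, |g.u i| ≤ L
  F_le : ∀ i a, |g.F i a| ≤ L
  A_le : ∀ a b, |g.A a b| ≤ L

/-- The square of the distance of two states in the variables `(ρ, u, F, A)`. -/
def distSq (w₁ w₂ : PrimState) : ℝ :=
  (w₁.ρ - w₂.ρ) ^ 2 + ∑ i, (w₁.u i - w₂.u i) ^ 2 + ∑ i, ∑ a, (w₁.F i a - w₂.F i a) ^ 2
    + ∑ a, ∑ b, (w₁.A a b - w₂.A a b) ^ 2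

lemma distSq_nonneg (w₁ w₂ : PrimState) : 0 ≤ distSq w₁ w₂ := by
  unfold distSq; positivity

lemma sq_ρ_le (w₁ w₂ : PrimState) : (w₁.ρ - w₂.ρ) ^ 2 ≤ distSq w₁ w₂ := by
  have h1 : 0 ≤ ∑ i, (w₁.u i - w₂.u i) ^ 2 := by positivity
  have h2 : 0 ≤ ∑ i, ∑ a, (w₁.F i a - w₂.F i a) ^ 2 := by positivity
  have h3 : 0 ≤ ∑ a, ∑ b, (w₁.A a b - w₂.A a b) ^ 2 := by positivity
  unfold distSq; linarith

lemma sq_u_le (w₁ w₂ : PrimState) (i : Fin 3) : (w₁.u i - w₂.u i) ^ 2 ≤ distSq w₁ w₂ := by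
  have h0 : 0 ≤ (w₁.ρ - w₂.ρ) ^ 2 := by positivity
  have h1 := Finset.single_le_sum (f := fun i => (w₁.u i - w₂.u i) ^ 2)
    (fun _ _ => sq_nonneg _) (Finset.mem_univ i)
  have h2 : 0 ≤ ∑ i, ∑ a, (w₁.F i a - w₂.F i a) ^ 2 := by positivity
  have h3 : 0 ≤ ∑ a, ∑ b, (w₁.A a b - w₂.A a b) ^ 2 := by positivity
  unfold distSq; linarith

lemma sq_entry_le (B C : Mat) (i a : Fin 3) :
    (B i a - C i a) ^ 2 ≤ ∑ i, ∑ a, (B i a - C i a) ^ 2 :=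
  (Finset.single_le_sum (f := fun a => (B i a - C i a) ^ 2)
    (fun _ _ => sq_nonneg _) (Finset.mem_univ a)).trans
  (Finset.single_le_sum (f := fun i => ∑ a, (B i a - C i a) ^ 2)
    (fun _ _ => Finset.sum_nonneg fun _ _ => sq_nonneg _) (Finset.mem_univ i))

lemma sq_F_le (w₁ w₂ : PrimState) (i a : Fin 3) :
    (w₁.F i a - w₂.F i a) ^ 2 ≤ distSq w₁ w₂ := by
  have h0 : 0 ≤ (w₁.ρ - w₂.ρ) ^ 2 := by positivity
  have h1 : 0 ≤ ∑ i, (w₁.u i - w₂.u i) ^ 2 := by positivity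
  have h2 := sq_entry_le w₁.F w₂.F i a
  have h3 : 0 ≤ ∑ a, ∑ b, (w₁.A a b - w₂.A a b) ^ 2 := by positivity
  unfold distSq; linarith

lemma sq_A_le (w₁ w₂ : PrimState) (a b : Fin 3) :
    (w₁.A a b - w₂.A a b) ^ 2 ≤ distSq w₁ w₂ := by
  have h0 : 0 ≤ (w₁.ρ - w₂.ρ) ^ 2 := by positivity
  have h1 : 0 ≤ ∑ i, (w₁.u i - w₂.u i) ^ 2 := by positivity
  have h2 : 0 ≤ ∑ i, ∑ a, (w₁.F i a - w₂.F i a) ^ 2 := by positivity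
  have h3 := sq_entry_le w₁.A w₂.A a b
  unfold distSq; linarith

lemma StateBound.ρ_pos {m : ℝ} {w : PrimState} (h : StateBound m w) : 0 < w.ρ :=
  h.admissible.ρ_pos

lemma StateBound.m_pos {m : ℝ} {w : PrimState} (h : StateBound m w) : 0 < m :=
  h.ρ_pos.trans_le h.ρ_le

lemma StateBound.inv_mem {m : ℝ} {w : PrimState} (h : StateBound m w) : w.ρ⁻¹ ∈ Icc m⁻¹ m :=
  ⟨inv_anti₀ h.ρ_pos h.ρ_le, h.inv_ρ_le⟩

lemma PrimState.Admissible.A_symm {w : PrimState} (h : w.Admissible) (a b : Fin 3) :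
    w.A a b = w.A b a := by
  have := congrFun (congrFun h.A_posDef.isHermitian b) a
  simpa using this

lemma PrimState.Admissible.isUnit_det_A {w : PrimState} (h : w.Admissible) : IsUnit w.A.det :=
  isUnit_iff_ne_zero.2 h.A_posDef.det_pos.ne'

lemma PrimState.Admissible.isUnit_det_F {w : PrimState} (h : w.Admissible) : IsUnit w.F.det :=
  isUnit_iff_ne_zero.2 h.F_inv

/-! ### Coercivity -/

/-- A bound on the inverse of a positive definite matrix bounds the matrix from below. -/
lemma posDef_lower_bound {B : Mat} (hB : B.PosDef) {m : ℝ} (hm : 0 < m)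
    (hi : ∀ a b, |B⁻¹ a b| ≤ m) (x : Fin 3 → ℝ) :
    (3 * m)⁻¹ * ∑ a, x a ^ 2 ≤ ∑ a, ∑ b, x a * B a b * x b := by
  have hdet : IsUnit B.det := isUnit_iff_ne_zero.2 hB.det_pos.ne'
  set s : ℝ := (3 * m)⁻¹ with hs
  -- the form `B` at `x - s B⁻¹ x` is nonnegative, and `s` is the best choice
  have hpos := hB.posSemidef.dotProduct_mulVec_nonneg (x - s • (B⁻¹ *ᵥ x))
  have hsymm : Bᵀ = B := by
    have h := hB.isHermitian
    rwa [Matrix.IsHermitian, Matrix.conjTranspose_eq_transpose_of_trivial] at h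
  have e1 : B *ᵥ (x - s • (B⁻¹ *ᵥ x)) = B *ᵥ x - s • x := by
    rw [Matrix.mulVec_sub, Matrix.mulVec_smul, Matrix.mulVec_mulVec, Matrix.mul_nonsing_inv _ hdet,
      Matrix.one_mulVec]
  have e2 : (B⁻¹ *ᵥ x) ⬝ᵥ (B *ᵥ x) = x ⬝ᵥ x := by
    rw [Matrix.dotProduct_mulVec, ← Matrix.mulVec_transpose, hsymm, Matrix.mulVec_mulVec,
      Matrix.mul_nonsing_inv _ hdet, Matrix.one_mulVec]
  have e3 : (B⁻¹ *ᵥ x) ⬝ᵥ x ≤ 3 * m * (x ⬝ᵥ x) := by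
    simp only [dotProduct, Matrix.mulVec, Finset.sum_mul, Finset.mul_sum]
    have : ∀ a b, B⁻¹ a b * x b * x a ≤ m / 2 * (x a ^ 2 + x b ^ 2) := fun a b => by
      have h1 : B⁻¹ a b * x b * x a ≤ |B⁻¹ a b| * |x b * x a| := by
        rw [mul_assoc, ← abs_mul]; exact le_abs_self _
      have h2 : |x b * x a| ≤ (x a ^ 2 + x b ^ 2) / 2 := by
        rw [abs_le]; constructor <;> nlinarith [sq_nonneg (x a + x b), sq_nonneg (x a - x b)]
      calc _ ≤ _ := h1
        _ ≤ m * ((x a ^ 2 + x b ^ 2) / 2) := by gcongr; exact hi a b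
        _ = _ := by ring
    calc _ ≤ ∑ a, ∑ b, m / 2 * (x a ^ 2 + x b ^ 2) :=
          Finset.sum_le_sum fun a _ => Finset.sum_le_sum fun b _ => this a b
      _ = _ := by simp only [Fin.sum_univ_three]; ring
  simp only [star_trivial] at hpos
  rw [e1, sub_dotProduct, dotProduct_sub, dotProduct_sub, smul_dotProduct, smul_dotProduct, e2,
    dotProduct_smul, dotProduct_smul] at hpos
  simp only [smul_eq_mul] at hpos
  have e4 : x ⬝ᵥ (B *ᵥ x) = ∑ a, ∑ b, x a * B a b * x b := by
    simp only [dotProduct, Matrix.mulVec, Finset.mul_sum, mul_assoc]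
  have e5 : x ⬝ᵥ x = ∑ a, x a ^ 2 := by simp only [dotProduct, sq]
  rw [e4, e5] at hpos
  rw [e5] at e3
  have hs0 : 0 < s := by positivity
  have hsm : s * (3 * m) = 1 := by rw [hs]; field_simp
  have h1 := mul_le_mul_of_nonneg_left e3 (mul_pos hs0 hs0).le
  have h2 : s * s * (3 * m * ∑ a, x a ^ 2) = s * ∑ a, x a ^ 2 := by
    rw [← mul_assoc, mul_assoc s s, hsm, mul_one]
  rw [h2] at h1
  linarith

/-- The specific energy, as a function of the specific volume, that accounts for the whole
isotropic part `-(p + G ρ) I` of the stress. -/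
def volEnergy (G : ℝ) (e₀ : ℝ → ℝ) (τ : ℝ) : ℝ := e₀ τ - G * Real.log τ

lemma contDiffOn_volEnergy {G : ℝ} {e₀ : ℝ → ℝ} (he : ContDiffOn ℝ ∞ e₀ (Ioi 0)) :
    ContDiffOn ℝ ∞ (volEnergy G e₀) (Ioi 0) :=
  he.sub (contDiffOn_const.mul (contDiffOn_id.log fun _ hx => (ne_of_gt hx)))

lemma deriv_volEnergy {G : ℝ} {e₀ : ℝ → ℝ} (he : ContDiffOn ℝ ∞ e₀ (Ioi 0)) {τ : ℝ}
    (hτ : 0 < τ) : deriv (volEnergy G e₀) τ = deriv e₀ τ - G / τ := by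
  have h1 : HasDerivAt e₀ (deriv e₀ τ) τ :=
    ((he.contDiffAt (Ioi_mem_nhds hτ)).differentiableAt (by simp)).hasDerivAt
  have := h1.sub ((Real.hasDerivAt_log hτ.ne').const_mul G)
  rw [div_eq_mul_inv]; exact this.deriv

lemma convexOn_tangent_le {f : ℝ → ℝ} {S : Set ℝ} (hf : ConvexOn ℝ S f) {x y : ℝ} (hx : x ∈ S)
    (hy : y ∈ S) (hd : DifferentiableAt ℝ f y) : f y + deriv f y * (x - y) ≤ f x := by
  rcases lt_trichotomy x y with h | h | h
  · have := hf.slope_le_deriv hx hy h hd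
    rw [slope_def_field, div_le_iff₀ (by linarith)] at this
    linarith
  · subst h; simp
  · have := hf.deriv_le_slope hy hx h hd
    rw [slope_def_field, le_div_iff₀ (by linarith)] at this
    linarith

/-- `x - 1 - log x` bounds the square of `x - 1`. -/
lemma sq_le_sub_log {x : ℝ} (hx : 0 < x) :
    (x - 1) ^ 2 ≤ 2 * (x + 1) * (x - 1 - Real.log x) := by
  have h1 : Real.log x = 2 * Real.log (√x) := by
    rw [Real.log_sqrt hx.le]; ring
  have h2 := Real.log_le_sub_one_of_pos (Real.sqrt_pos.2 hx)
  set s := √x with hs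
  have h3 : s ^ 2 = x := Real.sq_sqrt hx.le
  have hs0 : 0 < s := Real.sqrt_pos.2 hx
  have h4 : (s - 1) ^ 2 ≤ x - 1 - Real.log x := by rw [h1]; nlinarith
  have h5 : (x - 1) ^ 2 = (s + 1) ^ 2 * (s - 1) ^ 2 := by rw [← h3]; ring
  have h6 : (s + 1) ^ 2 ≤ 2 * (x + 1) := by nlinarith [sq_nonneg (s - 1)]
  rw [h5]
  exact mul_le_mul h6 h4 (sq_nonneg _) (by positivity)

lemma volEnergy_coercive {G : ℝ} (hG : 0 < G) {e₀ : ℝ → ℝ} (he : ContDiffOn ℝ ∞ e₀ (Ioi 0))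
    (hc : ConvexOn ℝ (Ioi 0) e₀) {m r₁ r₂ : ℝ} (h₁ : 0 < r₁) (h₂ : 0 < r₂) (hm₁ : r₁ ≤ m)
    (hm₁' : r₁⁻¹ ≤ m) (hm₂ : r₂ ≤ m) :
    G / (2 * (m ^ 2 + 1) * m ^ 2) * (r₁ - r₂) ^ 2 ≤
      volEnergy G e₀ r₁⁻¹ - volEnergy G e₀ r₂⁻¹
        - deriv (volEnergy G e₀) r₂⁻¹ * (r₁⁻¹ - r₂⁻¹) := by
  have p₁ := inv_pos.2 h₁
  have p₂ := inv_pos.2 h₂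
  have hm : 0 < m := h₁.trans_le hm₁
  have t := convexOn_tangent_le hc (show r₁⁻¹ ∈ Ioi 0 from p₁) (show r₂⁻¹ ∈ Ioi 0 from p₂)
    ((he.contDiffAt (Ioi_mem_nhds p₂)).differentiableAt (by simp))
  have l := sq_le_sub_log (div_pos h₂ h₁)
  rw [Real.log_div h₂.ne' h₁.ne'] at l
  have hx : r₂ / r₁ ≤ m ^ 2 := by
    rw [div_eq_mul_inv, sq]; exact mul_le_mul hm₂ hm₁' p₁.le hm.le
  have hl0 : 0 ≤ r₂ / r₁ - 1 - (Real.log r₂ - Real.log r₁) := by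
    have := Real.log_le_sub_one_of_pos (div_pos h₂ h₁)
    rw [Real.log_div h₂.ne' h₁.ne'] at this; linarith
  have l2 : (r₂ / r₁ - 1) ^ 2 ≤
      2 * (m ^ 2 + 1) * (r₂ / r₁ - 1 - (Real.log r₂ - Real.log r₁)) :=
    l.trans (by gcongr)
  have l3 : (r₁ - r₂) ^ 2 ≤ m ^ 2 * (r₂ / r₁ - 1) ^ 2 := by
    have : (r₁ - r₂) ^ 2 = r₁ ^ 2 * (r₂ / r₁ - 1) ^ 2 := by field_simp; ring
    rw [this]; gcongr
  have l4 : (r₁ - r₂) ^ 2 ≤ (2 * (m ^ 2 + 1) * m ^ 2)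
      * (r₂ / r₁ - 1 - (Real.log r₂ - Real.log r₁)) := by
    calc _ ≤ _ := l3
      _ ≤ m ^ 2 * (2 * (m ^ 2 + 1) * (r₂ / r₁ - 1 - (Real.log r₂ - Real.log r₁))) := by gcongr
      _ = _ := by ring
  rw [deriv_volEnergy he p₂]
  unfold volEnergy
  rw [Real.log_inv, Real.log_inv]
  have e : (deriv e₀ r₂⁻¹ - G / r₂⁻¹) * (r₁⁻¹ - r₂⁻¹)
      = deriv e₀ r₂⁻¹ * (r₁⁻¹ - r₂⁻¹) - G * (r₂ / r₁ - 1) := by field_simp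
  rw [e]
  have l5 : G / (2 * (m ^ 2 + 1) * m ^ 2) * (r₁ - r₂) ^ 2
      ≤ G * (r₂ / r₁ - 1 - (Real.log r₂ - Real.log r₁)) := by
    rw [div_mul_eq_mul_div, div_le_iff₀ (by positivity), mul_assoc]
    gcongr
    linarith
  linarith

/-- For a large enough weight `κ` of the metrics, the relative energy controls the square of the
difference of the two states. -/
lemma relEnergy_coercive {G : ℝ} (hG : 0 < G) {e₀ : ℝ → ℝ} (he : ContDiffOn ℝ ∞ e₀ (Ioi 0))
    (hc : ConvexOn ℝ (Ioi 0) e₀) {m : ℝ} (hm : 0 < m) :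
    ∃ κ c : ℝ, 0 < c ∧ ∀ w₁ w₂, StateBound m w₁ → StateBound m w₂ →
      c * distSq w₁ w₂ ≤ relEnergy G (volEnergy G e₀) κ w₁ w₂ := by
  set l : ℝ := (3 * m)⁻¹ with hl
  have hl0 : 0 < l := by positivity
  set c₀ : ℝ := G / (2 * (m ^ 2 + 1) * m ^ 2) with hc₀
  have hc₀pos : 0 < c₀ := by positivity
  refine ⟨2 * (9 * m ^ 2 * G / l + 1), min (min c₀ (1 / 2)) (min (G * l / 4) 1),
    by positivity, fun w₁ w₂ h₁ h₂ => ?_⟩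
  have hv := volEnergy_coercive hG he hc h₁.ρ_pos h₂.ρ_pos h₁.ρ_le h₁.inv_ρ_le h₂.ρ_le
  have hf := fun i => posDef_lower_bound h₁.admissible.A_posDef hm h₁.inv_A_le
    (fun a => w₁.F i a - w₂.F i a)
  have hf' := Finset.sum_le_sum fun i (_ : i ∈ Finset.univ) => hf i
  rw [← Finset.mul_sum] at hf'
  -- Young's inequality; summed over `b`, the first term is half of the lower bound in `hf`
  have young : ∀ i a b, -(l / 12 * (w₁.F i a - w₂.F i a) ^ 2
        + 3 / l * m ^ 2 * (w₁.A a b - w₂.A a b) ^ 2)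
      ≤ (w₁.F i a - w₂.F i a) * (w₁.A a b - w₂.A a b) * w₂.F i b := fun i a b => by
    have hF : w₂.F i b ^ 2 ≤ m ^ 2 := sq_le_sq' (by linarith [(abs_le.1 (h₂.F_le i b)).1])
      (abs_le.1 (h₂.F_le i b)).2
    set x := w₁.F i a - w₂.F i a
    set y := w₁.A a b - w₂.A a b
    set z := w₂.F i b
    have h1 : 0 ≤ l / 12 * (x + 6 / l * (y * z)) ^ 2 := by positivity
    have h2 : l / 12 * (x + 6 / l * (y * z)) ^ 2
        = l / 12 * x ^ 2 + x * y * z + 3 / l * (z ^ 2 * y ^ 2) := by field_simp; ring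
    have h3 : 3 / l * (z ^ 2 * y ^ 2) ≤ 3 / l * (m ^ 2 * y ^ 2) := by gcongr
    linarith
  have young' := Finset.sum_le_sum fun i (_ : i ∈ (Finset.univ : Finset (Fin 3))) =>
    Finset.sum_le_sum fun a (_ : a ∈ (Finset.univ : Finset (Fin 3))) =>
    Finset.sum_le_sum fun b (_ : b ∈ (Finset.univ : Finset (Fin 3))) => young i a b
  have e1 : ∑ i : Fin 3, ∑ a : Fin 3, ∑ b : Fin 3, -(l / 12 * (w₁.F i a - w₂.F i a) ^ 2
        + 3 / l * m ^ 2 * (w₁.A a b - w₂.A a b) ^ 2)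
      = -(l / 4 * ∑ i, ∑ a, (w₁.F i a - w₂.F i a) ^ 2)
        - 9 * m ^ 2 / l * ∑ a, ∑ b, (w₁.A a b - w₂.A a b) ^ 2 := by
    simp only [Fin.sum_univ_three]; ring
  rw [e1] at young'
  have e2 : ∑ i, ∑ a, ∑ b, ((1 / 2) * ((w₁.F i a - w₂.F i a) * w₁.A a b * (w₁.F i b - w₂.F i b))
        + (w₁.F i a - w₂.F i a) * (w₁.A a b - w₂.A a b) * w₂.F i b)
      = (1 / 2) * ∑ i, ∑ a, ∑ b, (w₁.F i a - w₂.F i a) * w₁.A a b * (w₁.F i b - w₂.F i b)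
        + ∑ i, ∑ a, ∑ b, (w₁.F i a - w₂.F i a) * (w₁.A a b - w₂.A a b) * w₂.F i b := by
    simp only [Finset.sum_add_distrib, Finset.mul_sum]
  unfold relEnergy
  rw [e2]
  unfold distSq
  have n0 : 0 ≤ (w₁.ρ - w₂.ρ) ^ 2 := by positivity
  have n1 : 0 ≤ ∑ i, (w₁.u i - w₂.u i) ^ 2 := by positivity
  have n2 : 0 ≤ ∑ i, ∑ a, (w₁.F i a - w₂.F i a) ^ 2 := by positivity
  have n3 : 0 ≤ ∑ a, ∑ b, (w₁.A a b - w₂.A a b) ^ 2 := by positivity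
  set c := min (min c₀ (1 / 2)) (min (G * l / 4) 1) with hcdef
  have k0 : c ≤ c₀ := (min_le_left _ _).trans (min_le_left _ _)
  have k1 : c ≤ 1 / 2 := (min_le_left _ _).trans (min_le_right _ _)
  have k2 : c ≤ G * l / 4 := (min_le_right _ _).trans (min_le_left _ _)
  have k3 : c ≤ 1 := (min_le_right _ _).trans (min_le_right _ _)
  have q0 := mul_le_mul_of_nonneg_right k0 n0
  have q1 := mul_le_mul_of_nonneg_right k1 n1
  have q2 := mul_le_mul_of_nonneg_right k2 n2
  have q3 := mul_le_mul_of_nonneg_right k3 n3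
  set X := ∑ i, ∑ a, ∑ b, (w₁.F i a - w₂.F i a) * w₁.A a b * (w₁.F i b - w₂.F i b)
  set Y := ∑ i, ∑ a, ∑ b, (w₁.F i a - w₂.F i a) * (w₁.A a b - w₂.A a b) * w₂.F i b
  set S2 := ∑ i, ∑ a, (w₁.F i a - w₂.F i a) ^ 2
  set S3 := ∑ a, ∑ b, (w₁.A a b - w₂.A a b) ^ 2
  have q4 : G * (1 / 2 * (l * S2) - (l / 4 * S2) - 9 * m ^ 2 / l * S3) ≤ G * (1 / 2 * X + Y) :=
    mul_le_mul_of_nonneg_left (by linarith) hG.le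
  have q5 : G * (1 / 2 * (l * S2) - (l / 4 * S2) - 9 * m ^ 2 / l * S3)
      + 2 * (9 * m ^ 2 * G / l + 1) / 2 * S3 = G * l / 4 * S2 + S3 := by ring
  linarith

end

section

open Asymptotics Filter

/-! ### Taylor estimates on compact intervals -/

lemma contDiffOn_deriv {f : ℝ → ℝ} (hf : ContDiffOn ℝ ∞ f (Ioi 0)) :
    ContDiffOn ℝ ∞ (deriv f) (Ioi 0) :=
  hf.deriv_of_isOpen isOpen_Ioi (by simp)

lemma differentiableAt_of_pos {f : ℝ → ℝ} (hf : ContDiffOn ℝ ∞ f (Ioi 0)) {x : ℝ} (hx : 0 < x) :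
    DifferentiableAt ℝ f x :=
  (hf.contDiffAt (Ioi_mem_nhds hx)).differentiableAt (by simp)

lemma exists_bound_Icc {f : ℝ → ℝ} (hf : ContDiffOn ℝ ∞ f (Ioi 0)) {m : ℝ} (hm : 0 < m) :
    ∃ K, ∀ x ∈ Icc m⁻¹ m, |f x| ≤ K :=
  isCompact_Icc.exists_bound_of_continuousOn
    (hf.continuousOn.mono fun _ hx => (inv_pos.2 hm).trans_le hx.1)

lemma exists_lipschitz_Icc {f : ℝ → ℝ} (hf : ContDiffOn ℝ ∞ f (Ioi 0)) {m : ℝ} (hm : 0 < m) :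
    ∃ K, ∀ x ∈ Icc m⁻¹ m, ∀ y ∈ Icc m⁻¹ m, |f x - f y| ≤ K * |x - y| := by
  obtain ⟨K, hK⟩ := exists_bound_Icc (contDiffOn_deriv hf) hm
  refine ⟨K, fun x hx y hy => ?_⟩
  exact (convex_Icc _ _).norm_image_sub_le_of_norm_deriv_le
    (fun z hz => differentiableAt_of_pos hf ((inv_pos.2 hm).trans_le hz.1)) hK hy hx

lemma exists_taylor_Icc {f : ℝ → ℝ} (hf : ContDiffOn ℝ ∞ f (Ioi 0)) {m : ℝ} (hm : 0 < m) :
    ∃ K, ∀ x ∈ Icc m⁻¹ m, ∀ y ∈ Icc m⁻¹ m,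
      |f x - f y - deriv f y * (x - y)| ≤ K * |x - y| ^ 2 := by
  obtain ⟨K, hK⟩ := exists_lipschitz_Icc (contDiffOn_deriv hf) hm
  refine ⟨K, fun x hx y hy => ?_⟩
  have hsub : uIcc y x ⊆ Icc m⁻¹ m := ordConnected_Icc.uIcc_subset hy hx
  have key := (convex_uIcc y x).norm_image_sub_le_of_norm_hasDerivWithin_le
    (f := fun z => f z - deriv f y * z) (f' := fun z => deriv f z - deriv f y * 1)
    (C := K * |x - y|) (x := y) (y := x)
    (fun z hz => by
      have hz' := differentiableAt_of_pos hf ((inv_pos.2 hm).trans_le (hsub hz).1)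
      exact (hz'.hasDerivAt.sub ((hasDerivAt_id z).const_mul _)).hasDerivWithinAt)
    (fun z hz => by
      have hzy : |z - y| ≤ |x - y| := abs_sub_left_of_mem_uIcc hz
      have hK0 : 0 ≤ K ∨ x = y := by
        by_cases hxy : x = y
        · exact Or.inr hxy
        · refine Or.inl (le_of_not_gt fun hneg => ?_)
          have h1 := hK x hx y hy
          have h2 : 0 < |x - y| := abs_pos.2 (sub_ne_zero.2 hxy)
          nlinarith [abs_nonneg (deriv f x - deriv f y)]
      rw [mul_one, Real.norm_eq_abs]
      refine (hK z (hsub hz) y hy).trans ?_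
      rcases hK0 with h | h
      · gcongr
      · subst h
        have hz0 : z = x := by simpa using hz
        simp [hz0])
    left_mem_uIcc right_mem_uIcc
  rw [Real.norm_eq_abs, Real.norm_eq_abs] at key
  calc _ = |f x - deriv f y * x - (f y - deriv f y * y)| := by congr 1; ring
    _ ≤ _ := key
    _ = _ := by ring

/-! ### Bounds on the terms of the energy balance -/

/-- The data at one point of a pair of flows: the two states, the spatial gradient of the second
one, and the two relaxation parameters. -/
structure Config where
  /-- first state -/
  w₁ : PrimState
  /-- second state -/
  w₂ : PrimState
  /-- gradient of the second state -/
  g : Fin 3 → PrimState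
  /-- first relaxation parameter -/
  ξ₁ : ℝ
  /-- second relaxation parameter -/
  ξ₂ : ℝ

/-- The bounded configurations. All estimates below are of the form `f =O[𝓟 (configs m L M)] g`,
that is, with a constant which depends on the three bounds only. -/
def configs (m L M : ℝ) : Set Config :=
  {c | StateBound m c.w₁ ∧ StateBound m c.w₂ ∧ (∀ j, TangentBound L (c.g j)) ∧
    |c.ξ₁| ≤ M ∧ |c.ξ₂| ≤ M}

/-- The distance of the two states. -/
def Config.s (c : Config) : ℝ := √(distSq c.w₁ c.w₂)

lemma Config.s_nonneg (c : Config) : 0 ≤ c.s := Real.sqrt_nonneg _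

lemma Config.s_sq (c : Config) : c.s ^ 2 = distSq c.w₁ c.w₂ := Real.sq_sqrt (distSq_nonneg _ _)

open Classical in
/-- The forcing: the difference of the relaxation parameters, where the second flow is out of
equilibrium. -/
def Config.forcing (c : Config) : ℝ := if relaxation c.w₂ = 0 then 0 else |c.ξ₁ - c.ξ₂|

lemma Config.forcing_nonneg (c : Config) : 0 ≤ c.forcing := by
  unfold Config.forcing; split_ifs <;> positivity

variable {m L M : ℝ}

lemma isBigO_one_of_abs_le {S : Set Config} {f : Config → ℝ} {K : ℝ} (h : ∀ c ∈ S, |f c| ≤ K) :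
    f =O[𝓟 S] fun _ => (1 : ℝ) :=
  isBigO_principal.2 ⟨K, fun c hc => by simpa using h c hc⟩

lemma isBigO_mul_bdd {S : Set Config} {f g r : Config → ℝ} (hf : f =O[𝓟 S] r)
    (hg : g =O[𝓟 S] fun _ => (1 : ℝ)) : (fun c => f c * g c) =O[𝓟 S] r := by
  simpa using hf.mul hg

lemma isBigO_bdd_mul {S : Set Config} {f g r : Config → ℝ} (hf : f =O[𝓟 S] fun _ => (1 : ℝ))
    (hg : g =O[𝓟 S] r) : (fun c => f c * g c) =O[𝓟 S] r := by
  simpa using hf.mul hg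

lemma isBigO_mul_sq {S : Set Config} {f g r : Config → ℝ} (hf : f =O[𝓟 S] r)
    (hg : g =O[𝓟 S] r) : (fun c => f c * g c) =O[𝓟 S] fun c => r c ^ 2 := by
  simpa [sq] using hf.mul hg

lemma isBigO_sum {S : Set Config} {f : Fin 3 → Config → ℝ} {r : Config → ℝ}
    (hf : ∀ i, f i =O[𝓟 S] r) : (fun c => ∑ i, f i c) =O[𝓟 S] r :=
  IsBigO.fun_sum fun i _ => hf i

lemma isBigO_s_of_sq_le {S : Set Config} {f : Config → ℝ}
    (h : ∀ c, f c ^ 2 ≤ distSq c.w₁ c.w₂) : f =O[𝓟 S] Config.s :=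
  IsBigO.of_bound 1 (Eventually.of_forall fun c => by
    rw [one_mul, Real.norm_eq_abs, Real.norm_of_nonneg c.s_nonneg]
    exact Real.abs_le_sqrt (h c))

lemma isBigO_ρ : (fun c : Config => c.w₁.ρ - c.w₂.ρ) =O[𝓟 (configs m L M)] Config.s :=
  isBigO_s_of_sq_le fun _ => sq_ρ_le _ _

lemma isBigO_u (i : Fin 3) :
    (fun c : Config => c.w₁.u i - c.w₂.u i) =O[𝓟 (configs m L M)] Config.s :=
  isBigO_s_of_sq_le fun _ => sq_u_le _ _ i

lemma isBigO_F (i a : Fin 3) :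
    (fun c : Config => c.w₁.F i a - c.w₂.F i a) =O[𝓟 (configs m L M)] Config.s :=
  isBigO_s_of_sq_le fun _ => sq_F_le _ _ i a

lemma isBigO_A (a b : Fin 3) :
    (fun c : Config => c.w₁.A a b - c.w₂.A a b) =O[𝓟 (configs m L M)] Config.s :=
  isBigO_s_of_sq_le fun _ => sq_A_le _ _ a b

lemma StateBound.abs_ρ_le {w : PrimState} (h : StateBound m w) : |w.ρ| ≤ m := by
  rw [abs_of_pos h.ρ_pos]; exact h.ρ_le

lemma StateBound.abs_inv_ρ_le {w : PrimState} (h : StateBound m w) : |w.ρ⁻¹| ≤ m := by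
  rw [abs_of_pos (inv_pos.2 h.ρ_pos)]; exact h.inv_ρ_le

lemma bdd_ρ₁ : (fun c : Config => c.w₁.ρ) =O[𝓟 (configs m L M)] fun _ => (1 : ℝ) :=
  isBigO_one_of_abs_le fun _ h => h.1.abs_ρ_le

lemma bdd_inv_ρ₁ : (fun c : Config => c.w₁.ρ⁻¹) =O[𝓟 (configs m L M)] fun _ => (1 : ℝ) :=
  isBigO_one_of_abs_le fun _ h => h.1.abs_inv_ρ_le

lemma bdd_inv_ρ₂ : (fun c : Config => c.w₂.ρ⁻¹) =O[𝓟 (configs m L M)] fun _ => (1 : ℝ) :=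
  isBigO_one_of_abs_le fun _ h => h.2.1.abs_inv_ρ_le

lemma bdd_u₁ (i : Fin 3) : (fun c : Config => c.w₁.u i) =O[𝓟 (configs m L M)] fun _ => (1 : ℝ) :=
  isBigO_one_of_abs_le fun _ h => h.1.u_le i

lemma bdd_F₁ (i a : Fin 3) :
    (fun c : Config => c.w₁.F i a) =O[𝓟 (configs m L M)] fun _ => (1 : ℝ) :=
  isBigO_one_of_abs_le fun _ h => h.1.F_le i a

lemma bdd_F₂ (i a : Fin 3) :
    (fun c : Config => c.w₂.F i a) =O[𝓟 (configs m L M)] fun _ => (1 : ℝ) :=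
  isBigO_one_of_abs_le fun _ h => h.2.1.F_le i a

lemma bdd_A₁ (a b : Fin 3) :
    (fun c : Config => c.w₁.A a b) =O[𝓟 (configs m L M)] fun _ => (1 : ℝ) :=
  isBigO_one_of_abs_le fun _ h => h.1.A_le a b

lemma bdd_A₂ (a b : Fin 3) :
    (fun c : Config => c.w₂.A a b) =O[𝓟 (configs m L M)] fun _ => (1 : ℝ) :=
  isBigO_one_of_abs_le fun _ h => h.2.1.A_le a b

lemma bdd_inv_F₁ (a i : Fin 3) :
    (fun c : Config => c.w₁.F⁻¹ a i) =O[𝓟 (configs m L M)] fun _ => (1 : ℝ) :=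
  isBigO_one_of_abs_le fun _ h => h.1.inv_F_le a i

lemma bdd_inv_F₂ (a i : Fin 3) :
    (fun c : Config => c.w₂.F⁻¹ a i) =O[𝓟 (configs m L M)] fun _ => (1 : ℝ) :=
  isBigO_one_of_abs_le fun _ h => h.2.1.inv_F_le a i

lemma bdd_inv_A₁ (a b : Fin 3) :
    (fun c : Config => c.w₁.A⁻¹ a b) =O[𝓟 (configs m L M)] fun _ => (1 : ℝ) :=
  isBigO_one_of_abs_le fun _ h => h.1.inv_A_le a b

lemma bdd_inv_A₂ (a b : Fin 3) :
    (fun c : Config => c.w₂.A⁻¹ a b) =O[𝓟 (configs m L M)] fun _ => (1 : ℝ) :=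
  isBigO_one_of_abs_le fun _ h => h.2.1.inv_A_le a b

lemma bdd_grad_u (j i : Fin 3) :
    (fun c : Config => (c.g j).u i) =O[𝓟 (configs m L M)] fun _ => (1 : ℝ) :=
  isBigO_one_of_abs_le fun _ h => (h.2.2.1 j).u_le i

lemma bdd_grad_F (j i a : Fin 3) :
    (fun c : Config => (c.g j).F i a) =O[𝓟 (configs m L M)] fun _ => (1 : ℝ) :=
  isBigO_one_of_abs_le fun _ h => (h.2.2.1 j).F_le i a

lemma bdd_grad_A (j a b : Fin 3) :
    (fun c : Config => (c.g j).A a b) =O[𝓟 (configs m L M)] fun _ => (1 : ℝ) :=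
  isBigO_one_of_abs_le fun _ h => (h.2.2.1 j).A_le a b

lemma bdd_ξ₁ : (fun c : Config => c.ξ₁) =O[𝓟 (configs m L M)] fun _ => (1 : ℝ) :=
  isBigO_one_of_abs_le fun _ h => h.2.2.2.1

lemma bdd_const (x : ℝ) {S : Set Config} : (fun _ => x) =O[𝓟 S] fun _ => (1 : ℝ) :=
  isBigO_const_const x one_ne_zero _

lemma isBigO_inv_ρ :
    (fun c : Config => c.w₁.ρ⁻¹ - c.w₂.ρ⁻¹) =O[𝓟 (configs m L M)] Config.s := by
  refine (isBigO_mul_bdd (isBigO_mul_bdd isBigO_ρ bdd_inv_ρ₁) (bdd_inv_ρ₂.neg_left)).congr' ?_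
    EventuallyEq.rfl
  refine eventually_principal.2 fun c hc => ?_
  have h1 := hc.1.ρ_pos.ne'
  have h2 := hc.2.1.ρ_pos.ne'
  field_simp
  ring

/-- The resolvent identity `B⁻¹ - C⁻¹ = B⁻¹ (C - B) C⁻¹`, in entries. -/
lemma inv_sub_inv_entry {B C : Mat} (hB : IsUnit B.det) (hC : IsUnit C.det) (i j : Fin 3) :
    B⁻¹ i j - C⁻¹ i j = -∑ b, (∑ a, B⁻¹ i a * (B a b - C a b)) * C⁻¹ b j := by
  have : B⁻¹ - C⁻¹ = -(B⁻¹ * (B - C) * C⁻¹) := by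
    rw [mul_sub, sub_mul, Matrix.nonsing_inv_mul _ hB, mul_assoc, Matrix.mul_nonsing_inv _ hC]
    simp
  have := congrFun (congrFun this i) j
  simpa only [Matrix.sub_apply, Matrix.neg_apply, Matrix.mul_apply] using this

lemma isBigO_inv_F (a i : Fin 3) :
    (fun c : Config => c.w₁.F⁻¹ a i - c.w₂.F⁻¹ a i) =O[𝓟 (configs m L M)] Config.s := by
  have h : (fun c : Config => -∑ l, (∑ k, c.w₁.F⁻¹ a k * (c.w₁.F k l - c.w₂.F k l))
      * c.w₂.F⁻¹ l i) =O[𝓟 (configs m L M)] Config.s :=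
    (isBigO_sum fun l => isBigO_mul_bdd (isBigO_sum fun k =>
      isBigO_bdd_mul (bdd_inv_F₁ a k) (isBigO_F k l)) (bdd_inv_F₂ l i)).neg_left
  refine h.congr' (eventually_principal.2 fun c hc => ?_) EventuallyEq.rfl
  exact (inv_sub_inv_entry hc.1.admissible.isUnit_det_F hc.2.1.admissible.isUnit_det_F a i).symm

lemma isBigO_inv_A (a i : Fin 3) :
    (fun c : Config => c.w₁.A⁻¹ a i - c.w₂.A⁻¹ a i) =O[𝓟 (configs m L M)] Config.s := by
  have h : (fun c : Config => -∑ l, (∑ k, c.w₁.A⁻¹ a k * (c.w₁.A k l - c.w₂.A k l))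
      * c.w₂.A⁻¹ l i) =O[𝓟 (configs m L M)] Config.s :=
    (isBigO_sum fun l => isBigO_mul_bdd (isBigO_sum fun k =>
      isBigO_bdd_mul (bdd_inv_A₁ a k) (isBigO_A k l)) (bdd_inv_A₂ l i)).neg_left
  refine h.congr' (eventually_principal.2 fun c hc => ?_) EventuallyEq.rfl
  exact (inv_sub_inv_entry hc.1.admissible.isUnit_det_A hc.2.1.admissible.isUnit_det_A a i).symm

/-- Differences of products are controlled by the differences of the factors. -/
lemma isBigO_mul_sub_mul {S : Set Config} {f₁ f₂ g₁ g₂ r : Config → ℝ}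
    (hf₁ : f₁ =O[𝓟 S] fun _ => (1 : ℝ)) (hg₂ : g₂ =O[𝓟 S] fun _ => (1 : ℝ))
    (hf : (fun c => f₁ c - f₂ c) =O[𝓟 S] r) (hg : (fun c => g₁ c - g₂ c) =O[𝓟 S] r) :
    (fun c => f₁ c * g₁ c - f₂ c * g₂ c) =O[𝓟 S] r := by
  refine ((isBigO_bdd_mul hf₁ hg).add (isBigO_mul_bdd hf hg₂)).congr_left fun c => ?_
  ring

lemma relaxation_apply (w : PrimState) (a b : Fin 3) :
    relaxation w a b = ∑ k, w.F⁻¹ a k * w.F⁻¹ b k - w.A a b := by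
  simp [relaxation, Matrix.mul_apply]

lemma isBigO_relaxation (a b : Fin 3) :
    (fun c : Config => relaxation c.w₁ a b - relaxation c.w₂ a b)
      =O[𝓟 (configs m L M)] Config.s := by
  refine ((isBigO_sum fun k => isBigO_mul_sub_mul (bdd_inv_F₁ a k) (bdd_inv_F₂ b k)
    (isBigO_inv_F a k) (isBigO_inv_F b k)).sub (isBigO_A a b)).congr_left fun c => ?_
  rw [relaxation_apply, relaxation_apply, Finset.sum_sub_distrib]
  ring

lemma bdd_relaxation₁ (a b : Fin 3) :
    (fun c : Config => relaxation c.w₁ a b) =O[𝓟 (configs m L M)] fun _ => (1 : ℝ) := by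
  simp only [relaxation_apply]
  exact (isBigO_sum fun k => isBigO_mul_bdd (bdd_inv_F₁ a k) (bdd_inv_F₁ b k)).sub (bdd_A₁ a b)

lemma bdd_relaxation₂ (a b : Fin 3) :
    (fun c : Config => relaxation c.w₂ a b) =O[𝓟 (configs m L M)] fun _ => (1 : ℝ) := by
  simp only [relaxation_apply]
  exact (isBigO_sum fun k => isBigO_mul_bdd (bdd_inv_F₂ a k) (bdd_inv_F₂ b k)).sub (bdd_A₂ a b)

lemma isBigO_diffFA (i a : Fin 3) :
    (fun c : Config => diffFA c.w₁ c.w₂ i a) =O[𝓟 (configs m L M)] Config.s := by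
  unfold diffFA
  exact isBigO_sum fun b => isBigO_mul_sub_mul (bdd_F₁ i b) (bdd_A₂ b a) (isBigO_F i b)
    (isBigO_A b a)

lemma bdd_dFA (j i a : Fin 3) :
    (fun c : Config => dFA c.w₂ (c.g j) i a) =O[𝓟 (configs m L M)] fun _ => (1 : ℝ) := by
  unfold dFA
  exact isBigO_sum fun b => (isBigO_mul_bdd (bdd_grad_F j i b) (bdd_A₂ b a)).add
    (isBigO_mul_bdd (bdd_F₂ i b) (bdd_grad_A j b a))

variable {f : ℝ → ℝ}

lemma isBigO_comp_inv_ρ (hf : ContDiffOn ℝ ∞ f (Ioi 0)) (hm : 0 < m) :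
    (fun c : Config => f c.w₁.ρ⁻¹ - f c.w₂.ρ⁻¹) =O[𝓟 (configs m L M)] Config.s := by
  obtain ⟨K, hK⟩ := exists_lipschitz_Icc hf hm
  refine IsBigO.trans (isBigO_principal.2 ⟨K, fun c hc => ?_⟩) isBigO_inv_ρ
  exact hK _ hc.1.inv_mem _ hc.2.1.inv_mem

lemma isBigO_taylor_inv_ρ (hf : ContDiffOn ℝ ∞ f (Ioi 0)) (hm : 0 < m) :
    (fun c : Config => f c.w₁.ρ⁻¹ - f c.w₂.ρ⁻¹ - deriv f c.w₂.ρ⁻¹ * (c.w₁.ρ⁻¹ - c.w₂.ρ⁻¹))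
      =O[𝓟 (configs m L M)] fun c => c.s ^ 2 := by
  obtain ⟨K, hK⟩ := exists_taylor_Icc hf hm
  refine IsBigO.trans (isBigO_principal.2 ⟨K, fun c hc => ?_⟩) (isBigO_inv_ρ.pow 2)
  rw [Real.norm_eq_abs, norm_pow, Real.norm_eq_abs]
  exact hK _ hc.1.inv_mem _ hc.2.1.inv_mem

lemma bdd_comp_inv_ρ₂ (hf : ContDiffOn ℝ ∞ f (Ioi 0)) (hm : 0 < m) :
    (fun c : Config => f c.w₂.ρ⁻¹) =O[𝓟 (configs m L M)] fun _ => (1 : ℝ) := by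
  obtain ⟨K, hK⟩ := exists_bound_Icc hf hm
  exact isBigO_one_of_abs_le fun c hc => hK _ hc.2.1.inv_mem

lemma isBigO_relEnergy {G κ : ℝ} (hf : ContDiffOn ℝ ∞ f (Ioi 0)) (hm : 0 < m) :
    (fun c : Config => relEnergy G f κ c.w₁ c.w₂) =O[𝓟 (configs m L M)] fun c => c.s ^ 2 := by
  unfold relEnergy
  refine (((isBigO_bdd_mul (bdd_const _) (isBigO_sum fun i => (isBigO_u i).pow 2)).add
    (isBigO_taylor_inv_ρ hf hm)).add (isBigO_bdd_mul (bdd_const _) (isBigO_sum fun i =>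
      isBigO_sum fun a => isBigO_sum fun b => IsBigO.add (isBigO_bdd_mul (bdd_const _) ?_) ?_))).add
    (isBigO_bdd_mul (bdd_const _) (isBigO_sum fun a => isBigO_sum fun b => (isBigO_A a b).pow 2))
  · exact isBigO_mul_sq (isBigO_mul_bdd (isBigO_F i a) (bdd_A₁ a b)) (isBigO_F i b)
  · exact isBigO_mul_bdd (isBigO_mul_sq (isBigO_F i a) (isBigO_A a b)) (bdd_F₂ i b)

lemma isBigO_relFlux {G : ℝ} (hf : ContDiffOn ℝ ∞ f (Ioi 0)) (hm : 0 < m) (j : Fin 3) :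
    (fun c : Config => relFlux G f c.w₁ c.w₂ j) =O[𝓟 (configs m L M)] fun c => c.s ^ 2 := by
  unfold relFlux
  refine IsBigO.sub (isBigO_mul_sq (isBigO_u j) ?_) (isBigO_bdd_mul (bdd_const _) (isBigO_sum
    fun i => isBigO_sum fun a => isBigO_bdd_mul (isBigO_mul_bdd bdd_ρ₁ (bdd_F₁ j a))
      (isBigO_mul_sq (isBigO_u i) (isBigO_diffFA i a))))
  exact (isBigO_comp_inv_ρ (contDiffOn_deriv hf) hm).neg_left.congr_left fun c => by ring

/-- The material derivative of the second metric along the first flow. -/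
def Config.metricRate (c : Config) : Mat :=
  Matrix.of fun a b => c.ξ₂ * relaxation c.w₂ a b
    + ∑ j, (c.w₁.u j - c.w₂.u j) * (c.g j).A a b

lemma isBigO_metricRate_sub (a b : Fin 3) :
    (fun c : Config => c.ξ₁ * relaxation c.w₁ a b - c.metricRate a b)
      =O[𝓟 (configs m L M)] fun c => c.s + c.forcing := by
  have hs : Config.s =O[𝓟 (configs m L M)] fun c => c.s + c.forcing :=
    isBigO_of_le _ fun c => by
      rw [Real.norm_of_nonneg c.s_nonneg,
        Real.norm_of_nonneg (add_nonneg c.s_nonneg c.forcing_nonneg)]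
      linarith [c.forcing_nonneg]
  have hθ : (fun c : Config => (c.ξ₁ - c.ξ₂) * relaxation c.w₂ a b) =O[𝓟 (configs m L M)]
      fun c => c.s + c.forcing := by
    have h1 : (fun c : Config => (c.ξ₁ - c.ξ₂) * relaxation c.w₂ a b) =O[𝓟 (configs m L M)]
        fun c => c.forcing * relaxation c.w₂ a b := isBigO_of_le _ fun c => by
      unfold Config.forcing
      split_ifs with h
      · simp [h]
      · rw [norm_mul, norm_mul, Real.norm_eq_abs, Real.norm_eq_abs |_|, abs_abs]
    refine (h1.trans (isBigO_mul_bdd (isBigO_refl _ _) (bdd_relaxation₂ a b))).trans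
      (isBigO_of_le _ fun c => ?_)
    rw [Real.norm_of_nonneg c.forcing_nonneg,
        Real.norm_of_nonneg (add_nonneg c.s_nonneg c.forcing_nonneg)]
    linarith [c.s_nonneg]
  have h := (((isBigO_bdd_mul bdd_ξ₁ (isBigO_relaxation a b)).trans hs).add hθ).sub
    ((isBigO_sum fun j => isBigO_mul_bdd (isBigO_u j) (bdd_grad_A j a b)).trans hs)
  refine h.congr_left fun c => ?_
  simp only [Config.metricRate, Matrix.of_apply]
  ring

/-- The production of relative energy is quadratic in the difference of the states and the
forcing. -/
lemma isBigO_production {G κ : ℝ} (hf : ContDiffOn ℝ ∞ f (Ioi 0)) (hm : 0 < m) :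
    (fun c : Config => production G f κ c.w₁ c.w₂ c.g (c.ξ₁ • relaxation c.w₁) c.metricRate)
      =O[𝓟 (configs m L M)] fun c => (c.s + c.forcing) ^ 2 := by
  have hs : Config.s =O[𝓟 (configs m L M)] fun c => c.s + c.forcing :=
    isBigO_of_le _ fun c => by
      rw [Real.norm_of_nonneg c.s_nonneg,
        Real.norm_of_nonneg (add_nonneg c.s_nonneg c.forcing_nonneg)]
      linarith [c.forcing_nonneg]
  have hu := fun i => (isBigO_u (m := m) (L := L) (M := M) i).trans hs
  have hF := fun i a => (isBigO_F (m := m) (L := L) (M := M) i a).trans hs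
  have hA := fun i a => (isBigO_A (m := m) (L := L) (M := M) i a).trans hs
  have hZ := fun i a => (isBigO_diffFA (m := m) (L := L) (M := M) i a).trans hs
  have hg := bdd_grad_u (m := m) (L := L) (M := M)
  unfold production
  simp only [Matrix.smul_apply, smul_eq_mul]
  refine (((IsBigO.neg_left (isBigO_sum fun i => isBigO_sum fun j =>
    isBigO_mul_sq (hu i) (isBigO_mul_bdd (hu j) (hg j i)))).sub ?_).add
    (isBigO_bdd_mul (bdd_const _) (IsBigO.add (isBigO_sum fun i => isBigO_sum fun a =>
      IsBigO.add ?_ ?_) (isBigO_sum fun i => isBigO_sum fun a => isBigO_sum fun b =>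
        IsBigO.add (IsBigO.add ?_ ?_) ?_)))).add
    (isBigO_bdd_mul (bdd_const _) (isBigO_sum fun a => isBigO_sum fun b =>
      isBigO_mul_sq (hA a b) (isBigO_metricRate_sub a b)))
  · refine isBigO_bdd_mul (isBigO_mul_bdd bdd_inv_ρ₁ (isBigO_sum fun j => hg j j)) ?_
    have h1 := (isBigO_taylor_inv_ρ (L := L) (M := M) (contDiffOn_deriv hf) hm).trans (hs.pow 2)
    have h2 := ((isBigO_bdd_mul bdd_ρ₁ (isBigO_bdd_mul (bdd_comp_inv_ρ₂ (L := L) (M := M)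
      (contDiffOn_deriv (contDiffOn_deriv hf)) hm)
      (isBigO_mul_sq isBigO_inv_ρ isBigO_inv_ρ)))).trans (hs.pow 2)
    refine (h1.add h2).neg_left.congr' (eventually_principal.2 fun c hc => ?_) EventuallyEq.rfl
    have h1 := hc.1.ρ_pos.ne'
    have h2 := hc.2.1.ρ_pos.ne'
    field_simp
    ring
  · exact isBigO_mul_sq (hu i) (isBigO_sum fun j => isBigO_mul_bdd (hF j a) (bdd_dFA j i a))
  · exact isBigO_mul_sq (isBigO_sum fun j => (isBigO_mul_bdd (hF j a) (hg j i)).sub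
      (isBigO_mul_bdd (hu j) (bdd_grad_F j i a))) (hZ i a)
  · exact isBigO_bdd_mul (bdd_const _) (isBigO_mul_sq (isBigO_mul_bdd (hF i a)
      (isBigO_bdd_mul bdd_ξ₁ (bdd_relaxation₁ a b))) (hF i b))
  · exact isBigO_mul_bdd (isBigO_mul_sq (hF i a) (isBigO_metricRate_sub a b)) (bdd_F₂ i b)
  · refine isBigO_mul_bdd (isBigO_mul_sq (hF i a) (hA a b)) (isBigO_sum fun j => ?_)
    have hu1 : (fun c : Config => c.w₁.u j - c.w₂.u j) =O[𝓟 (configs m L M)]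
        fun _ => (1 : ℝ) := (bdd_u₁ j).sub (isBigO_one_of_abs_le fun _ h => h.2.1.u_le j)
    exact (isBigO_mul_bdd (hg j i) (bdd_F₂ j b)).add (isBigO_mul_bdd hu1 (bdd_grad_F j i b))

/-- On the bounded configurations, with the weight `κ` of the metrics, `c` is a constant of
coercivity of the relative energy, `v` bounds its speed of propagation, and `K` bounds its rate of
growth and the effect of the forcing. -/
def EnergyConstants (G : ℝ) (e₀ : ℝ → ℝ) (m L M κ c v K : ℝ) : Prop :=
  ∀ x ∈ configs m L M,
    c * distSq x.w₁ x.w₂ ≤ x.w₁.ρ * relEnergy G (volEnergy G e₀) κ x.w₁ x.w₂ ∧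
    (∀ j, |x.w₁.ρ * x.w₁.u j * relEnergy G (volEnergy G e₀) κ x.w₁ x.w₂
        + relFlux G (volEnergy G e₀) x.w₁ x.w₂ j|
      ≤ v * (x.w₁.ρ * relEnergy G (volEnergy G e₀) κ x.w₁ x.w₂)) ∧
    x.w₁.ρ * production G (volEnergy G e₀) κ x.w₁ x.w₂ x.g (x.ξ₁ • relaxation x.w₁) x.metricRate
      ≤ K * (x.w₁.ρ * relEnergy G (volEnergy G e₀) κ x.w₁ x.w₂) + K * x.forcing ^ 2

theorem exists_energy_constants {G : ℝ} (hG : 0 < G) {e₀ : ℝ → ℝ}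
    (he : ContDiffOn ℝ ∞ e₀ (Ioi 0)) (hc : ConvexOn ℝ (Ioi 0) e₀) (m L M : ℝ) (hm : 0 < m) :
    ∃ κ c v K : ℝ, 0 < c ∧ 0 < v ∧ 0 < K ∧ EnergyConstants G e₀ m L M κ c v K := by
  obtain ⟨κ, c, hc0, hco⟩ := relEnergy_coercive hG he hc hm
  have hε := contDiffOn_volEnergy (G := G) he
  have hQ := fun j => (isBigO_mul_bdd (isBigO_relEnergy (G := G) (κ := κ) (L := L) (M := M) hε hm)
    (isBigO_mul_bdd bdd_ρ₁ (bdd_u₁ j))).add (isBigO_relFlux (G := G) hε hm j)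
  have hQ' : ∃ k, 0 < k ∧ ∀ j, ∀ x ∈ configs m L M,
      |relEnergy G (volEnergy G e₀) κ x.w₁ x.w₂ * (x.w₁.ρ * x.w₁.u j)
        + relFlux G (volEnergy G e₀) x.w₁ x.w₂ j| ≤ k * distSq x.w₁ x.w₂ := by
    choose k hk using fun j => isBigO_principal.1 (hQ j)
    refine ⟨1 + ∑ j, |k j|, by positivity, fun j x hx => (hk j x hx).trans ?_⟩
    rw [norm_pow, Real.norm_of_nonneg x.s_nonneg, x.s_sq]
    refine mul_le_mul_of_nonneg_right ?_ (distSq_nonneg _ _)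
    have := Finset.single_le_sum (f := fun j => |k j|) (fun _ _ => abs_nonneg _)
      (Finset.mem_univ j)
    linarith [le_abs_self (k j)]
  obtain ⟨k, hk0, hk⟩ := hQ'
  obtain ⟨K, hK⟩ := isBigO_principal.1 (isBigO_bdd_mul bdd_ρ₁
    (isBigO_production (G := G) (κ := κ) (L := L) (M := M) hε hm))
  have hcm : 0 < c / m := by positivity
  have lower : ∀ x ∈ configs m L M, c / m * distSq x.w₁ x.w₂
      ≤ x.w₁.ρ * relEnergy G (volEnergy G e₀) κ x.w₁ x.w₂ := fun x hx => by
    have h1 := hco x.w₁ x.w₂ hx.1 hx.2.1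
    have h2 : m⁻¹ ≤ x.w₁.ρ := by
      have := inv_anti₀ (inv_pos.2 hx.1.ρ_pos) hx.1.inv_ρ_le
      rwa [inv_inv] at this
    calc c / m * distSq x.w₁ x.w₂ = m⁻¹ * (c * distSq x.w₁ x.w₂) := by ring
      _ ≤ _ := mul_le_mul h2 h1 (mul_nonneg hc0.le (distSq_nonneg _ _)) hx.1.ρ_pos.le
  have upper : ∀ x ∈ configs m L M, distSq x.w₁ x.w₂
      ≤ (c / m)⁻¹ * (x.w₁.ρ * relEnergy G (volEnergy G e₀) κ x.w₁ x.w₂) := fun x hx => by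
    rw [← div_eq_inv_mul, le_div_iff₀ hcm, mul_comm]; exact lower x hx
  refine ⟨κ, c / m, k * (c / m)⁻¹, max (2 * |K| * (c / m)⁻¹) (2 * |K| + 1), hcm, by positivity,
    lt_max_of_lt_right (by positivity), fun x hx => ⟨lower x hx, fun j => ?_, ?_⟩⟩
  · calc _ = |relEnergy G (volEnergy G e₀) κ x.w₁ x.w₂ * (x.w₁.ρ * x.w₁.u j)
        + relFlux G (volEnergy G e₀) x.w₁ x.w₂ j| := by congr 1; ring
      _ ≤ _ := hk j x hx
      _ ≤ k * ((c / m)⁻¹ * (x.w₁.ρ * relEnergy G (volEnergy G e₀) κ x.w₁ x.w₂)) := by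
        gcongr; exact upper x hx
      _ = _ := by ring
  · have h1 := (le_abs_self _).trans (hK x hx)
    rw [norm_pow, Real.norm_of_nonneg (add_nonneg x.s_nonneg x.forcing_nonneg)] at h1
    have h2 : K * (x.s + x.forcing) ^ 2 ≤ |K| * (2 * (x.s ^ 2 + x.forcing ^ 2)) :=
      mul_le_mul (le_abs_self K) (by nlinarith [sq_nonneg (x.s - x.forcing)]) (sq_nonneg _)
        (abs_nonneg K)
    have h3 := upper x hx
    rw [x.s_sq] at h2
    have h0 : 0 ≤ x.w₁.ρ * relEnergy G (volEnergy G e₀) κ x.w₁ x.w₂ :=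
      (mul_nonneg hcm.le (distSq_nonneg _ _)).trans (lower x hx)
    have h4 : 2 * |K| * distSq x.w₁ x.w₂ ≤
        max (2 * |K| * (c / m)⁻¹) (2 * |K| + 1)
          * (x.w₁.ρ * relEnergy G (volEnergy G e₀) κ x.w₁ x.w₂) :=
      calc _ ≤ 2 * |K| * ((c / m)⁻¹ * (x.w₁.ρ * relEnergy G (volEnergy G e₀) κ x.w₁ x.w₂)) := by
            gcongr
        _ = 2 * |K| * (c / m)⁻¹ * (x.w₁.ρ * relEnergy G (volEnergy G e₀) κ x.w₁ x.w₂) := by ring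
        _ ≤ _ := mul_le_mul_of_nonneg_right (le_max_left _ _) h0
    have h5 : 2 * |K| * x.forcing ^ 2 ≤ max (2 * |K| * (c / m)⁻¹) (2 * |K| + 1) * x.forcing ^ 2 :=
      mul_le_mul_of_nonneg_right ((by linarith : 2 * |K| ≤ 2 * |K| + 1).trans (le_max_right _ _))
        (sq_nonneg _)
    linarith

end

section

/-! ### Derivatives along curves of states -/

/-- The curve of states `γ` has the tangent vector `γ'` at `s`. -/
structure HasTangent (γ : ℝ → PrimState) (γ' : PrimState) (s : ℝ) : Prop where
  ρ : HasDerivAt (fun s => (γ s).ρ) γ'.ρ s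
  u : ∀ i, HasDerivAt (fun s => (γ s).u i) (γ'.u i) s
  F : ∀ i a, HasDerivAt (fun s => (γ s).F i a) (γ'.F i a) s
  A : ∀ a b, HasDerivAt (fun s => (γ s).A a b) (γ'.A a b) s

variable {γ₁ γ₂ : ℝ → PrimState} {d₁ d₂ : PrimState} {s : ℝ} {ε : ℝ → ℝ}

lemma HasTangent.comp_inv_ρ {γ : ℝ → PrimState} {γ' : PrimState} (h : HasTangent γ γ' s)
    {f : ℝ → ℝ} (hf : ContDiffOn ℝ ∞ f (Ioi 0)) (hρ : 0 < (γ s).ρ) :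
    HasDerivAt (fun s => f (γ s).ρ⁻¹) (deriv f (γ s).ρ⁻¹ * (-γ'.ρ / (γ s).ρ ^ 2)) s :=
  HasDerivAt.comp s (differentiableAt_of_pos hf (inv_pos.2 hρ)).hasDerivAt (h.ρ.inv hρ.ne')

lemma HasTangent.fa {γ : ℝ → PrimState} {γ' : PrimState} (h : HasTangent γ γ' s) (i a : Fin 3) :
    HasDerivAt (fun s => ∑ b, (γ s).F i b * (γ s).A b a) (dFA (γ s) γ' i a) s :=
  HasDerivAt.fun_sum fun b _ => (h.F i b).mul (h.A b a)

lemma hasDerivAt_diffFA (h₁ : HasTangent γ₁ d₁ s) (h₂ : HasTangent γ₂ d₂ s) (i a : Fin 3) :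
    HasDerivAt (fun s => diffFA (γ₁ s) (γ₂ s) i a) (dFA (γ₁ s) d₁ i a - dFA (γ₂ s) d₂ i a) s := by
  simp only [diffFA, Finset.sum_sub_distrib]
  exact (h₁.fa i a).sub (h₂.fa i a)

lemma hasDerivAt_relEnergy {G κ : ℝ} (hε : ContDiffOn ℝ ∞ ε (Ioi 0))
    (h₁ : HasTangent γ₁ d₁ s) (h₂ : HasTangent γ₂ d₂ s)
    (hρ₁ : 0 < (γ₁ s).ρ) (hρ₂ : 0 < (γ₂ s).ρ) :
    HasDerivAt (fun s => relEnergy G ε κ (γ₁ s) (γ₂ s))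
      (dRelEnergy G ε κ (γ₁ s) (γ₂ s) d₁ d₂) s := by
  have hu : HasDerivAt (fun s => (1 / 2) * ∑ i, ((γ₁ s).u i - (γ₂ s).u i) ^ 2)
      (∑ i, ((γ₁ s).u i - (γ₂ s).u i) * (d₁.u i - d₂.u i)) s := by
    refine ((HasDerivAt.fun_sum fun i _ => ((h₁.u i).sub (h₂.u i)).pow 2).const_mul
      (1 / 2)).congr_deriv ?_
    rw [Finset.mul_sum]
    refine Finset.sum_congr rfl fun i _ => ?_
    simp only [Nat.cast_ofNat, Pi.sub_apply]; ring
  have hv := ((h₁.comp_inv_ρ hε hρ₁).sub (h₂.comp_inv_ρ hε hρ₂)).sub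
    ((h₂.comp_inv_ρ (contDiffOn_deriv hε) hρ₂).mul ((h₁.ρ.inv hρ₁.ne').sub (h₂.ρ.inv hρ₂.ne')))
  have he : HasDerivAt (fun s => G * ∑ i, ∑ a, ∑ b,
      ((1 / 2) * (((γ₁ s).F i a - (γ₂ s).F i a) * (γ₁ s).A a b * ((γ₁ s).F i b - (γ₂ s).F i b))
        + ((γ₁ s).F i a - (γ₂ s).F i a) * ((γ₁ s).A a b - (γ₂ s).A a b) * (γ₂ s).F i b)) _ s :=
    (HasDerivAt.fun_sum fun i _ => HasDerivAt.fun_sum fun a _ => HasDerivAt.fun_sum fun b _ =>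
      (((((h₁.F i a).sub (h₂.F i a)).mul (h₁.A a b)).mul
        ((h₁.F i b).sub (h₂.F i b))).const_mul (1 / 2)).add
      ((((h₁.F i a).sub (h₂.F i a)).mul ((h₁.A a b).sub (h₂.A a b))).mul (h₂.F i b))).const_mul G
  have ha : HasDerivAt (fun s => κ / 2 * ∑ a, ∑ b, ((γ₁ s).A a b - (γ₂ s).A a b) ^ 2)
      (κ * ∑ a, ∑ b, ((γ₁ s).A a b - (γ₂ s).A a b) * (d₁.A a b - d₂.A a b)) s := by
    refine ((HasDerivAt.fun_sum fun a _ => HasDerivAt.fun_sum fun b _ =>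
      ((h₁.A a b).sub (h₂.A a b)).pow 2).const_mul (κ / 2)).congr_deriv ?_
    simp only [Finset.mul_sum]
    refine Finset.sum_congr rfl fun a _ => Finset.sum_congr rfl fun b _ => ?_
    simp only [Nat.cast_ofNat, Pi.sub_apply]; ring
  refine (((hu.add hv).add he).add ha).congr_deriv ?_
  unfold dRelEnergy
  congr 1
  congr 1
  · congr 1
    simp only [Pi.inv_apply, Pi.sub_apply]
    ring
  · congr 1
    refine Finset.sum_congr rfl fun i _ => Finset.sum_congr rfl fun a _ =>
      Finset.sum_congr rfl fun b _ => ?_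
    simp only [Pi.mul_apply, Pi.sub_apply]
    ring

lemma hasDerivAt_relFlux {G : ℝ} (hε : ContDiffOn ℝ ∞ ε (Ioi 0))
    (h₁ : HasTangent γ₁ d₁ s) (h₂ : HasTangent γ₂ d₂ s)
    (hρ₁ : 0 < (γ₁ s).ρ) (hρ₂ : 0 < (γ₂ s).ρ) (j : Fin 3) :
    HasDerivAt (fun s => relFlux G ε (γ₁ s) (γ₂ s) j)
      (dRelFlux G ε (γ₁ s) (γ₂ s) d₁ d₂ j
        - G * ∑ i, ∑ a, (d₁.ρ * (γ₁ s).F j a + (γ₁ s).ρ * d₁.F j a)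
          * (((γ₁ s).u i - (γ₂ s).u i) * diffFA (γ₁ s) (γ₂ s) i a)) s := by
  have hε' := contDiffOn_deriv hε
  have h := (((h₁.u j).sub (h₂.u j)).mul
    ((h₂.comp_inv_ρ hε' hρ₂).sub (h₁.comp_inv_ρ hε' hρ₁))).sub
    ((HasDerivAt.fun_sum fun i (_ : i ∈ Finset.univ) => HasDerivAt.fun_sum
      fun a (_ : a ∈ Finset.univ) => (h₁.ρ.mul (h₁.F j a)).mul
        (((h₁.u i).sub (h₂.u i)).mul (hasDerivAt_diffFA h₁ h₂ i a))).const_mul G)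
  refine h.congr_deriv ?_
  simp only [Pi.mul_apply, Pi.sub_apply]
  unfold dRelFlux
  rw [sub_sub, ← mul_add, ← Finset.sum_add_distrib]
  congr 2
  refine Finset.sum_congr rfl fun i _ => ?_
  rw [← Finset.sum_add_distrib]
  refine Finset.sum_congr rfl fun a _ => ?_
  ring

/-! ### Derivatives of fields -/

/-- The derivative of the field of states `w` at the point `p` of space-time in the direction
`e`. -/
def tangent (w : ℝ → Space → PrimState) (p e : ℝ × Space) : PrimState where
  ρ := fderiv ℝ (fun q : ℝ × Space => (w q.1 q.2).ρ) p e
  u := fun i => fderiv ℝ (fun q : ℝ × Space => (w q.1 q.2).u i) p e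
  F := Matrix.of fun i a => fderiv ℝ (fun q : ℝ × Space => (w q.1 q.2).F i a) p e
  A := Matrix.of fun a b => fderiv ℝ (fun q : ℝ × Space => (w q.1 q.2).A a b) p e

/-- The `j`-th coordinate direction of space, in space-time. -/
def spaceDir (j : Fin 3) : ℝ × Space := (0, EuclideanSpace.single j 1)

lemma spacetime_mem_nhds {T t : ℝ} (ht : t ∈ Ioo 0 T) (x : Space) :
    Ico 0 T ×ˢ (univ : Set Space) ∈ nhds (t, x) :=
  prod_mem_nhds (Ico_mem_nhds ht.1 ht.2) Filter.univ_mem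

lemma partialDeriv_eq {g : ℝ × Space → ℝ} {t : ℝ} {x : Space} (hg : DifferentiableAt ℝ g (t, x))
    (j : Fin 3) : partialDeriv j (fun y => g (t, y)) x = fderiv ℝ g (t, x) (spaceDir j) := by
  have h : HasFDerivAt (fun y : Space => (t, y)) (ContinuousLinearMap.inr ℝ ℝ Space) x :=
    hasFDerivAt_prodMk_right t x
  have := HasFDerivAt.comp (g := g) x hg.hasFDerivAt h
  unfold partialDeriv
  rw [show (fun y => g (t, y)) = g ∘ fun y => (t, y) from rfl, this.fderiv]
  rfl

lemma deriv_time_eq {g : ℝ × Space → ℝ} {t : ℝ} {x : Space} (hg : DifferentiableAt ℝ g (t, x)) :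
    deriv (fun s => g (s, x)) t = fderiv ℝ g (t, x) (1, 0) := by
  have h : HasFDerivAt (fun s : ℝ => (s, x)) (ContinuousLinearMap.inl ℝ ℝ Space) t :=
    hasFDerivAt_prodMk_left t x
  have := (HasFDerivAt.comp (g := g) t hg.hasFDerivAt h).hasDerivAt
  rw [show (fun s => g (s, x)) = g ∘ fun s => (s, x) from rfl, this.deriv]
  rfl

lemma spacetime_dir_eq (v : Fin 3 → ℝ) :
    ((1, WithLp.toLp 2 v) : ℝ × Space) = (1, 0) + ∑ j, v j • spaceDir j := by
  ext k
  · simp [spaceDir, Prod.fst_sum]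
  · simp [spaceDir, Fin.sum_univ_three, PiLp.single_apply]
    fin_cases k <;> simp

lemma fderiv_transport (g : ℝ × Space → ℝ) (p : ℝ × Space) (v : Fin 3 → ℝ) :
    fderiv ℝ g p (1, WithLp.toLp 2 v)
      = fderiv ℝ g p (1, 0) + ∑ j, v j * fderiv ℝ g p (spaceDir j) := by
  rw [spacetime_dir_eq, map_add, map_sum]
  simp only [map_smul, smul_eq_mul]

lemma tangent_transport (w : ℝ → Space → PrimState) (p : ℝ × Space) (v v' : Fin 3 → ℝ) :
    tangent w p (1, WithLp.toLp 2 v)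
      = shift (tangent w p (1, WithLp.toLp 2 v')) (fun j => v j - v' j)
          (fun j => tangent w p (spaceDir j)) := by
  have key : ∀ g : ℝ × Space → ℝ, fderiv ℝ g p (1, WithLp.toLp 2 v)
      = fderiv ℝ g p (1, WithLp.toLp 2 v')
        + ∑ j, (v j - v' j) * fderiv ℝ g p (spaceDir j) := fun g => by
    rw [fderiv_transport g p v, fderiv_transport g p v']
    simp only [Fin.sum_univ_three]; ring
  unfold tangent shift
  simp only [PrimState.mk.injEq]
  refine ⟨key _, funext fun i => key _, ?_, ?_⟩
  · ext i a; exact key _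
  · ext i a; exact key _

lemma IsSmoothField.hasTangent {T : ℝ} {w : ℝ → Space → PrimState} (hw : IsSmoothField T w)
    {t : ℝ} (ht : t ∈ Ioo 0 T) (x : Space) (e : ℝ × Space) :
    HasTangent (fun s => w ((t, x) + s • e).1 ((t, x) + s • e).2) (tangent w (t, x) e) 0 := by
  have key : ∀ g : ℝ × Space → ℝ, ContDiffOn ℝ ∞ g (Ico 0 T ×ˢ univ) →
      HasDerivAt (fun s : ℝ => g ((t, x) + s • e)) (fderiv ℝ g (t, x) e) 0 := fun g hg =>
    ((hg.contDiffAt (spacetime_mem_nhds ht x)).differentiableAt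
      (by simp)).hasFDerivAt.hasLineDerivAt e
  exact ⟨key _ hw.ρ, fun i => key _ (hw.u i), fun i a => key _ (hw.F i a),
    fun a b => key _ (hw.A a b)⟩

/-- The derivative of a scalar field can be computed along lines. -/
lemma fderiv_eq_of_hasDerivAt {g : ℝ × Space → ℝ} {p e : ℝ × Space} {d : ℝ}
    (hg : DifferentiableAt ℝ g p) (h : HasDerivAt (fun s : ℝ => g (p + s • e)) d 0) :
    fderiv ℝ g p e = d :=
  HasDerivAt.unique (hg.hasFDerivAt.hasLineDerivAt e) h

variable {G T : ℝ} {w w₁ w₂ : ℝ → Space → PrimState}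

lemma contDiffOn_comp_inv_ρ (hw : IsSmoothField T w)
    (hadm : ∀ t ∈ Ico 0 T, ∀ x, (w t x).Admissible) {f : ℝ → ℝ} (hf : ContDiffOn ℝ ∞ f (Ioi 0)) :
    ContDiffOn ℝ ∞ (fun q : ℝ × Space => f (w q.1 q.2).ρ⁻¹) (Ico 0 T ×ˢ univ) :=
  hf.comp (hw.ρ.inv fun q hq => (hadm q.1 hq.1 q.2).ρ_pos.ne')
    fun q hq => inv_pos.2 (hadm q.1 hq.1 q.2).ρ_pos

lemma contDiffOn_relEnergy {κ : ℝ} (hε : ContDiffOn ℝ ∞ ε (Ioi 0))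
    (h₁ : IsSmoothField T w₁) (h₂ : IsSmoothField T w₂)
    (a₁ : ∀ t ∈ Ico 0 T, ∀ x, (w₁ t x).Admissible)
    (a₂ : ∀ t ∈ Ico 0 T, ∀ x, (w₂ t x).Admissible) :
    ContDiffOn ℝ ∞ (fun q : ℝ × Space => relEnergy G ε κ (w₁ q.1 q.2) (w₂ q.1 q.2))
      (Ico 0 T ×ˢ univ) := by
  unfold relEnergy
  refine (((contDiffOn_const.mul (ContDiffOn.sum fun i _ => ((h₁.u i).sub (h₂.u i)).pow 2)).add
    (((contDiffOn_comp_inv_ρ h₁ a₁ hε).sub (contDiffOn_comp_inv_ρ h₂ a₂ hε)).sub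
      ((contDiffOn_comp_inv_ρ h₂ a₂ (contDiffOn_deriv hε)).mul
        ((contDiffOn_comp_inv_ρ h₁ a₁ contDiffOn_id).sub
          (contDiffOn_comp_inv_ρ h₂ a₂ contDiffOn_id))))).add
    (contDiffOn_const.mul (ContDiffOn.sum fun i _ => ContDiffOn.sum fun a _ =>
      ContDiffOn.sum fun b _ => ?_))).add
    (contDiffOn_const.mul (ContDiffOn.sum fun a _ => ContDiffOn.sum fun b _ =>
      ((h₁.A a b).sub (h₂.A a b)).pow 2))
  exact (contDiffOn_const.mul ((((h₁.F i a).sub (h₂.F i a)).mul (h₁.A a b)).mul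
    ((h₁.F i b).sub (h₂.F i b)))).add
    ((((h₁.F i a).sub (h₂.F i a)).mul ((h₁.A a b).sub (h₂.A a b))).mul (h₂.F i b))

lemma contDiffOn_relFlux (hε : ContDiffOn ℝ ∞ ε (Ioi 0))
    (h₁ : IsSmoothField T w₁) (h₂ : IsSmoothField T w₂)
    (a₁ : ∀ t ∈ Ico 0 T, ∀ x, (w₁ t x).Admissible)
    (a₂ : ∀ t ∈ Ico 0 T, ∀ x, (w₂ t x).Admissible) (j : Fin 3) :
    ContDiffOn ℝ ∞ (fun q : ℝ × Space => relFlux G ε (w₁ q.1 q.2) (w₂ q.1 q.2) j)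
      (Ico 0 T ×ˢ univ) := by
  unfold relFlux diffFA
  exact (((h₁.u j).sub (h₂.u j)).mul ((contDiffOn_comp_inv_ρ h₂ a₂ (contDiffOn_deriv hε)).sub
    (contDiffOn_comp_inv_ρ h₁ a₁ (contDiffOn_deriv hε)))).sub
    (contDiffOn_const.mul (ContDiffOn.sum fun i _ => ContDiffOn.sum fun a _ =>
      (h₁.ρ.mul (h₁.F j a)).mul (((h₁.u i).sub (h₂.u i)).mul (ContDiffOn.sum fun b _ =>
        ((h₁.F i b).mul (h₁.A b a)).sub ((h₂.F i b).mul (h₂.A b a))))))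

end

section

/-! ### The equations of motion in the variables `(ρ, u, F, A)` -/

lemma contDiffOn_det {E : Type*} [NormedAddCommGroup E] [NormedSpace ℝ E] {S : Set E} {B : E → Mat}
    (hB : ∀ a b, ContDiffOn ℝ ∞ (fun q => B q a b) S) :
    ContDiffOn ℝ ∞ (fun q => (B q).det) S := by
  simp only [Matrix.det_fin_three]
  fun_prop (disch := assumption)

lemma contDiffOn_inv_entry {E : Type*} [NormedAddCommGroup E] [NormedSpace ℝ E] {S : Set E}
    {B : E → Mat}
    (hB : ∀ a b, ContDiffOn ℝ ∞ (fun q => B q a b) S) (hdet : ∀ q ∈ S, (B q).det ≠ 0)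
    (a b : Fin 3) : ContDiffOn ℝ ∞ (fun q => (B q)⁻¹ a b) S := by
  have e : (fun q => (B q)⁻¹ a b) = fun q => (B q).det⁻¹ * (B q).adjugate a b := by
    funext q
    rw [Matrix.inv_def, Ring.inverse_eq_inv', Matrix.smul_apply, smul_eq_mul]
  rw [e]
  refine ((contDiffOn_det hB).inv hdet).mul ?_
  simp only [Matrix.adjugate_fin_three]
  fin_cases a <;> fin_cases b <;> simp <;> fun_prop (disch := assumption)

variable {G T ξ : ℝ} {e₀ : ℝ → ℝ} {w : ℝ → Space → PrimState}

lemma IsSmoothField.inv_A_sq (hw : IsSmoothField T w)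
    (hadm : ∀ t ∈ Ico 0 T, ∀ x, (w t x).Admissible) (a b : Fin 3) :
    ContDiffOn ℝ ∞ (fun q : ℝ × Space => ((w q.1 q.2).A⁻¹ * (w q.1 q.2).A⁻¹) a b)
      (Ico 0 T ×ˢ univ) := by
  have h := contDiffOn_inv_entry (B := fun q : ℝ × Space => (w q.1 q.2).A) hw.A
    fun q hq => (hadm q.1 hq.1 q.2).A_posDef.det_pos.ne'
  simp only [Matrix.mul_apply]
  exact ContDiffOn.sum fun k _ => (h a k).mul (h k b)

/-- A matrix field `A` and `B = A⁻²` satisfy `∂B A² + B (∂A A + A ∂A) = 0`. -/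
lemma fderiv_inv_A_sq (hw : IsSmoothField T w) (hadm : ∀ t ∈ Ico 0 T, ∀ x, (w t x).Admissible)
    {t : ℝ} (ht : t ∈ Ioo 0 T) (x : Space) (e : ℝ × Space) :
    (tangent w (t, x) e).A * (w t x).A + (w t x).A * (tangent w (t, x) e).A
      = -((w t x).A * (w t x).A * (Matrix.of fun a b => fderiv ℝ
          (fun q : ℝ × Space => ((w q.1 q.2).A⁻¹ * (w q.1 q.2).A⁻¹) a b) (t, x) e)
          * ((w t x).A * (w t x).A)) := by
  set dB : Mat := Matrix.of fun a b => fderiv ℝ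
    (fun q : ℝ × Space => ((w q.1 q.2).A⁻¹ * (w q.1 q.2).A⁻¹) a b) (t, x) e with hdB
  set A := (w t x).A with hA
  set dA := (tangent w (t, x) e).A with hdA
  have hu : IsUnit A.det := (hadm t (Ioo_subset_Ico_self ht) x).isUnit_det_A
  have hAd : ∀ a b, HasFDerivAt (fun q : ℝ × Space => (w q.1 q.2).A a b)
      (fderiv ℝ (fun q : ℝ × Space => (w q.1 q.2).A a b) (t, x)) (t, x) := fun a b =>
    (((hw.A a b).contDiffAt (spacetime_mem_nhds ht x)).differentiableAt (by simp)).hasFDerivAt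
  have hBd : ∀ a b, HasFDerivAt (fun q : ℝ × Space => ((w q.1 q.2).A⁻¹ * (w q.1 q.2).A⁻¹) a b)
      (fderiv ℝ (fun q : ℝ × Space => ((w q.1 q.2).A⁻¹ * (w q.1 q.2).A⁻¹) a b) (t, x)) (t, x) :=
    fun a b => (((hw.inv_A_sq hadm a b).contDiffAt
      (spacetime_mem_nhds ht x)).differentiableAt (by simp)).hasFDerivAt
  have key : dB * (A * A) + (A⁻¹ * A⁻¹) * (dA * A + A * dA) = 0 := by
    ext a b
    have hconst : (fun q : ℝ × Space => ∑ k, ((w q.1 q.2).A⁻¹ * (w q.1 q.2).A⁻¹) a k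
        * ∑ l, (w q.1 q.2).A k l * (w q.1 q.2).A l b)
        =ᶠ[nhds (t, x)] fun _ => (1 : Mat) a b := by
      filter_upwards [spacetime_mem_nhds ht x] with q hq
      have hq' : IsUnit (w q.1 q.2).A.det := (hadm q.1 hq.1 q.2).isUnit_det_A
      have : (w q.1 q.2).A⁻¹ * (w q.1 q.2).A⁻¹ * ((w q.1 q.2).A * (w q.1 q.2).A) = 1 := by
        rw [mul_assoc, ← mul_assoc (w q.1 q.2).A⁻¹ (w q.1 q.2).A, Matrix.nonsing_inv_mul _ hq',
          one_mul, Matrix.nonsing_inv_mul _ hq']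
      have := congrFun (congrFun this a) b
      rw [Matrix.mul_apply] at this
      exact (Finset.sum_congr rfl fun k _ => by rw [← Matrix.mul_apply]).trans this
    have h0 : fderiv ℝ (fun q : ℝ × Space => ∑ k, ((w q.1 q.2).A⁻¹ * (w q.1 q.2).A⁻¹) a k
        * ∑ l, (w q.1 q.2).A k l * (w q.1 q.2).A l b) (t, x) = 0 := by
      rw [hconst.fderiv_eq]; simp
    have h1 := HasFDerivAt.fun_sum (u := Finset.univ) fun k (_ : k ∈ Finset.univ) =>
      (hBd a k).mul (HasFDerivAt.fun_sum (u := Finset.univ) fun l (_ : l ∈ Finset.univ) =>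
        (hAd k l).mul (hAd l b))
    have h2 := congrArg (fun φ => φ e) (h1.fderiv.symm.trans h0)
    simp only [sum_apply, add_apply,
      smul_apply, smul_eq_mul, zero_apply] at h2
    have h3 : ∀ k, (A * A) k b = ∑ l, A k l * A l b := fun k => Matrix.mul_apply
    have h4 : ∀ k, (dA * A + A * dA) k b = ∑ l, (A k l * dA l b + A l b * dA k l) := fun k => by
      rw [Matrix.add_apply, Matrix.mul_apply, Matrix.mul_apply, add_comm, Finset.sum_add_distrib]
      congr 1
      exact Finset.sum_congr rfl fun l _ => mul_comm _ _
    rw [Matrix.add_apply, Matrix.mul_apply, Matrix.mul_apply, ← Finset.sum_add_distrib,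
      Matrix.zero_apply]
    refine Eq.trans (Finset.sum_congr rfl fun k _ => ?_) h2
    rw [h3, h4, add_comm]
    exact congrArg₂ (· + ·) rfl (mul_comm _ _)
  have h1 : A * A * (dB * (A * A) + (A⁻¹ * A⁻¹) * (dA * A + A * dA)) = 0 := by
    rw [key, mul_zero]
  have h2 : A * A * (A⁻¹ * A⁻¹) = 1 := by
    rw [mul_assoc, ← mul_assoc A A⁻¹, Matrix.mul_nonsing_inv _ hu, one_mul,
      Matrix.mul_nonsing_inv _ hu]
  rw [mul_add, ← mul_assoc (A * A) (A⁻¹ * A⁻¹), h2, one_mul, ← mul_assoc] at h1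
  rw [eq_neg_iff_add_eq_zero, add_comm]
  exact h1

lemma PrimState.Admissible.A_transpose {w : PrimState} (h : w.Admissible) : w.Aᵀ = w.A := by
  ext a b; exact h.A_symm b a

lemma PrimState.Admissible.inv_A_transpose {w : PrimState} (h : w.Admissible) :
    (w.A⁻¹)ᵀ = w.A⁻¹ := by
  rw [Matrix.transpose_nonsing_inv, h.A_transpose]

lemma PrimState.Admissible.inv_A_sq_symm {w : PrimState} (h : w.Admissible) (a b : Fin 3) :
    (w.A⁻¹ * w.A⁻¹) a b = (w.A⁻¹ * w.A⁻¹) b a := by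
  have : (w.A⁻¹ * w.A⁻¹)ᵀ = w.A⁻¹ * w.A⁻¹ := by
    rw [Matrix.transpose_mul, h.inv_A_transpose]
  exact congrFun (congrFun this b) a

/-- For a symmetric matrix `X` and a positive definite `A`, the trace of `X (X A + A X)` is
`2 tr (X A X)`, which bounds `X`. -/
lemma sylvester_bound {A X : Mat} (hA : A.PosDef) {m : ℝ} (hm : 0 < m)
    (hi : ∀ a b, |A⁻¹ a b| ≤ m) (hX : ∀ a b, X a b = X b a) :
    2 * ((3 * m)⁻¹ * ∑ i, ∑ a, X i a ^ 2) ≤ ∑ i, ∑ a, X i a * (X * A + A * X) a i := by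
  have hsymm : ∀ a b, A a b = A b a := fun a b => by
    have := congrFun (congrFun hA.isHermitian b) a
    simpa using this
  have h := Finset.sum_le_sum fun i (_ : i ∈ Finset.univ) =>
    posDef_lower_bound hA hm hi (fun a => X i a)
  rw [← Finset.mul_sum] at h
  have e : ∑ i, ∑ a, X i a * (X * A + A * X) a i = 2 * ∑ i, ∑ a, ∑ b, X i a * A a b * X i b := by
    have e1 : ∑ i, ∑ a, X i a * (A * X) a i = ∑ i, ∑ a, ∑ b, X i a * A a b * X i b := by
      refine Finset.sum_congr rfl fun i _ => Finset.sum_congr rfl fun a _ => ?_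
      rw [Matrix.mul_apply, Finset.mul_sum]
      refine Finset.sum_congr rfl fun b _ => ?_
      rw [hX b i, mul_assoc]
    have e2 : ∑ i, ∑ a, X i a * (X * A) a i = ∑ i, ∑ a, ∑ b, X i a * A a b * X i b := by
      rw [Finset.sum_comm]
      refine Finset.sum_congr rfl fun a _ => ?_
      rw [Finset.sum_comm' (t' := Finset.univ) (s' := fun _ => Finset.univ) (by simp)]
      refine Finset.sum_congr rfl fun i _ => ?_
      rw [Matrix.mul_apply, Finset.mul_sum]
      refine Finset.sum_congr rfl fun b _ => ?_
      rw [hX i a, hsymm b i]; ring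
    simp only [Matrix.add_apply, mul_add, Finset.sum_add_distrib]
    rw [e1, e2]; ring
  rw [e]
  linarith

lemma tangent_A_symm (hadm : ∀ t ∈ Ico 0 T, ∀ x, (w t x).Admissible)
    {t : ℝ} (ht : t ∈ Ioo 0 T) (x : Space) (e : ℝ × Space) (a b : Fin 3) :
    (tangent w (t, x) e).A a b = (tangent w (t, x) e).A b a := by
  have h : (fun q : ℝ × Space => (w q.1 q.2).A a b) =ᶠ[nhds (t, x)]
      fun q => (w q.1 q.2).A b a := by
    filter_upwards [spacetime_mem_nhds ht x] with q hq
    exact (hadm q.1 hq.1 q.2).A_symm a b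
  simp only [tangent, Matrix.of_apply]
  rw [h.fderiv_eq]

lemma relaxation_symm {w : PrimState} (h : w.Admissible) (a b : Fin 3) :
    relaxation w a b = relaxation w b a := by
  rw [relaxation_apply, relaxation_apply, h.A_symm a b]
  congr 1
  exact Finset.sum_congr rfl fun k _ => mul_comm _ _

lemma fderiv_mul_apply {f g : ℝ × Space → ℝ} {p : ℝ × Space} (hf : DifferentiableAt ℝ f p)
    (hg : DifferentiableAt ℝ g p) (e : ℝ × Space) :
    fderiv ℝ (fun q => f q * g q) p e = f p * fderiv ℝ g p e + fderiv ℝ f p e * g p := by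
  rw [fderiv_fun_mul hf hg]
  simp [mul_comm (g p)]

/-- The balance laws of a quantity `ρ f`, with a flux which is advected up to `J`, once the
conservation of mass is taken into account. -/
lemma advected_balance {r f : ℝ × Space → ℝ} {m J : Fin 3 → ℝ × Space → ℝ} {p : ℝ × Space}
    {c : ℝ} (hr : DifferentiableAt ℝ r p) (hf : DifferentiableAt ℝ f p)
    (hm : ∀ j, DifferentiableAt ℝ (m j) p) (hJ : ∀ j, DifferentiableAt ℝ (J j) p)
    (u : Fin 3 → ℝ) (hu : ∀ j, m j p = r p * u j)
    (hmass : fderiv ℝ r p (1, 0) + ∑ j, fderiv ℝ (m j) p (spaceDir j) = 0)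
    (h : fderiv ℝ (fun q => r q * f q) p (1, 0)
      + ∑ j, fderiv ℝ (fun q => m j q * f q - J j q) p (spaceDir j) = c) :
    r p * fderiv ℝ f p (1, WithLp.toLp 2 u) = c + ∑ j, fderiv ℝ (J j) p (spaceDir j) := by
  rw [fderiv_transport, ← h, fderiv_mul_apply hr hf]
  have : ∀ j, fderiv ℝ (fun q => m j q * f q - J j q) p (spaceDir j)
      = r p * (u j * fderiv ℝ f p (spaceDir j)) + fderiv ℝ (m j) p (spaceDir j) * f p
        - fderiv ℝ (J j) p (spaceDir j) := fun j => by
    have e1 : fderiv ℝ (fun q => m j q * f q - J j q) p (spaceDir j)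
        = fderiv ℝ (fun q => m j q * f q) p (spaceDir j) - fderiv ℝ (J j) p (spaceDir j) := by
      rw [fderiv_fun_sub (f := fun q => m j q * f q) ((hm j).mul hf) (hJ j)]; rfl
    rw [e1, fderiv_mul_apply (hm j) hf, hu]
    ring
  simp only [this, Finset.sum_add_distrib, Finset.sum_sub_distrib, ← Finset.mul_sum,
    ← Finset.sum_mul]
  linear_combination (-f p) * hmass

lemma IsSmoothSolution.mass_eq (hw : IsSmoothSolution G e₀ ξ T w) {t : ℝ} (ht : t ∈ Ioo 0 T)
    (x : Space) : fderiv ℝ (fun q : ℝ × Space => (w q.1 q.2).ρ) (t, x) (1, 0)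
      + ∑ j, fderiv ℝ (fun q : ℝ × Space => (w q.1 q.2).ρ * (w q.1 q.2).u j) (t, x)
        (spaceDir j) = 0 := by
  have hd : ∀ g : ℝ × Space → ℝ, ContDiffOn ℝ ∞ g (Ico 0 T ×ˢ univ) →
      DifferentiableAt ℝ g (t, x) := fun g hg =>
    (hg.contDiffAt (spacetime_mem_nhds ht x)).differentiableAt (by simp)
  have h : deriv (fun s => (w s x).ρ) t
      + ∑ α, partialDeriv α (fun y => (w t y).ρ * (w t y).u α) x = ξ * 0 :=
    hw.balance t ht x (Sum.inl ())
  rw [mul_zero] at h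
  rw [← h, ← deriv_time_eq (hd _ hw.smooth.ρ)]
  congr 1
  refine Finset.sum_congr rfl fun j _ => ?_
  exact (partialDeriv_eq (hd _ (hw.smooth.ρ.mul (hw.smooth.u j))) j).symm

lemma stress_apply (he : ContDiffOn ℝ ∞ e₀ (Ioi 0)) {w : PrimState} (hw : 0 < w.ρ)
    (i α : Fin 3) : stress G e₀ w i α = deriv (volEnergy G e₀) w.ρ⁻¹ * (1 : Mat) i α
      + G * ∑ a, (w.ρ * w.F α a) * ∑ b, w.F i b * w.A b a := by
  rw [deriv_volEnergy he (inv_pos.2 hw)]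
  simp only [stress, pressure, Matrix.add_apply, Matrix.neg_apply, Matrix.smul_apply,
    Matrix.sub_apply, smul_eq_mul, Matrix.mul_apply, Matrix.transpose_apply]
  rw [div_inv_eq_mul, Finset.mul_sum, mul_sub, Finset.mul_sum]
  have : ∑ a, w.ρ * G * ((∑ b, w.F i b * w.A b a) * w.F α a)
      = ∑ a, G * (w.ρ * w.F α a * ∑ b, w.F i b * w.A b a) :=
    Finset.sum_congr rfl fun a _ => by ring
  rw [this]
  ring

/-- The material derivative and the gradient of a smooth solution satisfy the equations of motion
in non-conservative form. -/
theorem IsSmoothSolution.pointEquations (hw : IsSmoothSolution G e₀ ξ T w)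
    (he : ContDiffOn ℝ ∞ e₀ (Ioi 0)) {t : ℝ} (ht : t ∈ Ioo 0 T) (x : Space) :
    PointEquations G (volEnergy G e₀) ξ (w t x)
      (tangent w (t, x) (1, WithLp.toLp 2 (w t x).u))
      (fun j => tangent w (t, x) (spaceDir j)) := by
  have ht' := Ioo_subset_Ico_self ht
  have hρ := (hw.admissible t ht' x).ρ_pos
  have hs := hw.smooth
  have hd : ∀ {g : ℝ × Space → ℝ}, ContDiffOn ℝ ∞ g (Ico 0 T ×ˢ univ) →
      DifferentiableAt ℝ g (t, x) := fun hg =>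
    (hg.contDiffAt (spacetime_mem_nhds ht x)).differentiableAt (by simp)
  have hmass := hw.mass_eq ht x
  have hpiola : ∀ a, ∑ j, fderiv ℝ (fun q : ℝ × Space => (w q.1 q.2).ρ * (w q.1 q.2).F j a)
      (t, x) (spaceDir j) = 0 := fun a => by
    rw [← hw.piola t ht' x a]
    exact Finset.sum_congr rfl fun j _ =>
      (partialDeriv_eq (hd (hs.ρ.mul (hs.F j a))) j).symm
  have hm := fun j => hd (hs.ρ.mul (hs.u j))
  refine ⟨?_, fun i => ?_, fun i a => ?_, fun a b => ?_⟩
  · simp only [tangent]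
    rw [fderiv_transport]
    have : ∀ j, fderiv ℝ (fun q : ℝ × Space => (w q.1 q.2).ρ * (w q.1 q.2).u j) (t, x)
        (spaceDir j) = _ := fun j => fderiv_mul_apply (hd hs.ρ) (hd (hs.u j)) (spaceDir j)
    simp only [this] at hmass
    rw [Finset.sum_add_distrib, ← Finset.mul_sum] at hmass
    rw [eq_neg_iff_add_eq_zero, ← hmass]
    simp only [mul_comm]
    ring
  · have hε := contDiffOn_volEnergy (G := G) he
    set ε := volEnergy G e₀ with hεdef
    have hp := contDiffOn_comp_inv_ρ hs hw.admissible (contDiffOn_deriv hε)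
    have hZ : ∀ a, ContDiffOn ℝ ∞ (fun q : ℝ × Space => ∑ b, (w q.1 q.2).F i b * (w q.1 q.2).A b a)
        (Ico 0 T ×ˢ univ) := fun a => ContDiffOn.sum fun b _ => (hs.F i b).mul (hs.A b a)
    have hJ : ∀ j, ContDiffOn ℝ ∞ (fun q : ℝ × Space => deriv ε (w q.1 q.2).ρ⁻¹ * (1 : Mat) i j
      + G * ∑ a, ((w q.1 q.2).ρ * (w q.1 q.2).F j a) * ∑ b, (w q.1 q.2).F i b * (w q.1 q.2).A b a)
        (Ico 0 T ×ˢ univ) := fun j => (hp.mul contDiffOn_const).add (contDiffOn_const.mul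
          (ContDiffOn.sum fun a _ => (hs.ρ.mul (hs.F j a)).mul (hZ a)))
    have h0 : deriv (fun s => (w s x).ρ * (w s x).u i) t
        + ∑ α, partialDeriv α (fun y => (w t y).ρ * (w t y).u i * (w t y).u α
          - stress G e₀ (w t y) i α) x = ξ * 0 := hw.balance t ht x (Sum.inr (Sum.inl i))
    have h := advected_balance (hd hs.ρ) (hd (hs.u i)) hm (fun j => hd (hJ j)) (w t x).u
      (fun _ => rfl) hmass (c := 0) (by
        rw [mul_zero] at h0
        rw [← h0, ← deriv_time_eq (hd (hs.ρ.mul (hs.u i)))]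
        congr 1
        refine Finset.sum_congr rfl fun j _ => ?_
        rw [← partialDeriv_eq (((hm j).fun_mul (hd (hs.u i))).fun_sub (hd (hJ j)))]
        congr 1
        funext y
        rw [stress_apply he (hw.admissible t ht' y).ρ_pos]
        ring)
    rw [zero_add] at h
    refine h.trans ?_
    have hval : ∀ j, fderiv ℝ (fun q : ℝ × Space => deriv ε (w q.1 q.2).ρ⁻¹ * (1 : Mat) i j
      + G * ∑ a, ((w q.1 q.2).ρ * (w q.1 q.2).F j a) * ∑ b, (w q.1 q.2).F i b * (w q.1 q.2).A b a)
        (t, x) (spaceDir j) = deriv (deriv ε) (w t x).ρ⁻¹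
          * (-(tangent w (t, x) (spaceDir j)).ρ / (w t x).ρ ^ 2) * (1 : Mat) i j
        + G * ∑ a, (fderiv ℝ (fun q : ℝ × Space => (w q.1 q.2).ρ * (w q.1 q.2).F j a)
              (t, x) (spaceDir j) * (∑ b, (w t x).F i b * (w t x).A b a)
            + (w t x).ρ * (w t x).F j a
              * dFA (w t x) (tangent w (t, x) (spaceDir j)) i a) := fun j => by
      have hT := hs.hasTangent ht x (spaceDir j)
      refine fderiv_eq_of_hasDerivAt (hd (hJ j)) ?_
      have h1 := hT.comp_inv_ρ (contDiffOn_deriv hε) (by simpa using hρ)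
      have h2 : ∀ a, HasDerivAt (fun s : ℝ => (w ((t, x) + s • spaceDir j).1
          ((t, x) + s • spaceDir j).2).ρ * (w ((t, x) + s • spaceDir j).1
          ((t, x) + s • spaceDir j).2).F j a) (fderiv ℝ (fun q : ℝ × Space =>
            (w q.1 q.2).ρ * (w q.1 q.2).F j a) (t, x) (spaceDir j)) 0 := fun a =>
        (hd (hs.ρ.mul (hs.F j a))).hasFDerivAt.hasLineDerivAt _
      have h3 := (h1.mul_const ((1 : Mat) i j)).add ((HasDerivAt.fun_sum (u := Finset.univ)
        fun a _ => (h2 a).mul (hT.fa i a)).const_mul G)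
      simp only [zero_smul, add_zero] at h3
      exact h3
    simp only [hval, divStress]
    rw [Finset.sum_add_distrib]
    congr 1
    · rw [Finset.sum_eq_single i (fun j _ hj => by simp [Matrix.one_apply_ne hj.symm]) (by simp)]
      simp only [Matrix.one_apply_eq]
      ring
    · rw [← Finset.mul_sum, Finset.sum_comm, mul_comm (w t x).ρ G, mul_assoc]
      refine congrArg (G * ·) ?_
      rw [Finset.mul_sum]
      refine Finset.sum_congr rfl fun a _ => ?_
      rw [Finset.sum_add_distrib, ← Finset.sum_mul, hpiola, zero_mul, zero_add, Finset.mul_sum]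
      exact Finset.sum_congr rfl fun j _ => by ring
  · have h0 : deriv (fun s => (w s x).ρ * (w s x).F i a) t
        + ∑ α, partialDeriv α (fun y => (w t y).ρ * (w t y).F i a * (w t y).u α
          - (w t y).u i * ((w t y).ρ * (w t y).F α a)) x = ξ * 0 :=
      hw.balance t ht x (Sum.inr (Sum.inr (Sum.inl (i, a))))
    have hJ : ∀ j, ContDiffOn ℝ ∞ (fun q : ℝ × Space => (w q.1 q.2).u i
        * ((w q.1 q.2).ρ * (w q.1 q.2).F j a)) (Ico 0 T ×ˢ univ) := fun j =>
      (hs.u i).mul (hs.ρ.mul (hs.F j a))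
    have h := advected_balance (hd hs.ρ) (hd (hs.F i a)) hm (fun j => hd (hJ j)) (w t x).u
      (fun _ => rfl) hmass (c := 0) (by
        rw [mul_zero] at h0
        rw [← h0, ← deriv_time_eq (hd (hs.ρ.mul (hs.F i a)))]
        congr 1
        refine Finset.sum_congr rfl fun j _ => ?_
        rw [← partialDeriv_eq (((hm j).fun_mul (hd (hs.F i a))).fun_sub (hd (hJ j)))]
        congr 1
        funext y
        ring)
    have hval : ∀ j, fderiv ℝ (fun q : ℝ × Space => (w q.1 q.2).u i
        * ((w q.1 q.2).ρ * (w q.1 q.2).F j a)) (t, x) (spaceDir j) = _ := fun j =>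
      fderiv_mul_apply (hd (hs.u i)) (hd (hs.ρ.mul (hs.F j a))) (spaceDir j)
    simp only [hval] at h
    rw [Finset.sum_add_distrib, ← Finset.mul_sum, hpiola, mul_zero, zero_add, zero_add] at h
    refine mul_left_cancel₀ hρ.ne' (h.trans ?_)
    rw [Finset.mul_sum]
    exact Finset.sum_congr rfl fun j _ => by simp only [tangent]; ring
  · set A := (w t x).A with hA
    set S := relaxation (w t x) with hS
    set dA := (tangent w (t, x) (1, WithLp.toLp 2 (w t x).u)).A with hdA
    have hadm := hw.admissible t ht' x
    have hu : IsUnit A.det := hadm.isUnit_det_A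
    have hB := hs.inv_A_sq hw.admissible
    -- the balance law of `ρ A⁻²`, for the entries on and above the diagonal
    have upper : ∀ a b, a ≤ b → fderiv ℝ (fun q : ℝ × Space =>
        ((w q.1 q.2).A⁻¹ * (w q.1 q.2).A⁻¹) a b) (t, x) (1, WithLp.toLp 2 (w t x).u)
        = -(ξ * (A⁻¹ * A⁻¹ * S * A⁻¹ + A⁻¹ * S * (A⁻¹ * A⁻¹)) a b) := fun a b hab => by
      have h0 : deriv (fun s => (w s x).ρ * ((w s x).A⁻¹ * (w s x).A⁻¹) a b) t
          + ∑ α, partialDeriv α (fun y => ((w t y).ρ * (w t y).u α)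
            * ((w t y).A⁻¹ * (w t y).A⁻¹) a b) x
          = ξ * (-((w t x).ρ * (A⁻¹ * A⁻¹ * S * A⁻¹ + A⁻¹ * S * (A⁻¹ * A⁻¹)) a b)) :=
        hw.balance t ht x (Sum.inr (Sum.inr (Sum.inr ⟨(a, b), hab⟩)))
      have h := advected_balance (J := fun _ _ => 0) (hd hs.ρ) (hd (hB a b)) hm
        (fun j => differentiableAt_const _) (w t x).u (fun _ => rfl) hmass
        (c := ξ * (-((w t x).ρ * (A⁻¹ * A⁻¹ * S * A⁻¹ + A⁻¹ * S * (A⁻¹ * A⁻¹)) a b))) (by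
          rw [← h0, ← deriv_time_eq (hd (hs.ρ.mul (hB a b)))]
          congr 1
          refine Finset.sum_congr rfl fun j _ => ?_
          simp only [sub_zero]
          rw [← partialDeriv_eq ((hm j).fun_mul (hd (hB a b)))])
      simp only [fderiv_fun_const, Pi.zero_apply, zero_apply, Finset.sum_const_zero,
        add_zero] at h
      refine mul_left_cancel₀ hρ.ne' (h.trans ?_)
      ring
    have symm : ∀ a b, (A⁻¹ * A⁻¹ * S * A⁻¹ + A⁻¹ * S * (A⁻¹ * A⁻¹)) a b
        = (A⁻¹ * A⁻¹ * S * A⁻¹ + A⁻¹ * S * (A⁻¹ * A⁻¹)) b a := fun a b => by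
      have hSt : Sᵀ = S := by ext a b; exact relaxation_symm hadm b a
      have : (A⁻¹ * A⁻¹ * S * A⁻¹ + A⁻¹ * S * (A⁻¹ * A⁻¹))ᵀ
          = A⁻¹ * A⁻¹ * S * A⁻¹ + A⁻¹ * S * (A⁻¹ * A⁻¹) := by
        simp only [Matrix.transpose_add, Matrix.transpose_mul, hSt, hadm.inv_A_transpose, hA]
        rw [add_comm]
        simp only [mul_assoc]
      exact congrFun (congrFun this b) a
    have all : (Matrix.of fun a b => fderiv ℝ (fun q : ℝ × Space =>
        ((w q.1 q.2).A⁻¹ * (w q.1 q.2).A⁻¹) a b) (t, x) (1, WithLp.toLp 2 (w t x).u))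
        = -(ξ • (A⁻¹ * A⁻¹ * S * A⁻¹ + A⁻¹ * S * (A⁻¹ * A⁻¹))) := by
      ext a b
      rw [Matrix.of_apply, Matrix.neg_apply, Matrix.smul_apply, smul_eq_mul]
      rcases le_total a b with hab | hab
      · exact upper a b hab
      · have h : (fun q : ℝ × Space => ((w q.1 q.2).A⁻¹ * (w q.1 q.2).A⁻¹) a b) =ᶠ[nhds (t, x)]
            fun q => ((w q.1 q.2).A⁻¹ * (w q.1 q.2).A⁻¹) b a := by
          filter_upwards [spacetime_mem_nhds ht x] with q hq
          exact (hw.admissible q.1 hq.1 q.2).inv_A_sq_symm a b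
        rw [h.fderiv_eq, upper b a hab, symm]
    have key := fderiv_inv_A_sq hs hw.admissible ht x (1, WithLp.toLp 2 (w t x).u)
    rw [all, ← hA, ← hdA] at key
    have c1 : A * A⁻¹ = 1 := Matrix.mul_nonsing_inv _ hu
    have c2 : A⁻¹ * A = 1 := Matrix.nonsing_inv_mul _ hu
    have e1 : A * A * (A⁻¹ * A⁻¹ * S * A⁻¹ + A⁻¹ * S * (A⁻¹ * A⁻¹)) * (A * A)
        = S * A + A * S := by
      have k1 : A * A * (A⁻¹ * A⁻¹ * S * A⁻¹) * (A * A)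
          = A * (A * A⁻¹) * A⁻¹ * S * (A⁻¹ * A) * A := by simp only [mul_assoc]
      have k2 : A * A * (A⁻¹ * S * (A⁻¹ * A⁻¹)) * (A * A)
          = A * (A * A⁻¹) * S * A⁻¹ * (A⁻¹ * A) * A := by simp only [mul_assoc]
      rw [mul_add, add_mul, k1, k2, c1, c2, mul_one, mul_one, c1, mul_one, one_mul,
        mul_assoc (A * S), c2, mul_one]
    have e2 : (dA - ξ • S) * A + A * (dA - ξ • S) = 0 := by
      have : -(A * A * -(ξ • (A⁻¹ * A⁻¹ * S * A⁻¹ + A⁻¹ * S * (A⁻¹ * A⁻¹))) * (A * A))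
          = ξ • (A * A * (A⁻¹ * A⁻¹ * S * A⁻¹ + A⁻¹ * S * (A⁻¹ * A⁻¹)) * (A * A)) := by
        rw [mul_neg, neg_mul, neg_neg, mul_smul_comm, smul_mul_assoc]
      rw [this, e1] at key
      rw [sub_mul, mul_sub, smul_mul_assoc, mul_smul_comm]
      rw [smul_add] at key
      rw [sub_add_sub_comm, key, sub_self]
    have hsym : ∀ a b, (dA - ξ • S) a b = (dA - ξ • S) b a := fun a b => by
      rw [Matrix.sub_apply, Matrix.sub_apply, Matrix.smul_apply, Matrix.smul_apply,
        hS, relaxation_symm hadm a b, hdA, tangent_A_symm hw.admissible ht x _ a b]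
    set m : ℝ := 1 + ∑ a, ∑ b, |A⁻¹ a b| with hm_def
    have hm0 : 0 < m := by positivity
    have hbd := sylvester_bound hadm.A_posDef hm0 (fun a b => by
      have h1 := Finset.single_le_sum (f := fun b => |A⁻¹ a b|) (fun _ _ => abs_nonneg _)
        (Finset.mem_univ b)
      have h2 := Finset.single_le_sum (f := fun a => ∑ b, |A⁻¹ a b|)
        (fun _ _ => Finset.sum_nonneg fun _ _ => abs_nonneg _) (Finset.mem_univ a)
      exact (h1.trans h2).trans (by rw [hm_def]; linarith)) hsym
    rw [← hA, e2] at hbd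
    simp only [Matrix.zero_apply, mul_zero, Finset.sum_const_zero] at hbd
    have h0 : ∑ i, ∑ a, (dA - ξ • S) i a ^ 2 ≤ 0 := by
      by_contra hcon
      have : 0 < 2 * ((3 * m)⁻¹ * ∑ i, ∑ a, (dA - ξ • S) i a ^ 2) := by
        have := not_le.1 hcon
        positivity
      linarith
    have h1 := sq_entry_le (dA - ξ • S) 0 a b
    simp only [Matrix.zero_apply, sub_zero] at h1
    have h2 : (dA - ξ • S) a b = 0 := by
      have := le_antisymm (h1.trans h0) (sq_nonneg _)
      exact pow_eq_zero_iff (two_ne_zero) |>.1 this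
    rw [Matrix.sub_apply, Matrix.smul_apply, smul_eq_mul, sub_eq_zero] at h2
    exact h2

end

section

/-! ### The balance of relative energy -/

/-- The relative energy per unit volume of two flows. -/
def energyDensity (G : ℝ) (ε : ℝ → ℝ) (κ : ℝ) (w₁ w₂ : ℝ → Space → PrimState) (q : ℝ × Space) : ℝ :=
  (w₁ q.1 q.2).ρ * relEnergy G ε κ (w₁ q.1 q.2) (w₂ q.1 q.2)

/-- The flux of the relative energy of two flows. -/
def energyFlux (G : ℝ) (ε : ℝ → ℝ) (κ : ℝ) (w₁ w₂ : ℝ → Space → PrimState) (j : Fin 3)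
    (q : ℝ × Space) : ℝ :=
  (w₁ q.1 q.2).ρ * (w₁ q.1 q.2).u j * relEnergy G ε κ (w₁ q.1 q.2) (w₂ q.1 q.2)
    + relFlux G ε (w₁ q.1 q.2) (w₂ q.1 q.2) j

/-- The configuration of two flows at a point of space-time. -/
def configAt (ξ₁ ξ₂ : ℝ) (w₁ w₂ : ℝ → Space → PrimState) (p : ℝ × Space) : Config where
  w₁ := w₁ p.1 p.2
  w₂ := w₂ p.1 p.2
  g := fun j => tangent w₂ p (spaceDir j)
  ξ₁ := ξ₁
  ξ₂ := ξ₂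

variable {G κ T ξ₁ ξ₂ : ℝ} {e₀ : ℝ → ℝ} {w₁ w₂ : ℝ → Space → PrimState}

lemma contDiffOn_energyDensity (he : ContDiffOn ℝ ∞ e₀ (Ioi 0))
    (h₁ : IsSmoothSolution G e₀ ξ₁ T w₁) (h₂ : IsSmoothSolution G e₀ ξ₂ T w₂) :
    ContDiffOn ℝ ∞ (energyDensity G (volEnergy G e₀) κ w₁ w₂) (Ico 0 T ×ˢ univ) :=
  h₁.smooth.ρ.mul (contDiffOn_relEnergy (contDiffOn_volEnergy he) h₁.smooth h₂.smooth
    h₁.admissible h₂.admissible)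

lemma contDiffOn_energyFlux (he : ContDiffOn ℝ ∞ e₀ (Ioi 0))
    (h₁ : IsSmoothSolution G e₀ ξ₁ T w₁) (h₂ : IsSmoothSolution G e₀ ξ₂ T w₂) (j : Fin 3) :
    ContDiffOn ℝ ∞ (energyFlux G (volEnergy G e₀) κ w₁ w₂ j) (Ico 0 T ×ˢ univ) :=
  ((h₁.smooth.ρ.mul (h₁.smooth.u j)).mul (contDiffOn_relEnergy (contDiffOn_volEnergy he)
    h₁.smooth h₂.smooth h₁.admissible h₂.admissible)).add
    (contDiffOn_relFlux (contDiffOn_volEnergy he) h₁.smooth h₂.smooth h₁.admissible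
      h₂.admissible j)

/-- The relative energy of two smooth solutions is conserved up to the production. The terms in
which the flux is differentiated through `ρ F` cancel by the Piola identity of the first flow. -/
theorem energy_balance (he : ContDiffOn ℝ ∞ e₀ (Ioi 0))
    (h₁ : IsSmoothSolution G e₀ ξ₁ T w₁) (h₂ : IsSmoothSolution G e₀ ξ₂ T w₂)
    {t : ℝ} (ht : t ∈ Ioo 0 T) (x : Space) :
    fderiv ℝ (energyDensity G (volEnergy G e₀) κ w₁ w₂) (t, x) (1, 0)
      + ∑ j, fderiv ℝ (energyFlux G (volEnergy G e₀) κ w₁ w₂ j) (t, x) (spaceDir j)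
    = (w₁ t x).ρ * production G (volEnergy G e₀) κ (w₁ t x) (w₂ t x)
        (configAt ξ₁ ξ₂ w₁ w₂ (t, x)).g (ξ₁ • relaxation (w₁ t x))
        (configAt ξ₁ ξ₂ w₁ w₂ (t, x)).metricRate := by
  have ht' := Ioo_subset_Ico_self ht
  have hd : ∀ {g : ℝ × Space → ℝ}, ContDiffOn ℝ ∞ g (Ico 0 T ×ˢ univ) →
      DifferentiableAt ℝ g (t, x) := fun hg =>
    (hg.contDiffAt (spacetime_mem_nhds ht x)).differentiableAt (by simp)
  have hε := contDiffOn_volEnergy (G := G) he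
  set ε := volEnergy G e₀ with hεdef
  have a₁ := h₁.admissible t ht' x
  have a₂ := h₂.admissible t ht' x
  have hE := hd (contDiffOn_relEnergy (G := G) (κ := κ) hε h₁.smooth h₂.smooth
    h₁.admissible h₂.admissible)
  have hJ := fun j => hd (contDiffOn_relFlux (G := G) hε h₁.smooth h₂.smooth
    h₁.admissible h₂.admissible j)
  have hpiola : ∀ a, ∑ j, fderiv ℝ (fun q : ℝ × Space => (w₁ q.1 q.2).ρ * (w₁ q.1 q.2).F j a)
      (t, x) (spaceDir j) = 0 := fun a => by
    rw [← h₁.piola t ht' x a]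
    exact Finset.sum_congr rfl fun j _ =>
      (partialDeriv_eq (hd (h₁.smooth.ρ.mul (h₁.smooth.F j a))) j).symm
  have adv := advected_balance (hd h₁.smooth.ρ) hE
    (fun j => hd (h₁.smooth.ρ.mul (h₁.smooth.u j))) (fun j => (hJ j).fun_neg) (w₁ t x).u
    (fun _ => rfl) (h₁.mass_eq ht x) rfl
  simp only [sub_neg_eq_add] at adv
  have hgoal : ∀ X Y Z : ℝ, Y = X + Z → Y - Z = X := fun X Y Z h => by rw [h]; ring
  have adv' := hgoal _ _ _ adv
  refine adv'.symm.trans ?_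
  have hrel : fderiv ℝ (fun q : ℝ × Space => relEnergy G ε κ (w₁ q.1 q.2) (w₂ q.1 q.2)) (t, x)
      (1, WithLp.toLp 2 (w₁ t x).u) = dRelEnergy G ε κ (w₁ t x) (w₂ t x)
        (tangent w₁ (t, x) (1, WithLp.toLp 2 (w₁ t x).u))
        (tangent w₂ (t, x) (1, WithLp.toLp 2 (w₁ t x).u)) := by
    refine fderiv_eq_of_hasDerivAt hE ?_
    have := hasDerivAt_relEnergy (G := G) (κ := κ) hε
      (h₁.smooth.hasTangent ht x (1, WithLp.toLp 2 (w₁ t x).u))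
      (h₂.smooth.hasTangent ht x (1, WithLp.toLp 2 (w₁ t x).u))
      (by simpa using a₁.ρ_pos) (by simpa using a₂.ρ_pos)
    simp only [zero_smul, add_zero] at this
    exact this
  have hflux : ∀ j, fderiv ℝ (fun q : ℝ × Space => relFlux G ε (w₁ q.1 q.2) (w₂ q.1 q.2) j) (t, x)
      (spaceDir j) = dRelFlux G ε (w₁ t x) (w₂ t x) (tangent w₁ (t, x) (spaceDir j))
        (tangent w₂ (t, x) (spaceDir j)) j - G * ∑ i, ∑ a,
          fderiv ℝ (fun q : ℝ × Space => (w₁ q.1 q.2).ρ * (w₁ q.1 q.2).F j a) (t, x) (spaceDir j)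
          * (((w₁ t x).u i - (w₂ t x).u i) * diffFA (w₁ t x) (w₂ t x) i a) := fun j => by
    refine fderiv_eq_of_hasDerivAt (hJ j) ?_
    have := hasDerivAt_relFlux (G := G) hε
      (h₁.smooth.hasTangent ht x (spaceDir j)) (h₂.smooth.hasTangent ht x (spaceDir j))
      (by simpa using a₁.ρ_pos) (by simpa using a₂.ρ_pos) j
    simp only [zero_smul, add_zero] at this
    refine this.congr_deriv ?_
    congr 2
    refine Finset.sum_congr rfl fun i _ => Finset.sum_congr rfl fun a _ => ?_
    congr 1
    rw [fderiv_mul_apply (hd h₁.smooth.ρ) (hd (h₁.smooth.F j a))]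
    simp only [tangent, Matrix.of_apply]
    ring
  have hneg : ∀ j, fderiv ℝ (fun q : ℝ × Space => -relFlux G ε (w₁ q.1 q.2) (w₂ q.1 q.2) j) (t, x)
      (spaceDir j) = -fderiv ℝ (fun q : ℝ × Space => relFlux G ε (w₁ q.1 q.2) (w₂ q.1 q.2) j)
        (t, x) (spaceDir j) := fun j => by rw [fderiv_fun_neg]; rfl
  have hsum : ∑ j, ∑ i, ∑ a,
      fderiv ℝ (fun q : ℝ × Space => (w₁ q.1 q.2).ρ * (w₁ q.1 q.2).F j a) (t, x) (spaceDir j)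
        * (((w₁ t x).u i - (w₂ t x).u i) * diffFA (w₁ t x) (w₂ t x) i a) = 0 := by
    rw [Finset.sum_comm]
    refine Finset.sum_eq_zero fun i _ => ?_
    rw [Finset.sum_comm]
    refine Finset.sum_eq_zero fun a _ => ?_
    rw [← Finset.sum_mul, hpiola, zero_mul]
  simp only [hneg, hflux]
  rw [hrel, Finset.sum_neg_distrib, Finset.sum_sub_distrib, ← Finset.mul_sum, hsum, mul_zero,
    sub_zero, sub_neg_eq_add]
  rw [tangent_transport w₂ (t, x) (w₁ t x).u (w₂ t x).u]
  have E₁ := h₁.pointEquations he ht x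
  have E₂ := h₂.pointEquations he ht x
  refine (energy_balance_pointwise a₁.ρ_pos.ne' a₂.ρ_pos.ne' a₁.A_symm a₂.A_symm E₁ E₂).trans ?_
  have m₁ : (tangent w₁ (t, x) (1, WithLp.toLp 2 (w₁ t x).u)).A = ξ₁ • relaxation (w₁ t x) := by
    ext a b
    rw [Matrix.smul_apply, smul_eq_mul, E₁.metric]
  have m₂ : (shift (tangent w₂ (t, x) (1, WithLp.toLp 2 (w₂ t x).u))
      (fun j => (w₁ t x).u j - (w₂ t x).u j) fun j => tangent w₂ (t, x) (spaceDir j)).A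
      = (configAt ξ₁ ξ₂ w₁ w₂ (t, x)).metricRate := by
    ext a b
    simp only [shift, Config.metricRate, configAt, Matrix.of_apply, E₂.metric]
  rw [m₁, m₂]
  rfl

/-! ### Integration over backward cones -/

lemma hasDerivAt_max_zero_sq (s : ℝ) :
    HasDerivAt (fun s : ℝ => max s 0 ^ 2) (2 * max s 0) s := by
  rcases lt_trichotomy s 0 with h | h | h
  · rw [max_eq_right h.le, mul_zero]
    refine (hasDerivAt_const s (0 : ℝ)).congr_of_eventuallyEq ?_
    filter_upwards [Iio_mem_nhds h] with y hy
    rw [max_eq_right (le_of_lt hy)]; norm_num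
  · subst h
    rw [max_self, mul_zero, hasDerivAt_iff_isLittleO_nhds_zero]
    have hlo : (fun h : ℝ => h ^ 2) =o[nhds 0] fun h : ℝ => h := by
      simpa using Asymptotics.isLittleO_pow_id (𝕜 := ℝ) one_lt_two
    refine (Asymptotics.IsBigO.of_bound 1 (Filter.Eventually.of_forall fun y => ?_)).trans_isLittleO
      hlo
    rcases le_total y 0 with h | h <;> simp [h, sq_nonneg]
  · have h1 := (hasDerivAt_pow 2 s)
    rw [max_eq_left h.le]
    refine (h1.congr_deriv (by norm_num)).congr_of_eventuallyEq ?_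
    filter_upwards [Ioi_mem_nhds h] with y hy
    rw [max_eq_left (le_of_lt hy)]

lemma contDiff_max_zero_sq : ContDiff ℝ 1 fun s : ℝ => max s 0 ^ 2 := by
  rw [contDiff_one_iff_deriv]
  refine ⟨fun s => (hasDerivAt_max_zero_sq s).differentiableAt, ?_⟩
  rw [show deriv (fun s : ℝ => max s 0 ^ 2) = fun s => 2 * max s 0 from
    funext fun s => (hasDerivAt_max_zero_sq s).deriv]
  fun_prop

/-- A smooth substitute for the norm. -/
def smoothNorm (y : Space) : ℝ := √(1 + ‖y‖ ^ 2)

lemma norm_le_smoothNorm (y : Space) : ‖y‖ ≤ smoothNorm y :=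
  Real.le_sqrt_of_sq_le (by linarith)

lemma smoothNorm_pos (y : Space) : 0 < smoothNorm y := Real.sqrt_pos.2 (by positivity)

lemma contDiff_smoothNorm : ContDiff ℝ 1 smoothNorm :=
  (contDiff_const.add (contDiff_norm_sq ℝ)).sqrt fun y => by positivity

lemma abs_fderiv_smoothNorm_le (y e : Space) : |fderiv ℝ smoothNorm y e| ≤ ‖e‖ := by
  have h1 : HasFDerivAt (fun y : Space => 1 + ‖y‖ ^ 2) ((2 : ℕ) • innerSL ℝ y) y :=
    (hasStrictFDerivAt_norm_sq y).hasFDerivAt.const_add 1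
  have h2 : HasFDerivAt smoothNorm _ y := h1.sqrt (by positivity)
  rw [h2.fderiv]
  simp only [smul_apply, smul_eq_mul, innerSL_apply_apply, nsmul_eq_mul, Nat.cast_ofNat]
  have h3 : (1 : ℝ) / (2 * √(1 + ‖y‖ ^ 2)) * (2 * inner ℝ y e)
      = inner ℝ y e / smoothNorm y := by
    unfold smoothNorm; field_simp
  rw [h3, abs_div, abs_of_pos (smoothNorm_pos y), div_le_iff₀ (smoothNorm_pos y), mul_comm]
  exact (abs_real_inner_le_norm y e).trans
    (mul_le_mul_of_nonneg_right (norm_le_smoothNorm y) (norm_nonneg e))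

/-- The height of a point of space-time inside the backward cone (a hyperboloid, in fact) of
slope `c`, centre `z` and size `N`. -/
def coneHeight (c N : ℝ) (z : Space) (q : ℝ × Space) : ℝ := N - c * q.1 - smoothNorm (q.2 - z)

/-- The weight which is positive inside the backward cone, and vanishes to second order at its
boundary. -/
def coneWeight (c N : ℝ) (z : Space) (q : ℝ × Space) : ℝ := max (coneHeight c N z q) 0 ^ 2

variable {c N : ℝ} {z : Space}

lemma contDiff_coneHeight : ContDiff ℝ 1 (coneHeight c N z) :=
  (contDiff_const.sub (contDiff_const.mul contDiff_fst)).sub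
    (contDiff_smoothNorm.comp (contDiff_snd.sub contDiff_const))

lemma contDiff_coneWeight : ContDiff ℝ 1 (coneWeight c N z) :=
  contDiff_max_zero_sq.comp contDiff_coneHeight

lemma coneWeight_nonneg (q : ℝ × Space) : 0 ≤ coneWeight c N z q := sq_nonneg _

lemma coneWeight_pos_iff {q : ℝ × Space} : 0 < coneWeight c N z q ↔ 0 < coneHeight c N z q := by
  unfold coneWeight
  constructor
  · intro h
    by_contra hc
    rw [max_eq_right (not_lt.1 hc)] at h
    norm_num at h
  · intro h
    exact pow_pos (lt_max_of_lt_left h) 2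

lemma fderiv_coneWeight (q e : ℝ × Space) : fderiv ℝ (coneWeight c N z) q e
    = 2 * max (coneHeight c N z q) 0 * (-(c * e.1) - fderiv ℝ smoothNorm (q.2 - z) e.2) := by
  have h1 : HasFDerivAt (coneHeight c N z) _ q :=
    ((hasFDerivAt_const N q).sub ((hasFDerivAt_fst (𝕜 := ℝ) (p := q)).const_mul c)).sub
      (HasFDerivAt.comp (g := smoothNorm) (f := fun q : ℝ × Space => q.2 - z) q
        (contDiff_smoothNorm.differentiable one_ne_zero _).hasFDerivAt
        ((hasFDerivAt_snd (𝕜 := ℝ) (p := q)).sub_const z))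
  have h2 := (hasDerivAt_max_zero_sq (coneHeight c N z q)).comp_hasFDerivAt q h1
  have h3 : fderiv ℝ (coneWeight c N z) q = _ := h2.fderiv
  rw [h3]
  simp

lemma fderiv_coneWeight_time (q : ℝ × Space) : fderiv ℝ (coneWeight c N z) q (1, 0)
    = -(2 * max (coneHeight c N z q) 0 * c) := by
  rw [fderiv_coneWeight]; simp

lemma abs_fderiv_coneWeight_space (q : ℝ × Space) (j : Fin 3) :
    |fderiv ℝ (coneWeight c N z) q (spaceDir j)| ≤ 2 * max (coneHeight c N z q) 0 := by
  have h0 : 0 ≤ 2 * max (coneHeight c N z q) 0 := by positivity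
  rw [fderiv_coneWeight, abs_mul, abs_of_nonneg h0]
  have h1 := abs_fderiv_smoothNorm_le (q.2 - z) (EuclideanSpace.single j 1)
  have h2 : ‖(EuclideanSpace.single j 1 : Space)‖ = 1 := by simp
  rw [h2] at h1
  refine mul_le_of_le_one_right h0 ?_
  simpa [spaceDir] using h1

lemma coneHeight_nonpos_of_notMem (hc : 0 ≤ c) {t : ℝ} (ht : 0 ≤ t) {x : Space}
    (hx : x ∉ Metric.closedBall z N) : coneHeight c N z (t, x) ≤ 0 := by
  rw [Metric.mem_closedBall, dist_eq_norm, not_le] at hx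
  have := norm_le_smoothNorm (x - z)
  unfold coneHeight
  have := mul_nonneg hc ht
  simp only
  linarith

end

section

lemma integrable_of_zero_outside {f : Space → ℝ} (hf : Continuous f) {z : Space} {N : ℝ}
    (h : ∀ x, x ∉ Metric.closedBall z N → f x = 0) : Integrable f :=
  hf.integrable_of_hasCompactSupport
    (HasCompactSupport.intro (isCompact_closedBall z N) h)

section

variable {η : ℝ × Space → ℝ} {Q : Fin 3 → ℝ × Space → ℝ} {T c N : ℝ} {z : Space}

lemma continuousOn_fderiv_apply {g : ℝ × Space → ℝ} (hg : ContDiffOn ℝ 1 g (Ico 0 T ×ˢ univ))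
    (e : ℝ × Space) : ContinuousOn (fun q => fderiv ℝ g q e) (Ioo 0 T ×ˢ univ) :=
  ((hg.mono (prod_mono_left Ioo_subset_Ico_self)).continuousOn_fderiv_of_isOpen
    (isOpen_Ioo.prod isOpen_univ) le_rfl).clm_apply continuousOn_const

lemma continuous_slice {g : ℝ × Space → ℝ} {S : Set ℝ} (hg : ContinuousOn g (S ×ˢ univ)) {t : ℝ}
    (ht : t ∈ S) : Continuous fun x => g (t, x) :=
  continuousOn_univ.1 (hg.comp (by fun_prop) fun _ _ => ⟨ht, mem_univ _⟩)

lemma differentiableAt_spacetime {g : ℝ × Space → ℝ} (hg : ContDiffOn ℝ 1 g (Ico 0 T ×ˢ univ))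
    {t : ℝ} (ht : t ∈ Ioo 0 T) (x : Space) : DifferentiableAt ℝ g (t, x) :=
  (hg.contDiffAt (spacetime_mem_nhds ht x)).differentiableAt one_ne_zero

lemma coneWeight_eq_zero (hc : 0 ≤ c) {t : ℝ} (ht : 0 ≤ t) {x : Space}
    (hx : x ∉ Metric.closedBall z N) : coneWeight c N z (t, x) = 0 := by
  unfold coneWeight
  rw [max_eq_right (coneHeight_nonpos_of_notMem hc ht hx)]
  norm_num

/-- The integral of the divergence of a compactly supported field vanishes. -/
lemma integral_divergence_eq_zero (hc : 0 ≤ c) {g : ℝ × Space → ℝ}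
    (hg : ContDiffOn ℝ 1 g (Ico 0 T ×ˢ univ)) {t : ℝ} (ht : t ∈ Ioo 0 T) (j : Fin 3) :
    Integrable (fun x => coneWeight c N z (t, x) * fderiv ℝ g (t, x) (spaceDir j)
      + fderiv ℝ (coneWeight c N z) (t, x) (spaceDir j) * g (t, x)) ∧
    ∫ x, (coneWeight c N z (t, x) * fderiv ℝ g (t, x) (spaceDir j)
      + fderiv ℝ (coneWeight c N z) (t, x) (spaceDir j) * g (t, x)) = 0 := by
  have hφ : Continuous fun x => coneWeight c N z (t, x) :=
    contDiff_coneWeight.continuous.comp (by fun_prop)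
  have hφ' : Continuous fun x => fderiv ℝ (coneWeight c N z) (t, x) (spaceDir j) :=
    ((contDiff_coneWeight.continuous_fderiv one_ne_zero).clm_apply continuous_const).comp
      (by fun_prop : Continuous fun x : Space => (t, x))
  have hg' := continuous_slice (continuousOn_fderiv_apply hg (spaceDir j)) ht
  have hg0 := continuous_slice hg.continuousOn (Ioo_subset_Ico_self ht)
  have z0 : ∀ x, x ∉ Metric.closedBall z N → coneWeight c N z (t, x) = 0 :=
    fun x hx => coneWeight_eq_zero hc ht.1.le hx
  have z1 : ∀ x, x ∉ Metric.closedBall z N →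
      fderiv ℝ (coneWeight c N z) (t, x) (spaceDir j) = 0 := fun x hx => by
    have := abs_fderiv_coneWeight_space (c := c) (N := N) (z := z) (t, x) j
    rw [max_eq_right (coneHeight_nonpos_of_notMem hc ht.1.le hx), mul_zero] at this
    exact abs_nonpos_iff.1 this
  have i1 := integrable_of_zero_outside (hφ.fun_mul hg') (z := z) (N := N) fun x hx => by
    rw [z0 x hx, zero_mul]
  have i2 := integrable_of_zero_outside (hφ'.fun_mul hg0) (z := z) (N := N) fun x hx => by
    rw [z1 x hx, zero_mul]
  have i3 := integrable_of_zero_outside (hφ.fun_mul hg0) (z := z) (N := N) fun x hx => by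
    rw [z0 x hx, zero_mul]
  refine ⟨i1.add i2, ?_⟩
  rw [integral_add i1 i2]
  have e1 : ∀ x, fderiv ℝ (fun y => g (t, y)) x (EuclideanSpace.single j 1)
      = fderiv ℝ g (t, x) (spaceDir j) := fun x =>
    partialDeriv_eq (differentiableAt_spacetime hg ht x) j
  have hdφ : ∀ x, DifferentiableAt ℝ (coneWeight c N z) (t, x) := fun x =>
    contDiff_coneWeight.differentiable one_ne_zero _
  have e2 : ∀ x, fderiv ℝ (fun y => coneWeight c N z (t, y)) x (EuclideanSpace.single j 1)
      = fderiv ℝ (coneWeight c N z) (t, x) (spaceDir j) := fun x => partialDeriv_eq (hdφ x) j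
  have key := integral_mul_fderiv_eq_neg_fderiv_mul_of_integrable (μ := (volume : Measure Space))
    (f := fun x => coneWeight c N z (t, x)) (g := fun x => g (t, x))
    (v := EuclideanSpace.single j 1) (by simpa only [e2] using i2) (by simpa only [e1] using i1) i3
    (fun x _ => (hdφ x).comp x (by fun_prop))
    (fun x _ => (differentiableAt_spacetime hg ht x).comp x (by fun_prop))
  simp only [e1, e2] at key
  rw [key]; ring

/-- Differentiation of the weighted integral in time. -/
lemma hasDerivAt_weighted_integral (hc : 0 ≤ c) (hη : ContDiffOn ℝ 1 η (Ico 0 T ×ˢ univ))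
    {t : ℝ} (ht : t ∈ Ioo 0 T) :
    Integrable (fun x => coneWeight c N z (t, x) * fderiv ℝ η (t, x) (1, 0)
        + fderiv ℝ (coneWeight c N z) (t, x) (1, 0) * η (t, x)) ∧
    HasDerivAt (fun s => ∫ x, coneWeight c N z (s, x) * η (s, x))
      (∫ x, (coneWeight c N z (t, x) * fderiv ℝ η (t, x) (1, 0)
        + fderiv ℝ (coneWeight c N z) (t, x) (1, 0) * η (t, x))) t := by
  set F' : ℝ × Space → ℝ := fun q => coneWeight c N z q * fderiv ℝ η q (1, 0)
    + fderiv ℝ (coneWeight c N z) q (1, 0) * η q with hF'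
  have hcont : ContinuousOn F' (Ioo 0 T ×ˢ univ) :=
    (contDiff_coneWeight.continuous.continuousOn.mul (continuousOn_fderiv_apply hη _)).add
      (((contDiff_coneWeight.continuous_fderiv one_ne_zero).clm_apply
        continuous_const).continuousOn.mul
          (hη.continuousOn.mono (prod_mono_left Ioo_subset_Ico_self)))
  have hzero : ∀ s, 0 ≤ s → ∀ x, x ∉ Metric.closedBall z N → F' (s, x) = 0 := fun s hs x hx => by
    simp only [hF', coneWeight_eq_zero hc hs hx, fderiv_coneWeight_time,
      max_eq_right (coneHeight_nonpos_of_notMem hc hs hx)]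
    ring
  have hint : ∀ s ∈ Ico 0 T, Integrable fun x => coneWeight c N z (s, x) * η (s, x) :=
    fun s hs => integrable_of_zero_outside
      ((contDiff_coneWeight.continuous.comp (by fun_prop)).mul
        (continuous_slice hη.continuousOn hs)) (z := z) (N := N)
      fun x hx => by rw [coneWeight_eq_zero hc hs.1 hx, zero_mul]
  obtain ⟨a, b, hab, hsub⟩ : ∃ a b, t ∈ Ioo a b ∧ Icc a b ⊆ Ioo 0 T :=
    ⟨t / 2, (t + T) / 2, ⟨by linarith [ht.1], by linarith [ht.2]⟩, fun s hs =>
      ⟨by linarith [ht.1, hs.1], by linarith [ht.2, hs.2]⟩⟩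
  obtain ⟨B, hB⟩ := ((isCompact_Icc (a := a) (b := b)).prod
    (isCompact_closedBall z N)).exists_bound_of_continuousOn
    (hcont.mono (prod_mono hsub (subset_univ _)))
  refine ⟨integrable_of_zero_outside (continuous_slice hcont ht) (hzero t ht.1.le), ?_⟩
  refine (hasDerivAt_integral_of_dominated_loc_of_deriv_le (s := Icc a b)
    (F := fun s x => coneWeight c N z (s, x) * η (s, x)) (F' := fun s x => F' (s, x))
    (bound := (Metric.closedBall z N).indicator fun _ => B) (Icc_mem_nhds hab.1 hab.2) ?_
    (hint t (Ioo_subset_Ico_self ht))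
    (continuous_slice hcont ht).aestronglyMeasurable ?_ ?_ ?_).2
  · filter_upwards [Ioo_mem_nhds ht.1 ht.2] with s hs
    exact (hint s (Ioo_subset_Ico_self hs)).aestronglyMeasurable
  · refine Filter.Eventually.of_forall fun x s hs => ?_
    by_cases hx : x ∈ Metric.closedBall z N
    · rw [indicator_of_mem hx]; exact hB (s, x) ⟨hs, hx⟩
    · rw [indicator_of_notMem hx, hzero s (hsub hs).1.le x hx, norm_zero]
  · exact (integrable_indicator_iff Metric.isClosed_closedBall.measurableSet).2
      (integrableOn_const (measure_closedBall_lt_top.ne))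
  · refine Filter.Eventually.of_forall fun x s hs => ?_
    have hs' := hsub hs
    have h1 := (contDiff_coneWeight (c := c) (N := N) (z := z)).differentiable one_ne_zero (s, x)
    have h2 := differentiableAt_spacetime hη hs' x
    have e : F' (s, x) = fderiv ℝ (fun q => coneWeight c N z q * η q) (s, x) (1, 0) := by
      rw [fderiv_mul_apply h1 h2]
    rw [e, ← deriv_time_eq (h1.fun_mul h2)]
    have hd : DifferentiableAt ℝ (fun s => coneWeight c N z (s, x) * η (s, x)) s :=
      (h1.fun_mul h2).comp s (f := fun s => (s, x)) (by fun_prop)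
    exact hd.hasDerivAt

/-- A local form of Gronwall's inequality for a density `η` which is propagated at a finite speed:
the hypotheses bear on the points of the backward cone only. The slope of the cone is `3 v`, since
each of the three components of the flux `Q` is bounded by `v η`. -/
theorem weighted_energy_estimate (hη : ContDiffOn ℝ 1 η (Ico 0 T ×ˢ univ))
    (hQ : ∀ j, ContDiffOn ℝ 1 (Q j) (Ico 0 T ×ˢ univ)) {v K b : ℝ} (hv : 0 ≤ v)
    (hb : 0 ≤ b) (hK : 0 ≤ K) (hN : 0 ≤ N) {Ω : Set Space} (hΩ : MeasurableSet Ω)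
    (hΩ' : volume Ω ≠ ⊤) {t₁ : ℝ} (ht₁ : 0 ≤ t₁) (ht₁T : t₁ < T)
    (h0 : ∀ x, 0 < coneWeight (3 * v) N z (0, x) → η (0, x) = 0)
    (hspeed : ∀ t ∈ Ioo 0 t₁, ∀ x, 0 < coneWeight (3 * v) N z (t, x) →
      ∀ j, |Q j (t, x)| ≤ v * η (t, x))
    (hgrowth : ∀ t ∈ Ioo 0 t₁, ∀ x, 0 < coneWeight (3 * v) N z (t, x) →
      fderiv ℝ η (t, x) (1, 0) + ∑ j, fderiv ℝ (Q j) (t, x) (spaceDir j)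
        ≤ K * η (t, x) + Ω.indicator (fun _ => b) x) :
    ∫ x, coneWeight (3 * v) N z (t₁, x) * η (t₁, x)
      ≤ N ^ 2 * b * (volume Ω).toReal * t₁ * Real.exp (K * t₁) := by
  have hc : 0 ≤ 3 * v := by positivity
  set φ := coneWeight (3 * v) N z with hφ
  set E : ℝ → ℝ := fun s => ∫ x, φ (s, x) * η (s, x) with hE
  set β : ℝ := N ^ 2 * b * (volume Ω).toReal with hβ
  have hβ0 : 0 ≤ β := by positivity
  have hsub : Icc 0 t₁ ⊆ Ico 0 T := fun s hs => ⟨hs.1, hs.2.trans_lt ht₁T⟩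
  have hEc : ContinuousOn E (Icc 0 t₁) := by
    refine continuousOn_integral_of_compact_support (isCompact_closedBall z N) ?_ ?_
    · exact contDiff_coneWeight.continuous.continuousOn.mul
        (hη.continuousOn.mono (prod_mono_left hsub))
    · intro s x hs hx
      rw [hφ, coneWeight_eq_zero hc hs.1 hx, zero_mul]
  have hint : ∀ s ∈ Ico 0 T, Integrable fun x => φ (s, x) * η (s, x) :=
    fun s hs => integrable_of_zero_outside
      ((contDiff_coneWeight.continuous.comp (by fun_prop)).mul
        (continuous_slice hη.continuousOn hs)) (z := z) (N := N)
      fun x hx => by rw [hφ, coneWeight_eq_zero hc hs.1 hx, zero_mul]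
  have hE' : ∀ t ∈ Ioo 0 t₁, ∃ E', HasDerivAt E E' t ∧ E' ≤ K * E t + β := fun t ht => by
    have htT : t ∈ Ioo 0 T := ⟨ht.1, ht.2.trans ht₁T⟩
    obtain ⟨iη, dη⟩ := hasDerivAt_weighted_integral (N := N) (z := z) hc hη htT
    refine ⟨_, dη, ?_⟩
    have hdiv := fun j => integral_divergence_eq_zero (N := N) (z := z) hc (hQ j) htT j
    have hsum : ∫ x, ∑ j, (φ (t, x) * fderiv ℝ (Q j) (t, x) (spaceDir j)
        + fderiv ℝ φ (t, x) (spaceDir j) * Q j (t, x)) = 0 := by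
      rw [integral_finsetSum _ fun j _ => (hdiv j).1]
      exact Finset.sum_eq_zero fun j _ => (hdiv j).2
    have isum : Integrable fun x => ∑ j, (φ (t, x) * fderiv ℝ (Q j) (t, x) (spaceDir j)
        + fderiv ℝ φ (t, x) (spaceDir j) * Q j (t, x)) :=
      integrable_finsetSum _ fun j _ => (hdiv j).1
    have iK := (hint t (Ioo_subset_Ico_self htT)).const_mul K
    have hle : ∀ x, φ (t, x) ≤ N ^ 2 := fun x => by
      have h1 : max (coneHeight (3 * v) N z (t, x)) 0 ≤ N := by
        refine max_le ?_ hN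
        have := smoothNorm_pos (x - z)
        have := mul_nonneg hc ht.1.le
        unfold coneHeight; simp only; linarith
      exact pow_le_pow_left₀ (le_max_right _ _) h1 2
    have iΩ : Integrable (Ω.indicator fun _ => N ^ 2 * b) :=
      (integrable_indicator_iff hΩ).2 (integrableOn_const hΩ')
    calc _ = (∫ x, (φ (t, x) * fderiv ℝ η (t, x) (1, 0) + fderiv ℝ φ (t, x) (1, 0) * η (t, x)))
          + ∫ x, ∑ j, (φ (t, x) * fderiv ℝ (Q j) (t, x) (spaceDir j)
            + fderiv ℝ φ (t, x) (spaceDir j) * Q j (t, x)) := by rw [hsum, add_zero]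
      _ = ∫ x, ((φ (t, x) * fderiv ℝ η (t, x) (1, 0) + fderiv ℝ φ (t, x) (1, 0) * η (t, x))
          + ∑ j, (φ (t, x) * fderiv ℝ (Q j) (t, x) (spaceDir j)
            + fderiv ℝ φ (t, x) (spaceDir j) * Q j (t, x))) := (integral_add iη isum).symm
      _ ≤ ∫ x, (K * (φ (t, x) * η (t, x)) + Ω.indicator (fun _ => N ^ 2 * b) x) := by
        refine integral_mono (iη.add isum) (iK.add iΩ) fun x => ?_
        have hind : 0 ≤ Ω.indicator (fun _ => N ^ 2 * b) x :=
          indicator_nonneg (fun _ _ => by positivity) x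
        set M := max (coneHeight (3 * v) N z (t, x)) 0 with hM
        have hM0 : 0 ≤ M := le_max_right _ _
        have ht' : fderiv ℝ φ (t, x) (1, 0) = -(2 * M * (3 * v)) := fderiv_coneWeight_time _
        have hx' : ∀ j, |fderiv ℝ φ (t, x) (spaceDir j)| ≤ 2 * M :=
          abs_fderiv_coneWeight_space (t, x)
        rcases (coneWeight_nonneg (c := 3 * v) (N := N) (z := z) (t, x)).eq_or_lt with hz | hz
        · -- where the weight vanishes, so does its differential
          have hM1 : M = 0 := by
            have : M ^ 2 = 0 := hz.symm
            exact pow_eq_zero_iff two_ne_zero |>.1 this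
          have hz' : φ (t, x) = 0 := hz.symm
          have hd0 : ∀ j, fderiv ℝ φ (t, x) (spaceDir j) = 0 := fun j => by
            have := hx' j
            rw [hM1, mul_zero] at this
            exact abs_nonpos_iff.1 this
          simp only [hz', ht', hM1, hd0]
          simpa using hind
        · have hgr := mul_le_mul_of_nonneg_left (hgrowth t ht x hz) hz.le
          have hflux : ∀ j, fderiv ℝ φ (t, x) (spaceDir j) * Q j (t, x)
              ≤ 2 * M * (v * η (t, x)) := fun j => by
            refine (le_abs_self _).trans ?_
            rw [abs_mul]
            exact mul_le_mul (hx' j) (hspeed t ht x hz j) (abs_nonneg _) (by positivity)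
          have hsumflux : ∑ j, fderiv ℝ φ (t, x) (spaceDir j) * Q j (t, x)
              ≤ 3 * (2 * M * (v * η (t, x))) := by
            refine (Finset.sum_le_sum fun j _ => hflux j).trans ?_
            simp
          have hΩle : φ (t, x) * Ω.indicator (fun _ => b) x
              ≤ Ω.indicator (fun _ => N ^ 2 * b) x := by
            by_cases hxΩ : x ∈ Ω
            · rw [indicator_of_mem hxΩ, indicator_of_mem hxΩ]
              exact mul_le_mul_of_nonneg_right (hle x) hb
            · rw [indicator_of_notMem hxΩ, indicator_of_notMem hxΩ, mul_zero]
          simp only [Finset.sum_add_distrib, ← Finset.mul_sum]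
          rw [ht']
          have e1 : φ (t, x) * (fderiv ℝ η (t, x) (1, 0)
              + ∑ j, fderiv ℝ (Q j) (t, x) (spaceDir j))
              = φ (t, x) * fderiv ℝ η (t, x) (1, 0)
              + φ (t, x) * ∑ j, fderiv ℝ (Q j) (t, x) (spaceDir j) := mul_add _ _ _
          have e2 : φ (t, x) * (K * η (t, x) + Ω.indicator (fun _ => b) x)
              = K * (φ (t, x) * η (t, x)) + φ (t, x) * Ω.indicator (fun _ => b) x := by ring
          have e3 : -(2 * M * (3 * v)) * η (t, x) = -(3 * (2 * M * (v * η (t, x)))) := by ring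
          rw [hφ] at e1 e2
          rw [e1, e2] at hgr
          linarith
      _ = K * E t + β := by
        rw [integral_add iK iΩ, integral_const_mul, integral_indicator hΩ, setIntegral_const]
        simp only [smul_eq_mul, hβ, Measure.real]
        ring
  -- the function `exp (-K s) E s - β s` decreases
  set F : ℝ → ℝ := fun s => Real.exp (-(K * s)) * E s - β * s with hF
  have hexp : ∀ s, HasDerivAt (fun s => Real.exp (-(K * s))) (Real.exp (-(K * s)) * -(K * 1)) s :=
    fun s => (((hasDerivAt_id s).const_mul K).neg).exp
  have hanti : AntitoneOn F (Icc 0 t₁) := by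
    refine antitoneOn_of_deriv_nonpos (convex_Icc _ _) ?_ ?_ ?_
    · exact ((by fun_prop : Continuous fun s => Real.exp (-(K * s))).continuousOn.mul hEc).sub
        (by fun_prop)
    · intro s hs
      rw [interior_Icc] at hs
      obtain ⟨E', hd, -⟩ := hE' s hs
      exact (((hexp s).mul hd).sub
        ((hasDerivAt_id s).const_mul β)).differentiableAt.differentiableWithinAt
    · intro s hs
      rw [interior_Icc] at hs
      obtain ⟨E', hd, hle⟩ := hE' s hs
      have h1 : HasDerivAt F (Real.exp (-(K * s)) * -(K * 1) * E s + Real.exp (-(K * s)) * E'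
        - β * 1) s := ((hexp s).mul hd).sub ((hasDerivAt_id s).const_mul β)
      rw [h1.deriv]
      have h2 : Real.exp (-(K * s)) ≤ 1 := Real.exp_le_one_iff.2 (by
        have := mul_nonneg hK hs.1.le; linarith)
      have h3 := mul_le_mul_of_nonneg_left hle (Real.exp_pos (-(K * s))).le
      have h4 := mul_le_mul_of_nonneg_right h2 hβ0
      linarith
  have hE0 : E 0 = 0 := by
    refine integral_eq_zero_of_ae (Filter.Eventually.of_forall fun x => ?_)
    rcases (coneWeight_nonneg (c := 3 * v) (N := N) (z := z) (0, x)).eq_or_lt with hz | hz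
    · simp only [hφ, ← hz, zero_mul, Pi.zero_apply]
    · simp only [h0 x hz, mul_zero, Pi.zero_apply]
  have hfin := hanti (left_mem_Icc.2 ht₁) (right_mem_Icc.2 ht₁) ht₁
  simp only [hF, hE0, mul_zero, sub_zero] at hfin
  have h1 : Real.exp (K * t₁) * Real.exp (-(K * t₁)) = 1 := by rw [← Real.exp_add]; simp
  have h2 := mul_le_mul_of_nonneg_left (sub_nonpos.1 hfin) (Real.exp_pos (K * t₁)).le
  rw [← mul_assoc, h1, one_mul] at h2
  calc E t₁ ≤ _ := h2
    _ = _ := by rw [hβ]; ring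

end

end

section

/-! ### Finite speed of propagation -/

/-- The sum of the absolute values of all entries of a state and of its inverses. -/
def PrimState.size (w : PrimState) : ℝ :=
  |w.ρ| + |w.ρ⁻¹| + ∑ i, |w.u i| + ∑ i, ∑ a, |w.F i a| + ∑ a, ∑ i, |w.F⁻¹ a i|
    + ∑ a, ∑ b, |w.A a b| + ∑ a, ∑ b, |w.A⁻¹ a b|

lemma abs_entry_le_sum (B : Mat) (a b : Fin 3) : |B a b| ≤ ∑ a, ∑ b, |B a b| :=
  (Finset.single_le_sum (f := fun b => |B a b|) (fun _ _ => abs_nonneg _)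
    (Finset.mem_univ b)).trans
  (Finset.single_le_sum (f := fun a => ∑ b, |B a b|)
    (fun _ _ => Finset.sum_nonneg fun _ _ => abs_nonneg _) (Finset.mem_univ a))

lemma PrimState.Admissible.stateBound {w : PrimState} (h : w.Admissible) {m : ℝ}
    (hm : w.size ≤ m) : StateBound m w := by
  have h1 := abs_nonneg w.ρ
  have h2 := abs_nonneg w.ρ⁻¹
  have h3 : 0 ≤ ∑ i, |w.u i| := by positivity
  have h4 : 0 ≤ ∑ i, ∑ a, |w.F i a| := by positivity
  have h5 : 0 ≤ ∑ i, ∑ a, |w.F⁻¹ i a| := by positivity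
  have h6 : 0 ≤ ∑ i, ∑ a, |w.A i a| := by positivity
  have h7 : 0 ≤ ∑ i, ∑ a, |w.A⁻¹ i a| := by positivity
  unfold PrimState.size at hm
  refine ⟨h, ?_, ?_, fun i => ?_, fun i a => ?_, fun i a => ?_, fun i a => ?_, fun i a => ?_⟩
  · linarith [le_abs_self w.ρ]
  · linarith [le_abs_self w.ρ⁻¹]
  · have := Finset.single_le_sum (f := fun i => |w.u i|) (fun _ _ => abs_nonneg _)
      (Finset.mem_univ i)
    linarith
  · linarith [abs_entry_le_sum w.F i a]
  · linarith [abs_entry_le_sum w.F⁻¹ i a]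
  · linarith [abs_entry_le_sum w.A i a]
  · linarith [abs_entry_le_sum w.A⁻¹ i a]

variable {G T ξ : ℝ} {e₀ : ℝ → ℝ}

lemma continuousOn_size {w : ℝ → Space → PrimState} (hw : IsSmoothField T w)
    (hadm : ∀ t ∈ Ico 0 T, ∀ x, (w t x).Admissible) :
    ContinuousOn (fun q : ℝ × Space => (w q.1 q.2).size) (Ico 0 T ×ˢ univ) := by
  have hF := contDiffOn_inv_entry (B := fun q : ℝ × Space => (w q.1 q.2).F) hw.F
    fun q hq => (hadm q.1 hq.1 q.2).F_inv
  have hA := contDiffOn_inv_entry (B := fun q : ℝ × Space => (w q.1 q.2).A) hw.A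
    fun q hq => (hadm q.1 hq.1 q.2).A_posDef.det_pos.ne'
  have hρ : ContDiffOn ℝ ∞ (fun q : ℝ × Space => (w q.1 q.2).ρ⁻¹) (Ico 0 T ×ˢ univ) :=
    hw.ρ.inv fun q hq => (hadm q.1 hq.1 q.2).ρ_pos.ne'
  unfold PrimState.size
  exact ((((((hw.ρ.continuousOn.abs.add hρ.continuousOn.abs).add
    (continuousOn_finsetSum _ fun i _ => (hw.u i).continuousOn.abs)).add
    (continuousOn_finsetSum _ fun i _ => continuousOn_finsetSum _ fun a _ =>
      (hw.F i a).continuousOn.abs)).add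
    (continuousOn_finsetSum _ fun i _ => continuousOn_finsetSum _ fun a _ =>
      (hF i a).continuousOn.abs)).add
    (continuousOn_finsetSum _ fun i _ => continuousOn_finsetSum _ fun a _ =>
      (hw.A i a).continuousOn.abs)).add
    (continuousOn_finsetSum _ fun i _ => continuousOn_finsetSum _ fun a _ =>
      (hA i a).continuousOn.abs))

lemma relEnergy_self {ε : ℝ → ℝ} {κ : ℝ} (w : PrimState) : relEnergy G ε κ w w = 0 := by
  simp [relEnergy]

lemma eq_of_distSq_eq_zero {w₁ w₂ : PrimState} (h : distSq w₁ w₂ = 0) : w₁ = w₂ := by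
  have key : ∀ x y : ℝ, (x - y) ^ 2 ≤ distSq w₁ w₂ → x = y := fun x y hxy => by
    rw [h] at hxy
    exact sub_eq_zero.1 (pow_eq_zero_iff two_ne_zero |>.1 (le_antisymm hxy (sq_nonneg _)))
  have hρ := key _ _ (sq_ρ_le w₁ w₂)
  have hu : w₁.u = w₂.u := funext fun i => key _ _ (sq_u_le w₁ w₂ i)
  have hF : w₁.F = w₂.F := by ext i a; exact key _ _ (sq_F_le w₁ w₂ i a)
  have hA : w₁.A = w₂.A := by ext i a; exact key _ _ (sq_A_le w₁ w₂ i a)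
  cases w₁; cases w₂
  simp_all

variable {ξ₁ ξ₂ m L M κ c v K : ℝ} {w₁ w₂ : ℝ → Space → PrimState}

/-- The relative energy of two flows in a backward cone, when the second one is in equilibrium
outside `Ω`. -/
theorem cone_estimate (he : ContDiffOn ℝ ∞ e₀ (Ioi 0))
    (hk : EnergyConstants G e₀ m L M κ c v K) (hv : 0 ≤ v) (hK : 0 ≤ K)
    (h₁ : IsSmoothSolution G e₀ ξ₁ T w₁) (h₂ : IsSmoothSolution G e₀ ξ₂ T w₂)
    {N : ℝ} (hN : 0 ≤ N) {z : Space} {Ω : Set Space} (hΩ : MeasurableSet Ω)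
    (hΩ' : volume Ω ≠ ⊤) {t₁ : ℝ} (ht₁ : 0 ≤ t₁) (ht₁T : t₁ < T)
    (hcfg : ∀ t ∈ Ioo 0 t₁, ∀ x, 0 < coneWeight (3 * v) N z (t, x) →
      configAt ξ₁ ξ₂ w₁ w₂ (t, x) ∈ configs m L M)
    (h0 : ∀ x, 0 < coneWeight (3 * v) N z (0, x) → w₁ 0 x = w₂ 0 x)
    (heq : ∀ t ∈ Ioo 0 t₁, ∀ x, x ∉ Ω → relaxation (w₂ t x) = 0) :
    ∫ x, coneWeight (3 * v) N z (t₁, x)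
        * energyDensity G (volEnergy G e₀) κ w₁ w₂ (t₁, x)
      ≤ N ^ 2 * (K * |ξ₁ - ξ₂| ^ 2) * (volume Ω).toReal * t₁ * Real.exp (K * t₁) := by
  refine weighted_energy_estimate
    (Q := energyFlux G (volEnergy G e₀) κ w₁ w₂)
    ((contDiffOn_energyDensity he h₁ h₂).of_le (by simp))
    (fun j => (contDiffOn_energyFlux he h₁ h₂ j).of_le (by simp)) hv (by positivity) hK hN hΩ hΩ'
    ht₁ ht₁T (fun x hx => ?_) (fun t ht x hx j => ?_) (fun t ht x hx => ?_)
  · simp only [energyDensity, h0 x hx, relEnergy_self, mul_zero]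
  · exact (hk _ (hcfg t ht x hx)).2.1 j
  · have hb := (hk _ (hcfg t ht x hx)).2.2
    rw [energy_balance he h₁ h₂ ⟨ht.1, ht.2.trans ht₁T⟩ x]
    refine hb.trans ?_
    refine add_le_add le_rfl ?_
    have hf : (configAt ξ₁ ξ₂ w₁ w₂ (t, x)).forcing ≤ |ξ₁ - ξ₂| := by
      unfold Config.forcing
      split_ifs
      · exact abs_nonneg _
      · exact le_rfl
    by_cases hx' : x ∈ Ω
    · rw [indicator_of_mem hx']
      exact mul_le_mul_of_nonneg_left
        (pow_le_pow_left₀ (Config.forcing_nonneg _) hf 2) hK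
    · have : (configAt ξ₁ ξ₂ w₁ w₂ (t, x)).forcing = 0 := by
        unfold Config.forcing
        exact if_pos (heq t ht x hx')
      rw [indicator_of_notMem hx', this]
      simp

lemma PrimState.IsEquilibrium.relaxation_eq_zero {w : PrimState} (h : w.IsEquilibrium) :
    relaxation w = 0 := by
  rw [relaxation, ← h.relaxed, sub_self]

/-- A constant equilibrium is a solution, for every relaxation parameter. -/
lemma PrimState.IsEquilibrium.isSmoothSolution {w : PrimState} (h : w.IsEquilibrium) :
    IsSmoothSolution G e₀ ξ T fun _ _ => w where
  smooth := ⟨contDiffOn_const, fun _ => contDiffOn_const, fun _ _ => contDiffOn_const,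
    fun _ _ => contDiffOn_const⟩
  admissible := fun _ _ _ => h.admissible
  balance := fun t _ x k => by
    have h1 : source w = 0 := by
      have hz : w.F⁻¹ * (w.F⁻¹)ᵀ - w.A = 0 := h.relaxation_eq_zero
      unfold source
      rw [hz]
      simp only [mul_zero, zero_mul, add_zero, smul_zero, neg_zero]
      ext k
      rcases k with k | k | k | k <;> rfl
    rw [h1]
    simp [partialDeriv]
  piola := fun _ _ _ _ => by simp [partialDeriv]

lemma tangent_const (w : PrimState) (p e : ℝ × Space) (hL : 0 ≤ L) :
    TangentBound L (tangent (fun _ _ => w) p e) := by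
  constructor <;> intros <;> simpa [tangent] using hL

/-- As long as a flow which agrees initially with a constant equilibrium at the basis of a backward
cone stays bounded there, it agrees with it inside the cone. -/
lemma eq_const_of_size_le (he : ContDiffOn ℝ ∞ e₀ (Ioi 0)) {w : ℝ → Space → PrimState}
    {wbar : PrimState} (hbar : wbar.IsEquilibrium) (hm : wbar.size ≤ m)
    (hk : EnergyConstants G e₀ m 0 |ξ| κ c v K) (hc : 0 < c) (hv : 0 ≤ v) (hK : 0 ≤ K)
    (hw : IsSmoothSolution G e₀ ξ T w) {N : ℝ} (hN : 0 ≤ N) {z : Space} {s : ℝ} (hs : 0 ≤ s)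
    (hsT : s < T) (h0 : ∀ x, 0 < coneHeight (3 * v) N z (0, x) → w 0 x = wbar)
    (hsize : ∀ t ∈ Icc 0 s, ∀ x, 0 < coneHeight (3 * v) N z (t, x) → (w t x).size ≤ m)
    {x : Space} (hx : 0 < coneHeight (3 * v) N z (s, x)) : w s x = wbar := by
  have hcfg : ∀ t ∈ Icc 0 s, ∀ x, 0 < coneWeight (3 * v) N z (t, x) →
      configAt ξ ξ w (fun _ _ => wbar) (t, x) ∈ configs m 0 |ξ| := fun t ht x hx =>
    ⟨(hw.admissible t ⟨ht.1, ht.2.trans_lt hsT⟩ x).stateBound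
      (hsize t ht x (coneWeight_pos_iff.1 hx)), hbar.admissible.stateBound hm,
      fun j => tangent_const _ _ _ le_rfl, le_rfl, le_rfl⟩
  have hest := cone_estimate (Ω := ∅) he hk hv hK hw (hbar.isSmoothSolution (ξ := ξ)) hN (z := z)
    MeasurableSet.empty (by simp) hs hsT (fun t ht => hcfg t (Ioo_subset_Icc_self ht))
    (fun x hx => h0 x (coneWeight_pos_iff.1 hx))
    (fun t _ x _ => hbar.relaxation_eq_zero)
  rw [sub_self, abs_zero] at hest
  norm_num at hest
  set f : Space → ℝ := fun x => coneWeight (3 * v) N z (s, x)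
    * energyDensity G (volEnergy G e₀) κ w (fun _ _ => wbar) (s, x) with hf
  have hlow : ∀ x, 0 < coneWeight (3 * v) N z (s, x) → c * distSq (w s x) wbar
      ≤ energyDensity G (volEnergy G e₀) κ w (fun _ _ => wbar) (s, x) := fun x hx =>
    (hk _ (hcfg s (right_mem_Icc.2 hs) x hx)).1
  have hnonneg : ∀ x, 0 ≤ f x := fun x => by
    rcases (coneWeight_nonneg (c := 3 * v) (N := N) (z := z) (s, x)).eq_or_lt with h | h
    · simp only [hf, ← h, zero_mul, le_refl]
    · exact mul_nonneg h.le ((mul_nonneg hc.le (distSq_nonneg _ _)).trans (hlow x h))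
  have hcont : Continuous f := (contDiff_coneWeight.continuous.comp (by fun_prop)).fun_mul
    (continuous_slice (contDiffOn_energyDensity he hw
      (hbar.isSmoothSolution (ξ := ξ))).continuousOn ⟨hs, hsT⟩)
  have hsupp : HasCompactSupport f := HasCompactSupport.intro (isCompact_closedBall z N)
    fun x hx => by simp only [hf, coneWeight_eq_zero (by positivity : 0 ≤ 3 * v) hs hx, zero_mul]
  have hfx : f x = 0 := by
    by_contra hne
    have := hcont.integral_pos_of_hasCompactSupport_nonneg_nonzero (μ := volume) hsupp hnonneg hne
    exact absurd hest (not_le.2 this)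
  have hφ := coneWeight_pos_iff.2 hx
  have h1 : energyDensity G (volEnergy G e₀) κ w (fun _ _ => wbar) (s, x) = 0 :=
    (mul_eq_zero.1 hfx).resolve_left hφ.ne'
  have h2 := hlow x hφ
  rw [h1] at h2
  refine eq_of_distSq_eq_zero (le_antisymm ?_ (distSq_nonneg _ _))
  by_contra hcon
  exact absurd h2 (not_le.2 (mul_pos hc (not_le.1 hcon)))

/-- A flow which differs initially from a constant equilibrium in a bounded set only does so at
all times of its existence. No bound on the flow is needed: the speed of propagation is that of
the states close to the equilibrium. -/
theorem finite_propagation (hG : 0 < G) (he : ContDiffOn ℝ ∞ e₀ (Ioi 0))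
    (hconv : ConvexOn ℝ (Ioi 0) e₀) {w : ℝ → Space → PrimState}
    (hw : IsSmoothSolution G e₀ ξ T w) {wbar : PrimState} (hbar : wbar.IsEquilibrium) {R : ℝ}
    (hsupp : ∀ x : Space, R < ‖x‖ → w 0 x = wbar) :
    ∃ R', ∀ t ∈ Ico 0 T, ∀ x : Space, R' < ‖x‖ → w t x = wbar := by
  set m : ℝ := wbar.size + 1 with hm
  have hm0 : 0 < m := (hbar.admissible.stateBound (m := m) (by linarith)).m_pos
  obtain ⟨κ, c, v, K, hc, hv, hK, hk⟩ := exists_energy_constants hG he hconv m 0 |ξ| hm0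
  set N : ℝ := 3 * v * |T| + 2 with hN
  have hN0 : 0 ≤ N := by positivity
  refine ⟨R + N, fun t₁ ht₁ x₀ hx₀ => ?_⟩
  have hbase : ∀ x, 0 ≤ coneHeight (3 * v) N x₀ (0, x) → w 0 x = wbar := fun x hx => by
    refine hsupp x ?_
    have h1 : ‖x - x₀‖ ≤ N := by
      have := norm_le_smoothNorm (x - x₀)
      unfold coneHeight at hx
      simp only [mul_zero, sub_zero] at hx
      linarith
    have h2 : ‖x₀‖ ≤ ‖x‖ + ‖x - x₀‖ := by
      have := norm_sub_le x (x - x₀)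
      simpa using this
    linarith
  have hv3 : 0 < 3 * v := by positivity
  have hsizec := continuousOn_size hw.smooth hw.admissible
  set cone : Set (ℝ × Space) := {q | q.1 ∈ Icc 0 t₁ ∧ 0 ≤ coneHeight (3 * v) N x₀ q} with hcone
  have hcone_closed : IsClosed cone :=
    (isClosed_Icc.preimage continuous_fst).inter
      (isClosed_Ici.preimage contDiff_coneHeight.continuous)
  have hcone_sub : cone ⊆ Icc 0 t₁ ×ˢ Metric.closedBall x₀ N := fun q hq => by
    refine ⟨hq.1, ?_⟩
    have h1 := hq.2
    have h2 := norm_le_smoothNorm (q.2 - x₀)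
    have h3 := mul_nonneg hv3.le hq.1.1
    unfold coneHeight at h1
    rw [Metric.mem_closedBall, dist_eq_norm]
    linarith
  have hcone_dom : cone ⊆ Ico 0 T ×ˢ univ := fun q hq =>
    ⟨⟨hq.1.1, hq.1.2.trans_lt ht₁.2⟩, mem_univ _⟩
  -- the first point of the cone where the state has left the ball of size `m`
  have hgood : ∀ q ∈ cone, (w q.1 q.2).size ≤ m := by
    by_contra hbad
    push Not at hbad
    obtain ⟨q₀, hq₀, hq₀m⟩ := hbad
    set bad : Set (ℝ × Space) := cone ∩ (fun q => (w q.1 q.2).size) ⁻¹' Ici m with hbaddef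
    have hbad_compact : IsCompact bad :=
      ((isCompact_Icc.prod (isCompact_closedBall x₀ N)).of_isClosed_subset hcone_closed
        hcone_sub).of_isClosed_subset
        ((hsizec.mono hcone_dom).preimage_isClosed_of_isClosed hcone_closed isClosed_Ici)
        inter_subset_left
    obtain ⟨⟨t, x⟩, htx, hmin⟩ := hbad_compact.exists_isMinOn ⟨q₀, hq₀, hq₀m.le⟩
      continuous_fst.continuousOn
    have hsz : m ≤ (w t x).size := htx.2
    have htc : (t, x) ∈ cone := htx.1
    have ht0 : 0 < t := by
      refine lt_of_le_of_ne htc.1.1 fun h => ?_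
      have : w t x = wbar := by
        have h2 := htc.2
        rw [← h] at h2 ⊢
        exact hbase x h2
      rw [this] at hsz
      linarith
    have htT : t < T := htc.1.2.trans_lt ht₁.2
    -- before this point, the state is the equilibrium, whose size is less than `m`
    have hbefore : ∀ s ∈ Ico 0 t, w s x = wbar := fun s hs => by
      refine eq_const_of_size_le he hbar (by linarith) hk hc hv.le hK.le hw hN0 hs.1
        (hs.2.trans htT) (fun y hy => hbase y hy.le) (fun r hr y hy => ?_) (z := x₀) ?_
      · by_contra hcon
        have hmem : ((r, y) : ℝ × Space) ∈ bad :=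
          ⟨⟨⟨hr.1, (hr.2.trans hs.2.le).trans htc.1.2⟩, hy.le⟩, (not_le.1 hcon).le⟩
        have : t ≤ r := hmin hmem
        linarith [hr.2, hs.2]
      · have h1 := htc.2
        have h2 := mul_lt_mul_of_pos_left hs.2 hv3
        unfold coneHeight at h1 ⊢
        simp only at h1 ⊢
        linarith
    have hlim : Filter.Tendsto (fun s => (w s x).size) (nhdsWithin t (Ico 0 t))
        (nhds (w t x).size) := by
      have h1 : ContinuousOn (fun s => (w s x).size) (Ico 0 T) :=
        hsizec.comp (f := fun s : ℝ => (s, x)) (by fun_prop) fun s hs => ⟨hs, mem_univ _⟩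
      exact (h1 t ⟨ht0.le, htT⟩).mono (Ico_subset_Ico_right htT.le)
    have hlim' : Filter.Tendsto (fun s => (w s x).size) (nhdsWithin t (Ico 0 t))
        (nhds wbar.size) := by
      refine tendsto_const_nhds.congr' ?_
      filter_upwards [self_mem_nhdsWithin] with s hs
      rw [hbefore s hs]
    have hne : (nhdsWithin t (Ico 0 t)).NeBot := right_nhdsWithin_Ico_neBot ht0
    have := tendsto_nhds_unique hlim hlim'
    linarith
  refine eq_const_of_size_le he hbar (by linarith) hk hc hv.le hK.le hw hN0 ht₁.1 ht₁.2
    (fun y hy => hbase y hy.le) (fun r hr y hy => hgood (r, y) ⟨hr, hy.le⟩) (z := x₀) ?_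
  have h1 : smoothNorm (x₀ - x₀) = 1 := by simp [smoothNorm]
  have h2 : 3 * v * t₁ ≤ 3 * v * |T| :=
    mul_le_mul_of_nonneg_left (ht₁.2.le.trans (le_abs_self T)) hv3.le
  unfold coneHeight
  simp only [h1]
  linarith

end

section

/-! ### Bounds on the two flows -/

/-- The entries of a symmetric matrix are bounded through the diagonal of its square. -/
lemma sum_abs_le_of_sq_le {A B : Mat} (hA : ∀ a b, A a b = A b a) (h : A * A = B) :
    ∑ a, ∑ b, |A a b| ≤ ∑ a : Fin 3, ∑ _b : Fin 3, (1 + |B a a|) := by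
  refine Finset.sum_le_sum fun a _ => Finset.sum_le_sum fun b _ => ?_
  have h1 : A a b ^ 2 ≤ B a a := by
    rw [← h, Matrix.mul_apply]
    have := Finset.single_le_sum (f := fun b => A a b ^ 2) (fun _ _ => sq_nonneg _)
      (Finset.mem_univ b)
    refine this.trans (le_of_eq (Finset.sum_congr rfl fun k _ => ?_))
    rw [hA k a, sq]
  have h2 : |A a b| ≤ 1 + A a b ^ 2 := by
    rw [← sq_abs (A a b)]; nlinarith [sq_nonneg (|A a b| - 1), abs_nonneg (A a b)]
  linarith [le_abs_self (B a a)]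

/-- Label of the component `ρ A⁻²_{ab}` of the conserved variable, by symmetry also for
`b < a`. -/
def metricIdx (a b : Fin 3) : CIdx :=
  Sum.inr (Sum.inr (Sum.inr ⟨(min a b, max a b), min_le_max⟩))

lemma conserved_metricIdx {w : PrimState} (hw : w.Admissible) (a b : Fin 3) :
    conserved w (metricIdx a b) = w.ρ * (w.A⁻¹ * w.A⁻¹) a b := by
  change (w.ρ • (w.A⁻¹ * w.A⁻¹)) (min a b) (max a b) = _
  rw [Matrix.smul_apply, smul_eq_mul]
  rcases le_total a b with h | h
  · rw [min_eq_left h, max_eq_right h]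
  · rw [min_eq_right h, max_eq_left h, hw.inv_A_sq_symm]

lemma PrimState.Admissible.inv_inv_A_sq {w : PrimState} (hw : w.Admissible) :
    (w.A⁻¹ * w.A⁻¹)⁻¹ = w.A * w.A := by
  rw [Matrix.mul_inv_rev, Matrix.nonsing_inv_nonsing_inv _ hw.isUnit_det_A]

/-- The states whose conserved variable belongs to a compact subset of the hyperbolicity domain
are uniformly bounded. -/
lemma exists_size_le {D : Set ConsSpace} (hD : IsCompact D) (hDO : D ⊆ hyperbolicDomain) :
    ∃ m, ∀ w : PrimState, w.Admissible → conserved w ∈ D → w.size ≤ m := by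
  -- the state as a function of `U`, except for `A`, of which only `B = A⁻²` is rational in `U`
  set r : ConsSpace → ℝ := fun U => U (Sum.inl ()) with hr
  set u : Fin 3 → ConsSpace → ℝ := fun i U => (r U)⁻¹ * U (Sum.inr (Sum.inl i)) with hu
  set F : ConsSpace → Mat := fun U => Matrix.of fun i a =>
    (r U)⁻¹ * U (Sum.inr (Sum.inr (Sum.inl (i, a)))) with hF
  set B : ConsSpace → Mat := fun U => Matrix.of fun a b => (r U)⁻¹ * U (metricIdx a b) with hB
  have val : ∀ w : PrimState, w.Admissible → r (conserved w) = w.ρ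
      ∧ (∀ i, u i (conserved w) = w.u i) ∧ F (conserved w) = w.F
      ∧ B (conserved w) = w.A⁻¹ * w.A⁻¹ := fun w hw => by
    have h0 : r (conserved w) = w.ρ := rfl
    have hne := hw.ρ_pos.ne'
    refine ⟨h0, fun i => ?_, ?_, ?_⟩
    · change (r (conserved w))⁻¹ * (w.ρ * w.u i) = w.u i
      rw [h0]; field_simp
    · ext i a
      change (r (conserved w))⁻¹ * (w.ρ * w.F i a) = w.F i a
      rw [h0]; field_simp
    · ext a b
      change (r (conserved w))⁻¹ * conserved w (metricIdx a b) = _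
      rw [h0, conserved_metricIdx hw]; field_simp
  have cr : ContDiffOn ℝ ∞ r D := by fun_prop
  have r0 : ∀ U ∈ D, r U ≠ 0 := fun U hU => by
    obtain ⟨w, hw, rfl⟩ := hDO hU
    rw [(val w hw).1]; exact hw.ρ_pos.ne'
  have cr' : ContDiffOn ℝ ∞ (fun U => (r U)⁻¹) D := cr.inv r0
  have cu : ∀ i, ContDiffOn ℝ ∞ (u i) D := fun i => cr'.mul (by fun_prop)
  have cF : ∀ i a, ContDiffOn ℝ ∞ (fun U => F U i a) D := fun i a => by
    simp only [hF, Matrix.of_apply]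
    exact cr'.mul (by fun_prop)
  have cB : ∀ i a, ContDiffOn ℝ ∞ (fun U => B U i a) D := fun i a => by
    simp only [hB, Matrix.of_apply]
    exact cr'.mul (by fun_prop)
  have cF' := contDiffOn_inv_entry cF fun U hU => by
    obtain ⟨w, hw, rfl⟩ := hDO hU
    rw [(val w hw).2.2.1]; exact hw.F_inv
  have cB' := contDiffOn_inv_entry cB fun U hU => by
    obtain ⟨w, hw, rfl⟩ := hDO hU
    rw [(val w hw).2.2.2, Matrix.det_mul]
    have := (Matrix.isUnit_nonsing_inv_det _ hw.isUnit_det_A).ne_zero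
    exact mul_ne_zero this this
  have cont : ContinuousOn (fun U => |r U| + |(r U)⁻¹| + ∑ i, |u i U| + ∑ i, ∑ a, |F U i a|
      + ∑ a, ∑ i, |(F U)⁻¹ a i| + ∑ a : Fin 3, ∑ _b : Fin 3, (1 + |(B U)⁻¹ a a|)
      + ∑ a : Fin 3, ∑ _b : Fin 3, (1 + |B U a a|)) D :=
    ((((((cr.continuousOn.abs.add cr'.continuousOn.abs).add
    (continuousOn_finsetSum _ fun i _ => (cu i).continuousOn.abs)).add
    (continuousOn_finsetSum _ fun i _ => continuousOn_finsetSum _ fun a _ =>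
      (cF i a).continuousOn.abs)).add
    (continuousOn_finsetSum _ fun i _ => continuousOn_finsetSum _ fun a _ =>
      (cF' i a).continuousOn.abs)).add
    (continuousOn_finsetSum _ fun a _ => continuousOn_finsetSum _ fun _ _ =>
      continuousOn_const.add (cB' a a).continuousOn.abs)).add
    (continuousOn_finsetSum _ fun a _ => continuousOn_finsetSum _ fun _ _ =>
      continuousOn_const.add (cB a a).continuousOn.abs))
  obtain ⟨m, hm⟩ := hD.exists_bound_of_continuousOn cont
  refine ⟨m, fun w hw hwD => ?_⟩
  have h1 := (le_abs_self _).trans (hm _ hwD)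
  obtain ⟨v1, v2, v3, v4⟩ := val w hw
  simp only [v1, v2, v3, v4, hw.inv_inv_A_sq] at h1
  have h2 := sum_abs_le_of_sq_le hw.A_symm rfl
  have h3 := sum_abs_le_of_sq_le (A := w.A⁻¹) (fun a b => by
    have := congrFun (congrFun hw.inv_A_transpose b) a
    simpa using this) rfl
  unfold PrimState.size
  linarith

lemma isBigO_conserved {m L M : ℝ} (k : CIdx) :
    (fun x : Config => conserved x.w₁ k - conserved x.w₂ k)
      =O[Filter.principal (configs m L M)] Config.s := by
  rcases k with k | i | ⟨i, a⟩ | ⟨⟨a, b⟩, _⟩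
  · exact isBigO_ρ
  · exact isBigO_mul_sub_mul bdd_ρ₁ (isBigO_one_of_abs_le fun _ h => h.2.1.u_le i) isBigO_ρ
      (isBigO_u i)
  · exact isBigO_mul_sub_mul bdd_ρ₁ (bdd_F₂ i a) isBigO_ρ (isBigO_F i a)
  · have h : (fun x : Config => x.w₁.ρ * ∑ k, x.w₁.A⁻¹ a k * x.w₁.A⁻¹ k b
        - x.w₂.ρ * ∑ k, x.w₂.A⁻¹ a k * x.w₂.A⁻¹ k b)
        =O[Filter.principal (configs m L M)] Config.s := by
      refine isBigO_mul_sub_mul bdd_ρ₁ (isBigO_sum fun k => isBigO_mul_bdd (bdd_inv_A₂ a k)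
        (bdd_inv_A₂ k b)) isBigO_ρ ?_
      simp only [← Finset.sum_sub_distrib]
      exact isBigO_sum fun k => isBigO_mul_sub_mul (bdd_inv_A₁ a k) (bdd_inv_A₂ k b)
        (isBigO_inv_A a k) (isBigO_inv_A k b)
    refine h.congr_left fun x => ?_
    rw [← Matrix.mul_apply, ← Matrix.mul_apply]
    rfl

/-- The conserved variable is a Lipschitz function of the variables `(ρ, u, F, A)`, on bounded
sets of states. -/
lemma exists_norm_conserved_le (m L M : ℝ) : ∃ C, 0 ≤ C ∧ ∀ x ∈ configs m L M,
    ‖conserved x.w₁ - conserved x.w₂‖ ^ 2 ≤ C * distSq x.w₁ x.w₂ := by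
  have h : (fun x : Config => ∑ k, (conserved x.w₁ k - conserved x.w₂ k) ^ 2)
      =O[Filter.principal (configs m L M)] fun x => x.s ^ 2 :=
    Asymptotics.IsBigO.fun_sum fun k _ => (isBigO_conserved k).pow 2
  obtain ⟨C, hC⟩ := Asymptotics.isBigO_principal.1 h
  refine ⟨|C|, abs_nonneg C, fun x hx => ?_⟩
  have h1 := (le_abs_self _).trans (hC x hx)
  rw [norm_pow, Real.norm_of_nonneg x.s_nonneg, x.s_sq] at h1
  rw [EuclideanSpace.norm_sq_eq]
  simp only [PiLp.sub_apply, Real.norm_eq_abs, sq_abs]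
  exact h1.trans (mul_le_mul_of_nonneg_right (le_abs_self C) (distSq_nonneg _ _))

variable {G T ξ : ℝ} {e₀ : ℝ → ℝ} {w : ℝ → Space → PrimState}

lemma TangentBound.of_entries {ι : Type*} {g : ι → PrimState} {S : Set ι}
    (hρ : ∃ L, ∀ q ∈ S, |(g q).ρ| ≤ L) (hu : ∀ i, ∃ L, ∀ q ∈ S, |(g q).u i| ≤ L)
    (hF : ∀ i a, ∃ L, ∀ q ∈ S, |(g q).F i a| ≤ L)
    (hA : ∀ a b, ∃ L, ∀ q ∈ S, |(g q).A a b| ≤ L) : ∃ L, ∀ q ∈ S, TangentBound L (g q) := by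
  obtain ⟨Lρ, hρ⟩ := hρ
  choose Lu hu using hu
  choose LF hF using hF
  choose LA hA using hA
  have p1 : 0 ≤ |Lρ| := abs_nonneg _
  have p2 : 0 ≤ ∑ i, |Lu i| := by positivity
  have p3 : 0 ≤ ∑ i, ∑ a, |LF i a| := by positivity
  have p4 : 0 ≤ ∑ i, ∑ a, |LA i a| := by positivity
  refine ⟨|Lρ| + ∑ i, |Lu i| + ∑ i, ∑ a, |LF i a| + ∑ i, ∑ a, |LA i a|, fun q hq =>
    ⟨?_, fun i => ?_, fun i a => ?_, fun i a => ?_⟩⟩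
  · linarith [hρ q hq, le_abs_self Lρ]
  · have := Finset.single_le_sum (f := fun i => |Lu i|) (fun _ _ => abs_nonneg _)
      (Finset.mem_univ i)
    linarith [hu i q hq, le_abs_self (Lu i)]
  · linarith [hF i a q hq, le_abs_self (LF i a), abs_entry_le_sum LF i a]
  · linarith [hA i a q hq, le_abs_self (LA i a), abs_entry_le_sum LA i a]

lemma TangentBound.exists_uniform {ι : Type*} {g : Fin 3 → ι → PrimState} {S : Set ι}
    (h : ∀ j, ∃ L, ∀ q ∈ S, TangentBound L (g j q)) :
    ∃ L, ∀ j, ∀ q ∈ S, TangentBound L (g j q) := by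
  choose L hL using h
  refine ⟨∑ j, |L j|, fun j q hq => ?_⟩
  have hle : L j ≤ ∑ j, |L j| := (le_abs_self _).trans (Finset.single_le_sum
    (f := fun j => |L j|) (fun _ _ => abs_nonneg _) (Finset.mem_univ j))
  have hb := hL j q hq
  exact ⟨hb.ρ_le.trans hle, fun i => (hb.u_le i).trans hle, fun i a => (hb.F_le i a).trans hle,
    fun a b => (hb.A_le a b).trans hle⟩

/-- The gradient of a smooth field which is constant outside a ball is bounded, away from the
final time. -/
lemma exists_fderiv_bound {g : ℝ × Space → ℝ} (hg : ContDiffOn ℝ ∞ g (Ico 0 T ×ˢ univ)) {k R T' : ℝ}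
    (hT' : T' < T) (hout : ∀ t ∈ Ico 0 T, ∀ x : Space, R < ‖x‖ → g (t, x) = k) (j : Fin 3) :
    ∃ L, ∀ q ∈ Ioo 0 T' ×ˢ (univ : Set Space), |fderiv ℝ g q (spaceDir j)| ≤ L := by
  have hcont : ContinuousOn (fun q => fderivWithin ℝ g (Ico 0 T ×ˢ univ) q (spaceDir j))
      (Ico 0 T ×ˢ univ) :=
    (hg.continuousOn_fderivWithin ((uniqueDiffOn_Ico 0 T).prod uniqueDiffOn_univ)
      (by simp)).clm_apply continuousOn_const
  obtain ⟨L, hL⟩ := (isCompact_Icc.prod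
    (isCompact_closedBall (0 : Space) R)).exists_bound_of_continuousOn
    (hcont.mono (prod_mono (Icc_subset_Ico_right hT') (subset_univ _)))
  refine ⟨max L 0, fun ⟨t, x⟩ hq => ?_⟩
  have ht : t ∈ Ioo 0 T := ⟨hq.1.1, hq.1.2.trans hT'⟩
  by_cases hx : x ∈ Metric.closedBall (0 : Space) R
  · have := hL (t, x) ⟨Ioo_subset_Icc_self hq.1, hx⟩
    rw [fderivWithin_of_mem_nhds (spacetime_mem_nhds ht x)] at this
    exact this.trans (le_max_left _ _)
  · have hx' : R < ‖x‖ := by simpa using hx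
    have : g =ᶠ[nhds (t, x)] fun _ => k := by
      have hopen : {y : Space | R < ‖y‖} ∈ nhds x :=
        (isOpen_lt continuous_const continuous_norm).mem_nhds hx'
      filter_upwards [prod_mem_nhds (Ioo_mem_nhds ht.1 ht.2) hopen] with q hq
      exact hout q.1 (Ioo_subset_Ico_self hq.1) q.2 hq.2
    rw [this.fderiv_eq]
    simp

/-- Bounds on a flow and its gradient, strictly before the end of its existence. -/
lemma exists_bounds_of_lt (hw : IsSmoothSolution G e₀ ξ T w) {wbar : PrimState} {R T' : ℝ}
    (hT' : T' < T) (hout : ∀ t ∈ Ico 0 T, ∀ x : Space, R < ‖x‖ → w t x = wbar) :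
    (∃ m, ∀ t ∈ Ico 0 T', ∀ x, (w t x).size ≤ m) ∧
    ∃ L, ∀ j, ∀ q ∈ Ioo 0 T' ×ˢ (univ : Set Space), TangentBound L (tangent w q (spaceDir j)) := by
  constructor
  · obtain ⟨m, hm⟩ := (isCompact_Icc.prod
      (isCompact_closedBall (0 : Space) R)).exists_bound_of_continuousOn
      ((continuousOn_size hw.smooth hw.admissible).mono
        (prod_mono (Icc_subset_Ico_right hT') (subset_univ _)))
    refine ⟨max m wbar.size, fun t ht x => ?_⟩
    by_cases hx : x ∈ Metric.closedBall (0 : Space) R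
    · exact ((le_abs_self _).trans (hm (t, x) ⟨Ico_subset_Icc_self ht, hx⟩)).trans (le_max_left _ _)
    · rw [hout t ⟨ht.1, ht.2.trans hT'⟩ x (by simpa using hx)]
      exact le_max_right _ _
  · have h : ∀ j, ∃ L, ∀ q ∈ Ioo 0 T' ×ˢ (univ : Set Space),
        TangentBound L (tangent w q (spaceDir j)) := fun j =>
      TangentBound.of_entries
        (exists_fderiv_bound (k := wbar.ρ) (R := R) hw.smooth.ρ hT'
          (fun t ht x hx => by simp only [hout t ht x hx]) j)
        (fun i => exists_fderiv_bound (k := wbar.u i) (R := R) (hw.smooth.u i) hT'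
          (fun t ht x hx => by simp only [hout t ht x hx]) j)
        (fun i a => exists_fderiv_bound (k := wbar.F i a) (R := R) (hw.smooth.F i a) hT'
          (fun t ht x hx => by simp only [hout t ht x hx]) j)
        (fun a b => exists_fderiv_bound (k := wbar.A a b) (R := R) (hw.smooth.A a b) hT'
          (fun t ht x hx => by simp only [hout t ht x hx]) j)
    exact TangentBound.exists_uniform h

lemma abs_mul_entry_le {X Y : Mat} {x y : ℝ} (hX : ∀ a b, |X a b| ≤ x) (hY : ∀ a b, |Y a b| ≤ y)
    (a b : Fin 3) : |(X * Y) a b| ≤ 3 * (x * y) := by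
  rw [Matrix.mul_apply]
  refine (Finset.abs_sum_le_sum_abs _ _).trans ?_
  refine (Finset.sum_le_sum (g := fun _ => x * y) fun k _ => ?_).trans (by simp)
  rw [abs_mul]
  exact mul_le_mul (hX a k) (hY k b) (abs_nonneg _) ((abs_nonneg _).trans (hX a k))

/-- From a bound on `X A + A X`, a bound on the symmetric matrix `X`. -/
lemma abs_le_of_sylvester {A X : Mat} (hA : A.PosDef) {m C : ℝ} (hm : 0 < m)
    (hi : ∀ a b, |A⁻¹ a b| ≤ m) (hX : ∀ a b, X a b = X b a)
    (hC : ∀ a b, |(X * A + A * X) a b| ≤ C) (a b : Fin 3) : |X a b| ≤ 9 * m / 2 * C := by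
  have hC0 : 0 ≤ C := (abs_nonneg _).trans (hC 0 0)
  have h1 := sylvester_bound hA hm hi hX
  have h2 : ∑ i, ∑ a, X i a * (X * A + A * X) a i
      ≤ ∑ i, ∑ a, ((3 * m)⁻¹ * X i a ^ 2 + 3 * m / 4 * C ^ 2) := by
    refine Finset.sum_le_sum fun i _ => Finset.sum_le_sum fun a _ => ?_
    have h3 : X i a * (X * A + A * X) a i ≤ |X i a| * C := by
      refine (le_abs_self _).trans ?_
      rw [abs_mul]
      exact mul_le_mul_of_nonneg_left (hC a i) (abs_nonneg _)
    have h4 : 0 ≤ (3 * m)⁻¹ * (|X i a| - 3 * m / 2 * C) ^ 2 := by positivity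
    have h5 : (3 * m)⁻¹ * (|X i a| - 3 * m / 2 * C) ^ 2
        = (3 * m)⁻¹ * |X i a| ^ 2 - |X i a| * C + 3 * m / 4 * C ^ 2 := by field_simp; ring
    rw [sq_abs] at h5
    linarith
  have h3 : ∑ i, ∑ a, ((3 * m)⁻¹ * X i a ^ 2 + 3 * m / 4 * C ^ 2)
      = (3 * m)⁻¹ * (∑ i, ∑ a, X i a ^ 2) + 9 * (3 * m / 4 * C ^ 2) := by
    simp only [Fin.sum_univ_three]; ring
  rw [h3] at h2
  have h4 : (3 * m)⁻¹ * (∑ i, ∑ a, X i a ^ 2) ≤ 9 * (3 * m / 4 * C ^ 2) := by linarith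
  rw [inv_mul_le_iff₀ (by positivity)] at h4
  have h5 := sq_entry_le X 0 a b
  simp only [Matrix.zero_apply, sub_zero] at h5
  refine abs_le_of_sq_le_sq ?_ (by positivity)
  calc X a b ^ 2 ≤ _ := h5.trans h4
    _ = _ := by ring

/-- The derivative of `f` is bounded by those of `r` and `r f`. -/
lemma abs_fderiv_le_of_mul {r f : ℝ × Space → ℝ} {p e : ℝ × Space} (hr : DifferentiableAt ℝ r p)
    (hf : DifferentiableAt ℝ f p) {m x L : ℝ} (hr0 : 0 < r p) (hm : (r p)⁻¹ ≤ m) (hx : |f p| ≤ x)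
    (h1 : |fderiv ℝ r p e| ≤ L) (h2 : |fderiv ℝ (fun q => r q * f q) p e| ≤ L) :
    |fderiv ℝ f p e| ≤ m * (L + L * x) := by
  have hL : 0 ≤ L := (abs_nonneg _).trans h1
  have e1 : fderiv ℝ f p e = (r p)⁻¹ * (fderiv ℝ (fun q => r q * f q) p e
      - fderiv ℝ r p e * f p) := by
    rw [fderiv_mul_apply hr hf]; field_simp; ring
  rw [e1, abs_mul, abs_of_pos (inv_pos.2 hr0)]
  refine mul_le_mul hm ((abs_sub _ _).trans (add_le_add h2 ?_)) (abs_nonneg _)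
    ((inv_pos.2 hr0).le.trans hm)
  rw [abs_mul]
  exact mul_le_mul h1 hx (abs_nonneg _) hL

/-- Bounds on a flow which is regular up to the time `T`, and on its gradient. -/
lemma exists_bounds_of_regular (hw : IsSmoothSolution G e₀ ξ T w) (hreg : RegularUpTo T w) :
    (∃ m, ∀ t ∈ Ico 0 T, ∀ x, (w t x).size ≤ m) ∧
    ∃ L, ∀ j, ∀ q ∈ Ioo 0 T ×ˢ (univ : Set Space), TangentBound L (tangent w q (spaceDir j)) := by
  obtain ⟨D, hD, hDO, hmem, l, hl⟩ := hreg
  obtain ⟨m, hm⟩ := exists_size_le hD hDO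
  have hsize : ∀ t ∈ Ico 0 T, ∀ x, (w t x).size ≤ m := fun t ht x =>
    hm _ (hw.admissible t ht x) (hmem t ht x)
  refine ⟨⟨m, hsize⟩, ?_⟩
  set b : ℝ := m * (l + l * (3 * (m * m))) with hb
  set C : ℝ := 3 * (3 * (3 * (m * m) * b) * (3 * (m * m))) with hC
  have hs := hw.smooth
  -- the derivatives of the conserved variable are bounded by its Lipschitz constant
  have hcons : ∀ (g : ℝ × Space → ℝ) (k : CIdx), ContDiffOn ℝ ∞ g (Ico 0 T ×ˢ univ) →
      (∀ t ∈ Ico 0 T, ∀ x, g (t, x) = conserved (w t x) k) → ∀ t ∈ Ioo 0 T, ∀ x j,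
      |fderiv ℝ g (t, x) (spaceDir j)| ≤ l := fun g k hg hgk t ht x j => by
    have hd : DifferentiableAt ℝ g (t, x) :=
      (hg.contDiffAt (spacetime_mem_nhds ht x)).differentiableAt (by simp)
    rw [← partialDeriv_eq hd j]
    have hlip : LipschitzWith l fun y => g (t, y) := by
      refine LipschitzWith.of_dist_le_mul fun y y' => ?_
      refine le_trans ?_ ((hl t (Ioo_subset_Ico_self ht)).dist_le_mul y y')
      rw [hgk t (Ioo_subset_Ico_self ht), hgk t (Ioo_subset_Ico_self ht), dist_eq_norm,
        dist_eq_norm, ← PiLp.sub_apply]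
      exact PiLp.norm_apply_le _ k
    have h1 := norm_fderiv_le_of_lipschitz ℝ hlip (x₀ := x)
    have h2 := (fderiv ℝ (fun y => g (t, y)) x).le_opNorm (EuclideanSpace.single j 1)
    have h3 : ‖(EuclideanSpace.single j 1 : Space)‖ = 1 := by simp
    rw [h3, mul_one] at h2
    exact h2.trans h1
  have hbase : ∀ j, ∀ q ∈ Ioo 0 T ×ˢ (univ : Set Space),
      |fderiv ℝ (fun q : ℝ × Space => (w q.1 q.2).ρ) q (spaceDir j)| ≤ l := fun j q hq =>
    hcons _ (Sum.inl ()) hs.ρ (fun _ _ _ => rfl) q.1 hq.1 q.2 j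
  have hmul : ∀ (f : ℝ × Space → ℝ) (k : CIdx), ContDiffOn ℝ ∞ f (Ico 0 T ×ˢ univ) →
      (∀ t ∈ Ico 0 T, ∀ x, (w t x).ρ * f (t, x) = conserved (w t x) k) → ∀ y,
      (∀ t ∈ Ico 0 T, ∀ x, |f (t, x)| ≤ y) → ∀ j, ∀ q ∈ Ioo 0 T ×ˢ (univ : Set Space),
      |fderiv ℝ f q (spaceDir j)| ≤ m * (l + l * y) := fun f k hf hfk y hy j q hq => by
    have hq' : q.1 ∈ Ico 0 T := Ioo_subset_Ico_self hq.1
    have hbd := (hw.admissible q.1 hq' q.2).stateBound (hsize q.1 hq' q.2)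
    exact abs_fderiv_le_of_mul
      ((hs.ρ.contDiffAt (spacetime_mem_nhds hq.1 q.2)).differentiableAt (by simp))
      ((hf.contDiffAt (spacetime_mem_nhds hq.1 q.2)).differentiableAt (by simp))
      hbd.ρ_pos hbd.inv_ρ_le (hy q.1 hq' q.2) (hbase j q hq)
      (hcons _ k (hs.ρ.mul hf) hfk q.1 hq.1 q.2 j)
  have hbd := fun t (ht : t ∈ Ico 0 T) x => (hw.admissible t ht x).stateBound (hsize t ht x)
  have hmetric : ∀ j a c, ∀ q ∈ Ioo 0 T ×ˢ (univ : Set Space),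
      |(tangent w q (spaceDir j)).A a c| ≤ 9 * m / 2 * C := fun j a c q hq => by
    have hq' : q.1 ∈ Ico 0 T := Ioo_subset_Ico_self hq.1
    have hB := hbd q.1 hq' q.2
    refine abs_le_of_sylvester hB.admissible.A_posDef hB.m_pos hB.inv_A_le
      (tangent_A_symm hw.admissible hq.1 q.2 _) (fun a' c' => ?_) a c
    rw [fderiv_inv_A_sq hs hw.admissible hq.1 q.2, Matrix.neg_apply, abs_neg]
    have hAA := abs_mul_entry_le hB.A_le hB.A_le
    refine abs_mul_entry_le (abs_mul_entry_le hAA fun a'' c'' => ?_) hAA a' c'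
    exact hmul _ (metricIdx a'' c'') (hs.inv_A_sq hw.admissible a'' c'')
      (fun t ht x => (conserved_metricIdx (hw.admissible t ht x) a'' c'').symm) (3 * (m * m))
      (fun t ht x => abs_mul_entry_le (hbd t ht x).inv_A_le (hbd t ht x).inv_A_le a'' c'') j q hq
  have hfinal : ∀ j, ∃ L, ∀ q ∈ Ioo 0 T ×ˢ (univ : Set Space),
      TangentBound L (tangent w q (spaceDir j)) := fun j =>
    TangentBound.of_entries ⟨l, hbase j⟩
      (fun i => ⟨_, hmul _ (Sum.inr (Sum.inl i)) (hs.u i) (fun _ _ _ => rfl) m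
        (fun t ht x => (hbd t ht x).u_le i) j⟩)
      (fun i a => ⟨_, hmul _ (Sum.inr (Sum.inr (Sum.inl (i, a)))) (hs.F i a) (fun _ _ _ => rfl) m
        (fun t ht x => (hbd t ht x).F_le i a) j⟩)
      (fun a c => ⟨_, hmetric j a c⟩)
  exact TangentBound.exists_uniform hfinal

end

section

/-! ### The estimate in `L²` -/

variable {G T ξ ξ₁ ξ₂ : ℝ} {e₀ : ℝ → ℝ} {w w₁ w₂ : ℝ → Space → PrimState}

lemma IsSmoothSolution.mono (hw : IsSmoothSolution G e₀ ξ T w) {T' : ℝ} (h : T' ≤ T) :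
    IsSmoothSolution G e₀ ξ T' w where
  smooth := by
    have hs : Ico 0 T' ×ˢ (univ : Set Space) ⊆ Ico 0 T ×ˢ univ :=
      prod_mono_left (Ico_subset_Ico_right h)
    exact ⟨hw.smooth.ρ.mono hs, fun i => (hw.smooth.u i).mono hs,
      fun i a => (hw.smooth.F i a).mono hs, fun a b => (hw.smooth.A a b).mono hs⟩
  admissible := fun t ht => hw.admissible t (Ico_subset_Ico_right h ht)
  balance := fun t ht => hw.balance t (Ioo_subset_Ioo_right h ht)
  piola := fun t ht => hw.piola t (Ico_subset_Ico_right h ht)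

/-- The weights of cones of growing size, once normalized, tend to one. -/
lemma tendsto_coneWeight_div (c : ℝ) (q : ℝ × Space) :
    Filter.Tendsto (fun n : ℕ => coneWeight c n 0 q / (n : ℝ) ^ 2) Filter.atTop (nhds 1) := by
  set k : ℝ := c * q.1 + smoothNorm (q.2 - 0) with hk
  have h1 : Filter.Tendsto (fun n : ℕ => (1 - k / (n : ℝ)) ^ 2) Filter.atTop (nhds 1) := by
    have := (tendsto_const_nhds (x := (1 : ℝ))).sub (tendsto_const_div_atTop_nhds_zero_nat k)
    simpa using this.pow 2
  refine h1.congr' ?_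
  obtain ⟨n₀, hn₀⟩ := exists_nat_gt (max k 0)
  filter_upwards [Filter.eventually_ge_atTop n₀] with n hn
  have hn' : max k 0 < n := hn₀.trans_le (by exact_mod_cast hn)
  have hn0 : (0 : ℝ) < n := (le_max_right _ _).trans_lt hn'
  have e : coneHeight c n 0 q = n - k := by unfold coneHeight; rw [hk]; ring
  unfold coneWeight
  rw [e, max_eq_left (by linarith [le_max_left k 0]), ← div_pow]
  congr 1
  field_simp

/-- The bound on the integral of a density over the whole space, from bounds on its integrals
with weights supported in cones. -/
lemma lintegral_le_of_weighted {η : ℝ × Space → ℝ} {c β t : ℝ} (hc : 0 ≤ c) (ht : 0 ≤ t)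
    (hη : Continuous fun x => η (t, x)) (hη0 : ∀ x, 0 ≤ η (t, x))
    (h : ∀ n : ℕ, ∫ x, coneWeight c n 0 (t, x) * η (t, x) ≤ (n : ℝ) ^ 2 * β) :
    ∫⁻ x, ENNReal.ofReal (η (t, x)) ≤ ENNReal.ofReal β := by
  have hφ : ∀ n : ℕ, Continuous fun x => coneWeight c n 0 (t, x) * η (t, x) := fun n =>
    (contDiff_coneWeight.continuous.comp (by fun_prop)).mul hη
  have hcont : ∀ n : ℕ, Continuous fun x => coneWeight c n 0 (t, x) / (n : ℝ) ^ 2 * η (t, x) :=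
    fun n => ((contDiff_coneWeight.continuous.comp (by fun_prop)).div_const _).mul hη
  have hlim : ∀ x, Filter.Tendsto (fun n : ℕ => ENNReal.ofReal
      (coneWeight c n 0 (t, x) / (n : ℝ) ^ 2 * η (t, x))) Filter.atTop
      (nhds (ENNReal.ofReal (η (t, x)))) := fun x => by
    have := (tendsto_coneWeight_div c (t, x)).mul_const (η (t, x))
    rw [one_mul] at this
    exact ENNReal.tendsto_ofReal this
  have hbound : ∀ n : ℕ, 1 ≤ n → ∫⁻ x, ENNReal.ofReal
      (coneWeight c n 0 (t, x) / (n : ℝ) ^ 2 * η (t, x)) ≤ ENNReal.ofReal β := fun n hn => by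
    have hn0 : (0 : ℝ) < (n : ℝ) ^ 2 := by positivity
    have hint : Integrable fun x => coneWeight c n 0 (t, x) * η (t, x) :=
      integrable_of_zero_outside (hφ n) (z := 0) (N := n) fun x hx => by
        rw [coneWeight_eq_zero hc ht hx, zero_mul]
    have e : (fun x => coneWeight c n 0 (t, x) / (n : ℝ) ^ 2 * η (t, x))
        = fun x => ((n : ℝ) ^ 2)⁻¹ * (coneWeight c n 0 (t, x) * η (t, x)) := by
      funext x; ring
    rw [← ofReal_integral_eq_lintegral_ofReal (by rw [e]; exact hint.const_mul _)
      (Filter.Eventually.of_forall fun x =>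
        mul_nonneg (div_nonneg (coneWeight_nonneg _) hn0.le) (hη0 x))]
    refine ENNReal.ofReal_le_ofReal ?_
    rw [e, integral_const_mul, inv_mul_le_iff₀ hn0]
    exact h n
  calc ∫⁻ x, ENNReal.ofReal (η (t, x))
      = ∫⁻ x, Filter.liminf (fun n : ℕ => ENNReal.ofReal
          (coneWeight c n 0 (t, x) / (n : ℝ) ^ 2 * η (t, x))) Filter.atTop :=
        lintegral_congr fun x => (hlim x).liminf_eq.symm
    _ ≤ Filter.liminf (fun n : ℕ => ∫⁻ x, ENNReal.ofReal
          (coneWeight c n 0 (t, x) / (n : ℝ) ^ 2 * η (t, x))) Filter.atTop :=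
        lintegral_liminf_le fun n => (hcont n).measurable.ennreal_ofReal
    _ ≤ ENNReal.ofReal β := by
        refine Filter.liminf_le_of_le (by isBoundedDefault) fun b hb => ?_
        obtain ⟨n, hn⟩ := (hb.and (Filter.eventually_ge_atTop 1)).exists
        exact hn.1.trans (hbound n hn.2)

lemma eLpNorm_two_le_of_sq_le {α E : Type*} [MeasurableSpace α] [NormedAddCommGroup E]
    {μ : Measure α} {f : α → E} {η : α → ℝ} {k β r : ℝ} (hk : 0 ≤ k) (hr : 0 ≤ r)
    (hf : ∀ x, ‖f x‖ ^ 2 ≤ k * η x) (hη : ∫⁻ x, ENNReal.ofReal (η x) ∂μ ≤ ENNReal.ofReal β)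
    (h : k * β = r ^ 2) : eLpNorm f 2 μ ≤ ENNReal.ofReal r := by
  have hsq : ∫⁻ x, ‖f x‖ₑ ^ (2 : ℝ) ∂μ ≤ ENNReal.ofReal r ^ (2 : ℝ) := by
    calc ∫⁻ x, ‖f x‖ₑ ^ (2 : ℝ) ∂μ
        ≤ ∫⁻ x, ENNReal.ofReal k * ENNReal.ofReal (η x) ∂μ := by
          refine lintegral_mono fun x => ?_
          rw [← ENNReal.ofReal_mul hk, ← ofReal_norm,
            ENNReal.ofReal_rpow_of_nonneg (norm_nonneg _) (by norm_num), Real.rpow_two]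
          exact ENNReal.ofReal_le_ofReal (hf x)
      _ = ENNReal.ofReal k * ∫⁻ x, ENNReal.ofReal (η x) ∂μ :=
          lintegral_const_mul' _ _ ENNReal.ofReal_ne_top
      _ ≤ ENNReal.ofReal k * ENNReal.ofReal β := by gcongr
      _ = ENNReal.ofReal r ^ (2 : ℝ) := by
          rw [← ENNReal.ofReal_mul hk, h, ENNReal.ofReal_rpow_of_nonneg hr (by norm_num),
            Real.rpow_two]
  rw [eLpNorm_eq_lintegral_rpow_enorm_toReal (by norm_num) (by norm_num)]
  simp only [ENNReal.toReal_ofNat]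
  calc _ ≤ (ENNReal.ofReal r ^ (2 : ℝ)) ^ (1 / (2 : ℝ)) := by gcongr
    _ = _ := by
      rw [← ENNReal.rpow_mul]
      norm_num

/-- Two bounded flows, the second of which is in equilibrium outside a ball, are as close in `L²` as
their relaxation parameters are. -/
theorem eLpNorm_le_of_bounds (hG : 0 < G) (he : ContDiffOn ℝ ∞ e₀ (Ioi 0))
    (hconv : ConvexOn ℝ (Ioi 0) e₀) {m L M R : ℝ} (hm : 0 < m) (hT : 0 ≤ T)
    (h₂ : IsSmoothSolution G e₀ ξ₂ T w₂) (hξ₂ : |ξ₂| ≤ M)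
    (hw₂ : ∀ t ∈ Ico 0 T, ∀ x, StateBound m (w₂ t x))
    (hL : ∀ j, ∀ q ∈ Ioo 0 T ×ˢ (univ : Set Space), TangentBound L (tangent w₂ q (spaceDir j)))
    (heq : ∀ t ∈ Ico 0 T, ∀ x : Space, R < ‖x‖ → relaxation (w₂ t x) = 0) :
    ∃ C : ℝ, ∀ (ξ₁ : ℝ) (w₁ : ℝ → Space → PrimState), |ξ₁| ≤ M →
      IsSmoothSolution G e₀ ξ₁ T w₁ → (∀ t ∈ Ico 0 T, ∀ x, StateBound m (w₁ t x)) →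
      w₁ 0 = w₂ 0 → ∀ t ∈ Ioo 0 T,
        eLpNorm (fun x => conserved (w₁ t x) - conserved (w₂ t x)) 2 volume
          ≤ ENNReal.ofReal (C * |ξ₁ - ξ₂|) := by
  obtain ⟨κ, c, v, K, hc, hv, hK, hk⟩ := exists_energy_constants hG he hconv m L M hm
  obtain ⟨B, hB0, hB⟩ := exists_norm_conserved_le m L M
  set V : ℝ := (volume (Metric.closedBall (0 : Space) R)).toReal with hV
  set γ : ℝ := B / c * (K * V * T * Real.exp (K * T)) with hγ
  have hγ0 : 0 ≤ γ := by positivity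
  refine ⟨√γ, fun ξ₁ w₁ hξ₁ h₁ hw₁ h0 t ht => ?_⟩
  set δ : ℝ := |ξ₁ - ξ₂| with hδ
  have hδ0 : 0 ≤ δ := abs_nonneg _
  have hcfg : ∀ s ∈ Ioo 0 T, ∀ x, configAt ξ₁ ξ₂ w₁ w₂ (s, x) ∈ configs m L M := fun s hs x =>
    ⟨hw₁ s (Ioo_subset_Ico_self hs) x, hw₂ s (Ioo_subset_Ico_self hs) x,
      fun j => hL j (s, x) ⟨hs, mem_univ _⟩, hξ₁, hξ₂⟩
  set η := energyDensity G (volEnergy G e₀) κ w₁ w₂ with hη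
  have hlow : ∀ x, c * distSq (w₁ t x) (w₂ t x) ≤ η (t, x) := fun x => (hk _ (hcfg t ht x)).1
  have hweighted : ∀ n : ℕ, ∫ x, coneWeight (3 * v) n 0 (t, x) * η (t, x)
      ≤ (n : ℝ) ^ 2 * (K * V * T * Real.exp (K * T) * δ ^ 2) := fun n => by
    refine (cone_estimate he hk hv.le hK.le h₁ h₂ (Nat.cast_nonneg n)
      (Ω := Metric.closedBall 0 R) Metric.isClosed_closedBall.measurableSet
      measure_closedBall_lt_top.ne ht.1.le ht.2 (fun s hs x _ => hcfg s ⟨hs.1, hs.2.trans ht.2⟩ x)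
      (fun x _ => by rw [h0]) (fun s hs x hx => heq s ⟨hs.1.le, hs.2.trans ht.2⟩ x
        (by simpa using hx))).trans ?_
    have h1 : t * Real.exp (K * t) ≤ T * Real.exp (K * T) :=
      mul_le_mul ht.2.le (Real.exp_le_exp.2 (mul_le_mul_of_nonneg_left ht.2.le hK.le))
        (Real.exp_pos _).le hT
    calc _ = (n : ℝ) ^ 2 * (K * δ ^ 2) * V * (t * Real.exp (K * t)) := by ring
      _ ≤ (n : ℝ) ^ 2 * (K * δ ^ 2) * V * (T * Real.exp (K * T)) :=
        mul_le_mul_of_nonneg_left h1 (by positivity)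
      _ = _ := by ring
  have hint := lintegral_le_of_weighted (η := η) (by positivity : 0 ≤ 3 * v) ht.1.le
    (continuous_slice (contDiffOn_energyDensity he h₁ h₂).continuousOn (Ioo_subset_Ico_self ht))
    (fun x => (mul_nonneg hc.le (distSq_nonneg _ _)).trans (hlow x)) hweighted
  refine eLpNorm_two_le_of_sq_le (k := B / c) (div_nonneg hB0 hc.le)
    (mul_nonneg (Real.sqrt_nonneg _) hδ0) (fun x => ?_) hint ?_
  · refine (hB (configAt ξ₁ ξ₂ w₁ w₂ (t, x)) (hcfg t ht x)).trans ?_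
    rw [div_mul_eq_mul_div, le_div_iff₀ hc, mul_assoc, mul_comm _ c]
    exact mul_le_mul_of_nonneg_left (hlow x) hB0
  · rw [mul_pow, Real.sq_sqrt hγ0, hγ]
    ring

end

end MaxwellFlow

end

theorem proposition2
    -- the material: elastic modulus `G > 0`, smooth convex energy `e₀` of the specific volume
    (G : ℝ) (hG : 0 < G) (e₀ : ℝ → ℝ)
    (he₀ : ContDiffOn ℝ ∞ e₀ (Ioi 0)) (he₀_convex : ConvexOn ℝ (Ioi 0) e₀)
    -- the second relaxation parameter, the upper bound for both, and the second flow
    (ξ₂ M : ℝ) (hξ₂ : 0 ≤ ξ₂) (T : ℝ) (w₂ : ℝ → MaxwellFlow.Space → MaxwellFlow.PrimState)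
    (hw₂ : MaxwellFlow.IsSmoothSolution G e₀ ξ₂ T w₂)
    -- the initial condition differs from a constant equilibrium in a bounded set only
    (wbar : MaxwellFlow.PrimState) (hwbar : wbar.IsEquilibrium) (R : ℝ)
    (hsupp : ∀ x : MaxwellFlow.Space, R < ‖x‖ → w₂ 0 x = wbar)
    -- a compact set of states
    (D : Set MaxwellFlow.ConsSpace) (hD : IsCompact D) (hDO : D ⊆ MaxwellFlow.hyperbolicDomain)
    -- a time horizon up to which the second flow is regular
    (T' : ℝ) (hT' : 0 < T') (hT'T : T' ≤ T)
    (hreg : T' < T ∨ MaxwellFlow.RegularUpTo T w₂) :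
    ∃ C : ℝ, ∀ ξ₁ : ℝ, ξ₂ ≤ ξ₁ → ξ₁ ≤ M →
      ∀ w₁ : ℝ → MaxwellFlow.Space → MaxwellFlow.PrimState,
        MaxwellFlow.IsSmoothSolution G e₀ ξ₁ T' w₁ →
        (∀ t ∈ Ico 0 T', ∀ x, MaxwellFlow.conserved (w₁ t x) ∈ D) →
        w₁ 0 = w₂ 0 →
        ∀ t ∈ Ioo 0 T',
          eLpNorm (fun x => MaxwellFlow.conserved (w₁ t x) - MaxwellFlow.conserved (w₂ t x))
              2 volume
            ≤ ENNReal.ofReal (C * |ξ₁ - ξ₂|) := by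
  obtain ⟨R', hR'⟩ := MaxwellFlow.finite_propagation hG he₀ he₀_convex hw₂ hwbar hsupp
  obtain ⟨m₁, hm₁⟩ := MaxwellFlow.exists_size_le hD hDO
  obtain ⟨⟨m₂, hm₂⟩, L, hL⟩ : (∃ m, ∀ t ∈ Ico 0 T', ∀ x, (w₂ t x).size ≤ m) ∧
      ∃ L, ∀ j, ∀ q ∈ Ioo 0 T' ×ˢ (univ : Set MaxwellFlow.Space),
        MaxwellFlow.TangentBound L (MaxwellFlow.tangent w₂ q (MaxwellFlow.spaceDir j)) := by
    rcases hreg with hlt | hreg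
    · exact MaxwellFlow.exists_bounds_of_lt hw₂ hlt hR'
    · obtain ⟨⟨m, hm⟩, L, hL⟩ := MaxwellFlow.exists_bounds_of_regular hw₂ hreg
      exact ⟨⟨m, fun t ht => hm t (Ico_subset_Ico_right hT'T ht)⟩, L, fun j q hq =>
        hL j q ⟨Ioo_subset_Ioo_right hT'T hq.1, hq.2⟩⟩
  have h₂ := hw₂.mono hT'T
  by_cases hM : ξ₂ ≤ M
  · have hb : ∀ t ∈ Ico 0 T', ∀ x, MaxwellFlow.StateBound (max m₁ m₂) (w₂ t x) := fun t ht x =>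
      (h₂.admissible t ht x).stateBound ((hm₂ t ht x).trans (le_max_right _ _))
    obtain ⟨C, hC⟩ := MaxwellFlow.eLpNorm_le_of_bounds hG he₀ he₀_convex
      (hb 0 ⟨le_rfl, hT'⟩ 0).m_pos hT'.le h₂ (M := M) (by rwa [abs_of_nonneg hξ₂]) hb hL
      (R := R') fun t ht x hx => by
        rw [hR' t (Ico_subset_Ico_right hT'T ht) x hx]
        exact hwbar.relaxation_eq_zero
    refine ⟨C, fun ξ₁ h21 h1M w₁ h₁ hw₁D h0 t ht => ?_⟩
    refine hC ξ₁ w₁ (by rwa [abs_of_nonneg (hξ₂.trans h21)]) h₁ (fun s hs x => ?_) h0 t ht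
    exact (h₁.admissible s hs x).stateBound
      ((hm₁ _ (h₁.admissible s hs x) (hw₁D s hs x)).trans (le_max_left _ _))
  · exact ⟨0, fun ξ₁ h21 h1M => absurd (h21.trans h1M) hM⟩
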